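/- An oriented singular link in $S^3$ is a non-empty closed oriented 1-manifold immersed (piecewise linearly or smoothly) in $S^3$ whose only singularities are finitely many transverse double points (contracted thick edges); such links are considered up to isotopy that keeps the double points rigid, i.e. they are given by generic oriented diagrams in the plane with ordinary and singular crossings, modulo planar isotopy and the ordinary and singular (rigid-vertex) Reidemeister moves. For a singular point $v$ of $K$ let $K^+$, $K^-$ and $K^o$ be the oriented singular links obtained by replacing $v$ by a positive crossing, by a negative crossing, and by the oriented resolution (smoothing) respectively, the rest of the diagram being unchanged. For an ordinary (non-singular) oriented link $K$ let $\Delta_K(T)\in\mathbb Z[T^{1/2},T^{-1/2}]$ be its one-variable symmetrized Alexander polynomial: the first minor of the Fox matrix of a Wirtinger presentation in which all meridians are sent to $T$, multiplied by the unit $\pm T^{k/2}$ for which $\Delta_K(T^{-1})=(-1)^{c-1}\Delta_K(T)$, where $c$ is the number of components, and with the usual (Conway) choice of sign, for which the unknot has polynomial $1$ and the positive Hopf link has polynomial $T^{1/2}-T^{-1/2}$. **Proposition.** There is one and only one function $K\mapsto\widetilde\Delta_K(T)\in\mathbb Z[T^{1/2},T^{-1/2}]$ on the set of isotopy classes of oriented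 singular links such that $\widetilde\Delta_K=\Delta_K$ for every non-singular oriented link $K$, and such that for every oriented singular link $K$ and every singular point $v$ of $K$ $$\widetilde\Delta_{K^+}(T)=\widetilde\Delta_K(T)+T^{\frac12}\,\widetilde\Delta_{K^o}(T),\qquad \widetilde\Delta_{K^-}(T)=\widetilde\Delta_K(T)+T^{-\frac12}\,\widetilde\Delta_{K^o}(T).$$ -/

import Mathlib

/-!
Oriented singular links in the 3-sphere, presented by generic projections.

A generic projection is cut by horizontal lines into slices, each of which contains vertical strands
and exactly one elementary piece: a minimum, a maximum, an ordinary crossing or a singular point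
(a contracted thick edge).  Two such diagrams represent the same oriented singular link exactly when
they are related by planar isotopies and by the Reidemeister moves for ordinary and for singular
(rigid vertex) crossings.  Links are therefore equivalence classes of sliced diagrams.
-/

namespace SingLink

open LaurentPolynomial

/-! ### Diagrams -/

/-- The direction of a strand at a point of a horizontal line: upwards (`up`) or downwards (`dn`). -/
abbrev up : Bool := true

/-- The downward direction. -/
abbrev dn : Bool := false

/-- The elementary pieces of an oriented singular link diagram.  Crossings and singular points are
drawn with both strands pointing upwards (other positions are obtained with minima and maxima).
* `cup x`: a local minimum, whose left end has direction `x` and whose right end has direction `!x`;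
* `cap x`: a local maximum, whose left end has direction `x` and whose right end has direction `!x`;
* `crossing true`: a positive crossing, the strand from bottom left to top right is the over-strand;
* `crossing false`: a negative crossing, the strand from bottom right to top left is the
  over-strand;
* `sing`: a singular point, both strands pointing upwards. -/
inductive Piece where
  | cup (x : Bool)
  | cap (x : Bool)
  | crossing (positive : Bool)
  | sing

/-- The directions of the strands at the bottom of a piece, from left to right. -/
def Piece.src : Piece → List Bool
  | .cup _ => []
  | .cap x => [x, !x]
  | .crossing _ => [up, up]
  | .sing => [up, up]

/-- The directions of the strands at the top of a piece, from left to right. -/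
def Piece.tgt : Piece → List Bool
  | .cup x => [x, !x]
  | .cap _ => []
  | .crossing _ => [up, up]
  | .sing => [up, up]

/-- A slice: one piece, with vertical strands of the given directions to its left and right. -/
structure Slice where
  left : List Bool
  piece : Piece
  right : List Bool

/-- The directions of all strands at the bottom of a slice. -/
def Slice.src (s : Slice) : List Bool := s.left ++ s.piece.src ++ s.right

/-- The directions of all strands at the top of a slice. -/
def Slice.tgt (s : Slice) : List Bool := s.left ++ s.piece.tgt ++ s.right

/-- Add vertical strands on both sides of a slice. -/
def Slice.widen (l r : List Bool) (s : Slice) : Slice := ⟨l ++ s.left, s.piece, s.right ++ r⟩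

/-- `Fits a w b`: the slices of `w`, stacked from bottom to top, fit together and form a diagram
from the horizontal line with strands `a` to the horizontal line with strands `b`. -/
def Fits : List Bool → List Slice → List Bool → Prop
  | a, [], b => a = b
  | a, s :: w, b => s.src = a ∧ Fits s.tgt w b

/-- A diagram of a non-empty oriented singular link. -/
structure Diagram where
  slices : List Slice
  nonempty : slices ≠ []
  closed : Fits [] slices []

/-- A diagram without singular points, i.e. a diagram of an ordinary oriented link. -/
def Diagram.IsNonsingular (D : Diagram) : Prop := ∀ s ∈ D.slices, s.piece ≠ Piece.sing

/-! ### Isotopy -/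

/-- A crossing of the given sign with the left strand pointing upwards and the right strand pointing
downwards at the bottom. -/
def sideR (e : Bool) : List Slice :=
  [⟨[], .cup dn, [up, dn]⟩, ⟨[dn], .crossing e, [dn]⟩, ⟨[dn, up], .cap up, []⟩]

/-- A crossing of the given sign with the left strand pointing downwards and the right strand
pointing upwards at the bottom. -/
def sideL (e : Bool) : List Slice :=
  [⟨[dn, up], .cup up, []⟩, ⟨[dn], .crossing e, [dn]⟩, ⟨[], .cap dn, [up, dn]⟩]

/-- The local moves. -/
inductive LocalMove : List Slice → List Slice → Prop
  /- planar isotopy: straightening a strand of direction `x` -/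
  | zig (x : Bool) : LocalMove [⟨[x], .cup (!x), []⟩, ⟨[], .cap x, [x]⟩] []
  | zag (x : Bool) : LocalMove [⟨[], .cup x, [x]⟩, ⟨[x], .cap (!x), []⟩] []
  /- planar isotopy: exchanging the heights of two pieces, the strands `m` running between them -/
  | interchange (p q : Piece) (m : List Bool) : LocalMove
      [⟨[], p, m ++ q.src⟩, ⟨p.tgt ++ m, q, []⟩]
      [⟨p.src ++ m, q, []⟩, ⟨[], p, m ++ q.tgt⟩]
  /- planar isotopy: a half turn to the left and a half turn to the right of a crossing or of a
  singular point give the same result -/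
  | rotate (p : Piece) (hp : p.src = [up, up]) (hp' : p.tgt = [up, up]) : LocalMove
      [⟨[dn, dn], .cup up, []⟩, ⟨[dn, dn, up], .cup up, [dn]⟩, ⟨[dn, dn], p, [dn, dn]⟩,
        ⟨[dn], .cap dn, [up, dn, dn]⟩, ⟨[], .cap dn, [dn, dn]⟩]
      [⟨[], .cup dn, [dn, dn]⟩, ⟨[dn], .cup dn, [up, dn, dn]⟩, ⟨[dn, dn], p, [dn, dn]⟩,
        ⟨[dn, dn, up], .cap up, [dn]⟩, ⟨[dn, dn], .cap up, []⟩]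
  /- first Reidemeister move: removing a kink -/
  | kinkR (e : Bool) : LocalMove
      [⟨[up], .cup up, []⟩, ⟨[], .crossing e, [dn]⟩, ⟨[up], .cap up, []⟩] []
  | kinkL (e : Bool) : LocalMove
      [⟨[], .cup dn, [up]⟩, ⟨[dn], .crossing e, []⟩, ⟨[], .cap dn, [up]⟩] []
  /- second Reidemeister move, for parallel and for antiparallel strands -/
  | cancel (e : Bool) : LocalMove [⟨[], .crossing e, []⟩, ⟨[], .crossing (!e), []⟩] []
  | cancelRL (e : Bool) : LocalMove (sideR e ++ sideL (!e)) []
  | cancelLR (e : Bool) : LocalMove (sideL e ++ sideR (!e)) []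
  /- third Reidemeister move -/
  | braid (e : Bool) : LocalMove
      [⟨[], .crossing e, [up]⟩, ⟨[up], .crossing e, []⟩, ⟨[], .crossing e, [up]⟩]
      [⟨[up], .crossing e, []⟩, ⟨[], .crossing e, [up]⟩, ⟨[up], .crossing e, []⟩]
  /- singular moves: a strand passes over or under a singular point -/
  | slide (e : Bool) : LocalMove
      [⟨[], .crossing e, [up]⟩, ⟨[up], .crossing e, []⟩, ⟨[], .sing, [up]⟩]
      [⟨[up], .sing, []⟩, ⟨[], .crossing e, [up]⟩, ⟨[up], .crossing e, []⟩]
  /- singular moves: a flip of the rigid vertex about its vertical axis -/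
  | flip (e : Bool) : LocalMove
      [⟨[], .crossing e, []⟩, ⟨[], .sing, []⟩] [⟨[], .sing, []⟩, ⟨[], .crossing e, []⟩]

/-- Two diagrams differ by a local move, performed in one place of the diagram. -/
def Move (D D' : Diagram) : Prop :=
  ∃ (below above : List Slice) (l r : List Bool) (u v : List Slice), LocalMove u v ∧
    D.slices = below ++ u.map (Slice.widen l r) ++ above ∧
    D'.slices = below ++ v.map (Slice.widen l r) ++ above

/-- Oriented singular links up to isotopy: diagrams modulo the equivalence relation generated by
the moves. -/
def Link : Type := Quot Move

/-- The oriented singular link represented by a diagram. -/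
def Diagram.link (D : Diagram) : Link := Quot.mk Move D

/-- `IsResolution D Dpos Dneg Dzero`: the diagrams `Dpos`, `Dneg` and `Dzero` are obtained from `D`
by replacing one singular point by a positive crossing, by a negative crossing, and by two vertical
strands (the oriented resolution), respectively. -/
def IsResolution (D Dpos Dneg Dzero : Diagram) : Prop :=
  ∃ (below above : List Slice) (l r : List Bool),
    D.slices = below ++ ⟨l, .sing, r⟩ :: above ∧
    Dpos.slices = below ++ ⟨l, .crossing true, r⟩ :: above ∧
    Dneg.slices = below ++ ⟨l, .crossing false, r⟩ :: above ∧
    Dzero.slices = below ++ above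

/-! ### The Alexander polynomial of ordinary links

Polynomials are elements of `ℤ[T^{1/2}, T^{-1/2}]`, the ring of integral Laurent polynomials in
the variable `T^{1/2}`. -/

/-- The monomial `T^{n/2}`. -/
noncomputable def halfPow (n : ℤ) : ℤ[T;T⁻¹] := LaurentPolynomial.T n

/-- The horizontal line at height `k`: its strands, from left to right. -/
def level (w : List Slice) : ℕ → List Bool
  | 0 => []
  | k + 1 => (w[k]?).elim [] Slice.tgt

/-- The points in which the horizontal lines meet the diagram. -/
abbrev Pt (w : List Slice) : Type := (k : Fin (w.length + 1)) × Fin (level w k).length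

/-- The Wirtinger relations at a piece, abelianised by Fox calculus (every meridian is sent to the
variable).  Each end point of a piece at which the link leaves the piece is a linear combination of
the end points at which the link enters it; `p.coeff a i b j` is the coefficient of the end point
`(b, j)` in the expression of the end point `(a, i)`.  Here `(true, i)` and `(false, i)` denote the
`i`-th end points at the top and at the bottom, counted from the left, starting at `0`.

At a crossing of sign `e` the leaving end of the over-strand equals its entering end, and
`y' = T^{-e} y + (1 - T^{-e}) x`, where `y` and `y'` are the entering and the leaving end of the
under-strand and `x` is the over-strand. -/
noncomputable def Piece.coeff : Piece → Bool → ℕ → Bool → ℕ → ℤ[T;T⁻¹]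
  | .cup true, true, 0, true, 1 => 1
  | .cup false, true, 1, true, 0 => 1
  | .cap true, false, 1, false, 0 => 1
  | .cap false, false, 0, false, 1 => 1
  | .crossing true, true, 1, false, 0 => 1
  | .crossing true, true, 0, false, 1 => halfPow (-2)
  | .crossing true, true, 0, false, 0 => 1 - halfPow (-2)
  | .crossing false, true, 0, false, 1 => 1
  | .crossing false, true, 1, false, 0 => halfPow 2
  | .crossing false, true, 1, false, 1 => 1 - halfPow 2
  | _, _, _, _, _ => 0

/-- The number of strands of a piece at its top (`true`) or bottom (`false`). -/
def Piece.width (p : Piece) (a : Bool) : ℕ := if a then p.tgt.length else p.src.length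

/-- The same coefficients for a whole slice: along a vertical strand, the leaving end equals the
entering end. -/
noncomputable def Slice.coeff (s : Slice) (a : Bool) (i : ℕ) (b : Bool) (j : ℕ) : ℤ[T;T⁻¹] :=
  let n := s.left.length
  if i < n then
    if j = i ∧ s.left[i]? = some a ∧ b = !a then 1 else 0
  else if i < n + s.piece.width a then
    if n ≤ j ∧ j < n + s.piece.width b then s.piece.coeff a (i - n) b (j - n) else 0
  else
    let i' := i - (n + s.piece.width a)
    if j = n + s.piece.width b + i' ∧ s.right[i']? = some a ∧ b = !a then 1 else 0

/-- The coefficients of the relations of the whole diagram.  The slice number `k` lies between the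
lines at heights `k` and `k + 1`. -/
noncomputable def relCoeff (w : List Slice) : Matrix (Pt w) (Pt w) ℤ[T;T⁻¹] :=
  fun P Q => ∑ k : Fin w.length, ∑ a : Bool, ∑ b : Bool,
    if P.1.val = k.val + a.toNat ∧ Q.1.val = k.val + b.toNat then
      (w[k]).coeff a P.2 b Q.2
    else 0

/-- The Alexander matrix of the diagram, i.e. the Fox matrix of the Wirtinger presentation: the row
of `P` is the relation that expresses `P`. -/
noncomputable def alexanderMatrix (w : List Slice) : Matrix (Pt w) (Pt w) ℤ[T;T⁻¹] :=
  1 - relCoeff w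

/-- The base point: the left end of the first minimum of the diagram. -/
def IsBase {w : List Slice} (P : Pt w) : Prop := P.1.val = 1 ∧ P.2.val = 0

instance {w : List Slice} : DecidablePred (IsBase (w := w)) :=
  fun _ => inferInstanceAs (Decidable (_ ∧ _))

/-- The sign of a crossing. -/
def Piece.sign : Piece → ℤ
  | .crossing true => 1
  | .crossing false => -1
  | _ => 0

/-- The contribution to the rotation number: `1` for a counterclockwise minimum and `-1` for a
clockwise maximum.  These are the points at which the tangent vector points to the right. -/
def Piece.turn : Piece → ℤ
  | .cup false => 1
  | .cap true => -1
  | _ => 0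

/-- The writhe of the diagram. -/
def writhe (w : List Slice) : ℤ := (w.map fun s => s.piece.sign).sum

/-- The rotation number (Whitney degree) of the diagram. -/
def rotation (w : List Slice) : ℤ := (w.map fun s => s.piece.turn).sum

/-- The correction for the base point: `1` if the first minimum is clockwise, and `-1` if it is
counterclockwise. -/
def baseSign (w : List Slice) : ℤ :=
  match w.head? with
  | some ⟨_, .cup true, _⟩ => 1
  | _ => -1

/-- The one-variable symmetrized Alexander polynomial of an ordinary oriented link, computed from a
diagram: the first minor of the Alexander matrix at the base point, multiplied by the power of
`T^{1/2}` for which the result `A` satisfies `A(T⁻¹) = (-1)^(c-1) A(T)`, where `c` is the number of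
components.  The sign is the usual one: the unknot has polynomial `1` and the positive Hopf link has
polynomial `T^{1/2} - T^{-1/2}`. -/
noncomputable def Diagram.alexander (D : Diagram) : ℤ[T;T⁻¹] :=
  halfPow (writhe D.slices + rotation D.slices + baseSign D.slices) *
    ((alexanderMatrix D.slices).submatrix
      (fun P : {P : Pt D.slices // ¬ IsBase P} => P.1)
      (fun P : {P : Pt D.slices // ¬ IsBase P} => P.1)).det

end SingLink

/-! Uniqueness is an induction on the number of singular points: the relation for `K⁺` expresses the
value at `K` through two diagrams with one singular point less (`Link.eq_of_resolution`).

For existence, give each upward vertical piece a weight `s` and let it act on Wirtinger labels by `1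
+ s N`, where `N` is a fixed matrix of rank one. Weight `0` is the oriented smoothing, weight `1`
the positive crossing, weight `T` the negative crossing. A singular point receives an indeterminate
weight `X`, so that a diagram has an Alexander matrix over `ℤ[T^{1/2}, T^{-1/2}][X]`.

The rows of this matrix satisfy a linear relation whose coefficients are powers of `T` given by the
Alexander numbering of the regions (`Stack.weight_vecMul_mat`), and its rows sum to zero. Hence the
first minor divided by the weight of its base point does not depend on the base point
(`Stack.val_eq`). It is unchanged when a part of the diagram is replaced by another one that imposes
the same conditions on the boundary labels, provided the labels of both parts can be eliminated by
unitriangular systems (`Transfer.wval_eq`). This covers all moves except kinks, and the moves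
involving singular points hold for an arbitrary weight. A kink multiplies the minor by a unit that
is compensated by a power of `T^{1/2}` built from writhe and rotation number. So `wordPoly` is an
isotopy invariant in `X` (`Move.invariance`), and it is the Alexander polynomial when there is no
singular point (`wordPoly_eq_alexander`).

Since `N` has rank one, the minor is affine in each weight (`wval_vert`). For a singular point of
`K` this gives `P(K) = f₀ + X f`, `P(K⁺) = T^{1/2} (f₀ + f)`, `P(K⁻) = T^{-1/2} (f₀ + T f)` and
`P(K^o) = f₀` (`wordPoly_resolution`). Therefore `P(K)` has degree at most the number `n` of
singular points, and `T^{n/2}` times its coefficient of `X^n` satisfies both required relations. -/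

namespace SingLink

open LaurentPolynomial

/-! ### Determinants: rank one perturbations, elimination of variables, first minors. -/

section LinearAlgebra

open Matrix

variable {R α β : Type*} [CommRing R] [Fintype α] [DecidableEq α] [Fintype β] [DecidableEq β]

/-- The determinant is affine along a line of rank one perturbations. -/
theorem det_add_smul_vecMulVec (A : Matrix α α R) (c r : α → R) (s : R) :
    (A + s • vecMulVec c r).det = A.det + s * ((A + vecMulVec c r).det - A.det) := by
  -- The perturbed matrix is the Schur complement of the corner `1` in a bordered matrix in which
  -- `s` occurs in a single column, and linearly.
  have key : ∀ s : R, (A + s • vecMulVec c r).det =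
      ((fromBlocks A 0 (replicateRow Unit r) 1).updateCol (Sum.inr ())
        (s • Sum.elim (-c) (fun _ => (0 : R)) +
          Sum.elim (fun _ => (0 : R)) (fun _ => 1))).det := by
    intro s
    have h1 : A + s • vecMulVec c r =
        A - replicateCol Unit (-(s • c)) * replicateRow Unit r := by
      ext i j
      simp [Matrix.mul_apply, vecMulVec_apply, mul_assoc]
    rw [h1, ← det_fromBlocks_one₂₂]
    congr 1
    ext (i | i) (j | j) <;> simp
  have h0 := key 0
  have h1 := key 1
  rw [key s]
  rw [det_updateCol_add, det_updateCol_smul] at *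
  simp only [zero_smul, add_zero, one_smul] at h0 h1
  rw [h0, h1]
  ring

/-- A matrix that is unitriangular with respect to a grading has determinant one. -/
theorem det_eq_one_of_order (N : Matrix α α R) (o : α → ℕ) (hd : ∀ a, N a a = 1)
    (h : ∀ a b, a ≠ b → o a ≤ o b → N a b = 0) : N.det = 1 := by
  have ht : N.BlockTriangular (OrderDual.toDual ∘ o) := by
    intro i j hij
    have hij' : o i < o j := hij
    exact h i j (by rintro rfl; exact lt_irrefl _ hij') hij'.le
  rw [ht.det]
  refine Finset.prod_eq_one fun k _ => ?_
  have : N.toSquareBlock (OrderDual.toDual ∘ o) k = 1 := by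
    ext ⟨i, hi⟩ ⟨j, hj⟩
    by_cases hij : i = j
    · subst hij; simp [toSquareBlock_def, hd]
    · rw [one_apply_ne (by simpa using hij)]
      refine h i j hij (le_of_eq ?_)
      exact OrderDual.toDual.injective (hi.trans hj.symm)
  rw [this, det_one]

/-- Both determinants are those of the Schur complements, because the eliminated blocks have
determinant one. Given `x`, the eliminated variables are forced to be `-D⁻¹ C x`, so `hext` says
that the two Schur complements send `x` to the same vector. One direction of extension is enough. -/
theorem det_fromBlocks_eq_of_extend {ε : Type*} [Fintype ε] [DecidableEq ε]
    (A : Matrix ε ε R) (B : Matrix ε α R) (C : Matrix α ε R) (D : Matrix α α R)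
    (A' : Matrix ε ε R) (B' : Matrix ε β R) (C' : Matrix β ε R) (D' : Matrix β β R)
    (hI : D.det = 1) (hI' : D'.det = 1)
    (hext : ∀ x y, C *ᵥ x + D *ᵥ y = 0 → ∃ y', C' *ᵥ x + D' *ᵥ y' = 0 ∧
      A' *ᵥ x + B' *ᵥ y' = A *ᵥ x + B *ᵥ y) :
    (fromBlocks A B C D).det = (fromBlocks A' B' C' D').det := by
  let _ := invertibleOfIsUnitDet D (by rw [hI]; exact isUnit_one)
  let _ := invertibleOfIsUnitDet D' (by rw [hI']; exact isUnit_one)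
  rw [det_fromBlocks₂₂, det_fromBlocks₂₂, hI, hI', one_mul, one_mul]
  congr 1
  suffices h : ∀ x, (A - B * ⅟D * C) *ᵥ x = (A' - B' * ⅟D' * C') *ᵥ x from
    Matrix.ext_of_mulVec_single fun i => h _
  intro x
  obtain ⟨y', h0, h1⟩ := hext x (-(⅟D *ᵥ (C *ᵥ x))) (by
    rw [mulVec_neg, mulVec_mulVec, mul_invOf_self, one_mulVec, add_neg_cancel])
  have h3 : y' = -(⅟D' *ᵥ (C' *ᵥ x)) := by
    have h4 := congrArg (fun v => ⅟D' *ᵥ v) h0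
    simp only [mulVec_add, mulVec_mulVec, invOf_mul_self, one_mulVec, mulVec_zero] at h4
    rw [mulVec_mulVec]
    exact eq_neg_of_add_eq_zero_right h4
  rw [h3] at h1
  simp only [mulVec_neg, mulVec_mulVec, ← Matrix.mul_assoc] at h1
  rw [sub_mulVec, sub_mulVec, sub_eq_add_neg, sub_eq_add_neg, h1]

/-- Two square matrices have the same determinant if they become equal after eliminating a
unimodular block of variables from each of them. -/
theorem det_eq_of_extend (M : Matrix α α R) (M' : Matrix β β R) (p : α → Prop) (p' : β → Prop)
    [DecidablePred p] [DecidablePred p'] (e : {a // p a} ≃ {b // p' b})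
    (hI : (M.toSquareBlockProp fun a => ¬ p a).det = 1)
    (hI' : (M'.toSquareBlockProp fun b => ¬ p' b).det = 1)
    (hext : ∀ y : α → R, (∀ a, ¬ p a → (M *ᵥ y) a = 0) →
      ∃ y' : β → R, (∀ b, ¬ p' b → (M' *ᵥ y') b = 0) ∧
        ∀ a : {a // p a}, y' (e a) = y a ∧ (M' *ᵥ y') (e a) = (M *ᵥ y) a) :
    M.det = M'.det := by
  set f : {a // p a} ⊕ {a // ¬ p a} ≃ α := Equiv.sumCompl p
  set f' : {a // p a} ⊕ {b // ¬ p' b} ≃ β :=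
    (Equiv.sumCongr e (Equiv.refl _)).trans (Equiv.sumCompl p')
  rw [← det_submatrix_equiv_self f M, ← det_submatrix_equiv_self f' M',
    ← fromBlocks_toBlocks (M.submatrix f f), ← fromBlocks_toBlocks (M'.submatrix f' f')]
  have hm : ∀ x y, Sum.elim
      ((M.submatrix f f).toBlocks₁₁ *ᵥ x + (M.submatrix f f).toBlocks₁₂ *ᵥ y)
      ((M.submatrix f f).toBlocks₂₁ *ᵥ x + (M.submatrix f f).toBlocks₂₂ *ᵥ y) =
      (M *ᵥ (Sum.elim x y ∘ f.symm)) ∘ f := by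
    intro x y
    rw [← submatrix_mulVec_equiv, ← fromBlocks_toBlocks (M.submatrix f f), fromBlocks_mulVec]
    rfl
  have hm' : ∀ x y, Sum.elim
      ((M'.submatrix f' f').toBlocks₁₁ *ᵥ x + (M'.submatrix f' f').toBlocks₁₂ *ᵥ y)
      ((M'.submatrix f' f').toBlocks₂₁ *ᵥ x + (M'.submatrix f' f').toBlocks₂₂ *ᵥ y) =
      (M' *ᵥ (Sum.elim x y ∘ f'.symm)) ∘ f' := by
    intro x y
    rw [← submatrix_mulVec_equiv, ← fromBlocks_toBlocks (M'.submatrix f' f'), fromBlocks_mulVec]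
    rfl
  refine det_fromBlocks_eq_of_extend _ _ _ _ _ _ _ _ hI hI' ?_
  intro x y hy
  obtain ⟨y', h1, h2⟩ := hext (Sum.elim x y ∘ f.symm)
    (fun a ha => (congrFun (hm x y) (Sum.inr ⟨a, ha⟩)).symm.trans (congrFun hy _))
  have hx : Sum.elim x (y' ∘ f' ∘ Sum.inr) ∘ f'.symm = y' := by
    rw [← Equiv.eq_comp_symm]
    funext i
    rcases i with i | i
    · refine Eq.trans ?_ (h2 i).1.symm
      change x i = Sum.elim x y (f.symm (f (Sum.inl i)))
      simp
    · rfl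
  refine ⟨y' ∘ f' ∘ Sum.inr, ?_, ?_⟩
  · funext i
    refine (congrFun (hm' x _) (Sum.inr i)).trans ?_
    rw [hx]
    exact h1 _ i.2
  · funext i
    refine (congrFun (hm' x _) (Sum.inl i)).trans ?_
    rw [hx]
    exact (h2 i).2.trans (congrFun (hm x y) (Sum.inl i)).symm

/-- The principal first minors of a matrix with a row relation and with vanishing row sums are
proportional to the coefficients of the row relation. -/
theorem adjugate_diag_mul_eq [IsDomain R] (M : Matrix α α R) (w : α → R) (hw : ∀ a, w a ≠ 0)
    (hc : M *ᵥ 1 = 0) (hr : w ᵥ* M = 0) (i j : α) :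
    M.adjugate i i * w j = M.adjugate j j * w i := by
  -- The difference is the determinant of `M` with row `j` replaced by `e_i - e_j`; this matrix
  -- kills the constant vector.
  have h1 : M.adjugate i j = M.adjugate j j := by
    rw [adjugate_apply, adjugate_apply, ← sub_eq_zero]
    have : ∀ u v : α → R, (M.updateRow j u).det - (M.updateRow j v).det =
        (M.updateRow j (u - v)).det := by
      intro u v
      have := det_updateRow_add M j (u - v) v
      rw [sub_add_cancel] at this
      rw [this]; ring
    rw [this]
    refine exists_mulVec_eq_zero_iff.1 ⟨1, ?_, ?_⟩
    · intro h; exact one_ne_zero (congrFun h i)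
    · funext k
      by_cases hk : k = j
      · subst hk
        simp [mulVec, dotProduct, updateRow_self]
      · have := congrFun hc k
        simpa [mulVec, dotProduct, updateRow_ne hk] using this
  -- Dually, the difference is the determinant of `M` with column `i` replaced by `w i • e_j - w j •
  -- e_i`, and `w` is a left null vector of this matrix.
  have h2 : M.adjugate i j * w i = M.adjugate i i * w j := by
    have hcol : ∀ k, M.adjugate i k = (M.updateCol i (Pi.single k 1)).det := by
      intro k
      rw [← transpose_apply M.adjugate, adjugate_transpose, adjugate_apply, updateRow_transpose,
        det_transpose]
    rw [hcol, hcol, ← sub_eq_zero, mul_comm _ (w i), mul_comm _ (w j), ← det_updateCol_smul,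
      ← det_updateCol_smul]
    have : ∀ u v : α → R, (M.updateCol i u).det - (M.updateCol i v).det =
        (M.updateCol i (u - v)).det := by
      intro u v
      have := det_updateCol_add M i (u - v) v
      rw [sub_add_cancel] at this
      rw [this]; ring
    rw [this]
    refine exists_vecMul_eq_zero_iff.1 ⟨w, ?_, ?_⟩
    · intro h; exact hw i (congrFun h i)
    · funext k
      by_cases hk : k = i
      · subst hk
        have : w ⬝ᵥ (w k • Pi.single j 1 - w j • Pi.single k 1) = 0 := by
          rw [dotProduct_sub, dotProduct_smul, dotProduct_smul, dotProduct_single_one,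
            dotProduct_single_one, smul_eq_mul, smul_eq_mul, mul_comm, sub_self]
        simpa only [vecMul, updateCol_self, Pi.zero_apply] using this
      · have := congrFun hr k
        simpa [vecMul, dotProduct, updateCol_ne hk] using this
  rw [← h2, h1]

/-- This links the minor of `Diagram.alexander`, where the base point is deleted by a predicate,
with the adjugate, for which base points can be compared. -/
theorem adjugate_diag_eq_det_minor (M : Matrix α α R) (p : α → Prop) [DecidablePred p] (i : α)
    (hp : ∀ a, p a ↔ a = i) :
    M.adjugate i i =
      (M.submatrix (fun a : {a // ¬ p a} => a.1) (fun a : {a // ¬ p a} => a.1)).det := by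
  rw [adjugate_apply, ← det_transpose,
    twoBlockTriangular_det _ (fun a => p a)]
  · have h1 : ((M.updateRow i (Pi.single i 1))ᵀ.toSquareBlockProp p) = 1 := by
      ext ⟨a, ha⟩ ⟨b, hb⟩
      obtain rfl := (hp a).1 ha
      obtain rfl := (hp b).1 hb
      simp [toSquareBlockProp_def]
    rw [h1, det_one, one_mul, ← det_transpose]
    congr 1
    ext ⟨a, ha⟩ ⟨b, hb⟩
    have : a ≠ i := fun h => ha ((hp a).2 h)
    simp [toSquareBlockProp_def, updateRow_ne this]
  · intro a ha b hb
    obtain rfl := (hp b).1 hb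
    have : a ≠ b := fun h => ha ((hp a).2 h)
    simp [this]

end LinearAlgebra

/-! ### Weighted diagrams -/

/-- The coefficients: polynomials in one variable, the weight of the singular points, over the ring
of Laurent polynomials. -/
abbrev Coef : Type := Polynomial ℤ[T;T⁻¹]

/-- The monomial `T^{n/2}` as a coefficient. -/
noncomputable def hp (n : ℤ) : Coef := Polynomial.C (halfPow n)

theorem halfPow_add (m n : ℤ) : halfPow (m + n) = halfPow m * halfPow n := T_add m n

theorem halfPow_zero : halfPow 0 = 1 := T_zero

theorem hp_add (m n : ℤ) : hp (m + n) = hp m * hp n := by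
  simp [hp, halfPow_add]

theorem hp_zero : hp 0 = 1 := by simp [hp, halfPow_zero]

theorem hp_ne_zero (n : ℤ) : hp n ≠ 0 := by
  intro h
  have h1 : hp n * hp (-n) = 1 := by rw [← hp_add, add_neg_cancel, hp_zero]
  rw [h, zero_mul] at h1
  exact zero_ne_one h1

theorem hp_two_mul : hp 2 * hp (-2) = 1 := by
  rw [← hp_add]; exact hp_zero

/-- The pieces of a weighted diagram.  The piece `vert s` generalises the two crossings (`s = 1` and
`s = T`) and two vertical strands (`s = 0`). -/
inductive GPiece where
  | cup (x : Bool)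
  | cap (x : Bool)
  | vert (s : Coef)

/-- The directions at the bottom (`false`) and at the top (`true`) of a piece. -/
def GPiece.ends : GPiece → Bool → List Bool
  | .cup x, true => [x, !x]
  | .cup _, false => []
  | .cap _, true => []
  | .cap x, false => [x, !x]
  | .vert _, _ => [up, up]

/-- The value which the relation of a piece prescribes at the end point `(a, i)` at which the link
leaves the piece, if `A` and `B` are the values at the bottom and at the top. -/
noncomputable def GPiece.out : GPiece → (ℕ → Coef) → (ℕ → Coef) → Bool → ℕ → Coef
  -- The ends of a turn have positions `0` and `1`, so `1 - i` is the other end.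
  | .cup _, _, B, _, i => B (1 - i)
  | .cap _, A, _, _, i => A (1 - i)
  -- This is the identity plus `s` times the rank one map `A ↦ (A 0 - A 1) • (-T⁻¹, 1)`. The weights
  -- `1` and `T` give the Burau matrices of the two crossings.
  | .vert s, A, _, _, 0 => (1 - s * hp (-2)) * A 0 + s * hp (-2) * A 1
  | .vert s, A, _, _, _ + 1 => s * A 0 + (1 - s) * A 1

/-- A slice of a weighted diagram. -/
structure GSlice where
  left : List Bool
  piece : GPiece
  right : List Bool

/-- The directions at the bottom (`false`) and at the top (`true`) of a slice. -/
def GSlice.ends (s : GSlice) (a : Bool) : List Bool := s.left ++ s.piece.ends a ++ s.right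

/-- The value which the relations of a slice prescribe at an end point at which the link leaves
the slice. -/
noncomputable def GSlice.out (s : GSlice) (A B : ℕ → Coef) (a : Bool) (i : ℕ) : Coef :=
  if i < s.left.length then (if a then A i else B i)
  else if i < s.left.length + (s.piece.ends a).length then
    s.piece.out (fun j => A (s.left.length + j)) (fun j => B (s.left.length + j)) a
      (i - s.left.length)
  else if a then
    A (s.left.length + (s.piece.ends false).length +
      (i - (s.left.length + (s.piece.ends a).length)))
  else
    B (s.left.length + (s.piece.ends true).length +
      (i - (s.left.length + (s.piece.ends a).length)))

/-- At the end point `(a, i)` the link leaves the piece. -/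
def GPiece.IsOut (p : GPiece) (a : Bool) (i : ℕ) : Prop := (p.ends a)[i]? = some a

/-- At the end point `(a, i)` the link leaves the slice. -/
def GSlice.IsOut (s : GSlice) (a : Bool) (i : ℕ) : Prop := (s.ends a)[i]? = some a

theorem getElem?_append_three {ρ : Type*} {l m r : List ρ} {i : ℕ} {x : ρ} :
    (l ++ m ++ r)[i]? = some x ↔ l[i]? = some x ∨ (∃ j, i = l.length + j ∧ m[j]? = some x) ∨
      ∃ j, i = l.length + m.length + j ∧ r[j]? = some x := by
  constructor
  · intro h
    by_cases h1 : i < l.length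
    · left
      rwa [List.append_assoc, List.getElem?_append_left h1] at h
    · by_cases h2 : i < l.length + m.length
      · right; left
        refine ⟨i - l.length, by omega, ?_⟩
        rwa [List.getElem?_append_left (by simpa using h2),
          List.getElem?_append_right (by omega)] at h
      · right; right
        refine ⟨i - (l.length + m.length), by omega, ?_⟩
        rwa [List.getElem?_append_right (by simp; omega), List.length_append] at h
  · rintro (h | ⟨j, rfl, h⟩ | ⟨j, rfl, h⟩)
    · have h1 : i < l.length := (List.getElem?_eq_some_iff.1 h).1
      rwa [List.append_assoc, List.getElem?_append_left h1]
    · have h1 : j < m.length := (List.getElem?_eq_some_iff.1 h).1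
      rw [List.getElem?_append_left (by simpa using h1), List.getElem?_append_right (by omega)]
      simpa using h
    · rw [List.getElem?_append_right (by simp)]
      simpa using h

/-- The end points at which the link leaves a slice, with the prescribed values. -/
theorem GSlice.isOut_iff (s : GSlice) (a : Bool) (i : ℕ) :
    s.IsOut a i ↔ s.left[i]? = some a ∨
      (∃ j, i = s.left.length + j ∧ s.piece.IsOut a j) ∨
      ∃ j, i = s.left.length + (s.piece.ends a).length + j ∧ s.right[j]? = some a :=
  getElem?_append_three

theorem GSlice.out_left (s : GSlice) (A B : ℕ → Coef) (a : Bool) {i : ℕ} {x : Bool}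
    (h : s.left[i]? = some x) : s.out A B a i = if a then A i else B i := by
  have h1 : i < s.left.length := (List.getElem?_eq_some_iff.1 h).1
  rw [GSlice.out, if_pos h1]

theorem GSlice.out_piece (s : GSlice) (A B : ℕ → Coef) (a : Bool) {j : ℕ}
    (h : s.piece.IsOut a j) : s.out A B a (s.left.length + j) =
      s.piece.out (fun j => A (s.left.length + j)) (fun j => B (s.left.length + j)) a j := by
  have h1 : j < (s.piece.ends a).length := (List.getElem?_eq_some_iff.1 h).1
  rw [GSlice.out, if_neg (by omega), if_pos (by omega), Nat.add_sub_cancel_left]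

theorem GSlice.out_right (s : GSlice) (A B : ℕ → Coef) (a : Bool) (j : ℕ) :
    s.out A B a (s.left.length + (s.piece.ends a).length + j) =
      if a then A (s.left.length + (s.piece.ends false).length + j)
      else B (s.left.length + (s.piece.ends true).length + j) := by
  rw [GSlice.out, if_neg (by omega), if_neg (by omega), Nat.add_sub_cancel_left]

theorem GPiece.out_add (p : GPiece) (A B A' B' : ℕ → Coef) (a : Bool) (i : ℕ) :
    p.out (A + A') (B + B') a i = p.out A B a i + p.out A' B' a i := by
  rcases p with x | x | s
  · rfl
  · rfl
  · cases i <;> simp [GPiece.out] <;> ring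

theorem GPiece.out_smul (p : GPiece) (c : Coef) (A B : ℕ → Coef) (a : Bool) (i : ℕ) :
    p.out (c • A) (c • B) a i = c * p.out A B a i := by
  rcases p with x | x | s
  · rfl
  · rfl
  · cases i <;> simp [GPiece.out] <;> ring

theorem GSlice.out_add (s : GSlice) (A B A' B' : ℕ → Coef) (a : Bool) (i : ℕ) :
    s.out (A + A') (B + B') a i = s.out A B a i + s.out A' B' a i := by
  simp only [GSlice.out]
  split_ifs
  · rfl
  · rfl
  · exact s.piece.out_add _ _ _ _ _ _
  · rfl
  · rfl

theorem GSlice.out_smul (s : GSlice) (c : Coef) (A B : ℕ → Coef) (a : Bool) (i : ℕ) :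
    s.out (c • A) (c • B) a i = c * s.out A B a i := by
  simp only [GSlice.out]
  split_ifs
  · rfl
  · rfl
  · exact s.piece.out_smul _ _ _ _ _
  · rfl
  · rfl

/-- A condition on labels of the end points of a slice, which consists of a condition on the ends of
each vertical strand and a condition on the ends of the piece. -/
def GSlice.Cond {ρ : Type*} (thr : Bool → ρ → ρ → Prop)
    (pc : GPiece → (ℕ → ρ) → (ℕ → ρ) → Prop) (s : GSlice) (A B : ℕ → ρ) : Prop :=
  (∀ i x, s.left[i]? = some x → thr x (A i) (B i)) ∧
  pc s.piece (fun j => A (s.left.length + j)) (fun j => B (s.left.length + j)) ∧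
  ∀ i x, s.right[i]? = some x →
    thr x (A (s.left.length + (s.piece.ends false).length + i))
      (B (s.left.length + (s.piece.ends true).length + i))

/-- The relations of a piece. -/
def GPiece.Rel : GPiece → (ℕ → Coef) → (ℕ → Coef) → Prop
  | .cup _, _, B => B 0 = B 1
  | .cap _, A, _ => A 0 = A 1
  | .vert s, A, B => B 0 = (1 - s * hp (-2)) * A 0 + s * hp (-2) * A 1 ∧
      B 1 = s * A 0 + (1 - s) * A 1

/-- The relations of a slice. -/
def GSlice.Rel (s : GSlice) : (ℕ → Coef) → (ℕ → Coef) → Prop :=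
  s.Cond (fun _ x y => x = y) GPiece.Rel

/-- `Rel` is convenient for solving the relations, while `out` assigns one equation to each leaving
end and so makes the Alexander matrix square. -/
theorem GPiece.rel_iff (p : GPiece) (A B : ℕ → Coef) :
    p.Rel A B ↔ ∀ a i, p.IsOut a i → (if a then B i else A i) = p.out A B a i := by
  rcases p with x | x | s
  · constructor
    · intro h a i hi
      cases x <;> cases a <;> rcases i with _ | _ | i <;>
        simp_all [GPiece.Rel, GPiece.IsOut, GPiece.ends, GPiece.out]
    · intro h
      cases x
      · exact (h true 1 rfl).symm
      · exact h true 0 rfl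
  · constructor
    · intro h a i hi
      cases x <;> cases a <;> rcases i with _ | _ | i <;>
        simp_all [GPiece.Rel, GPiece.IsOut, GPiece.ends, GPiece.out]
    · intro h
      cases x
      · exact h false 0 rfl
      · exact (h false 1 rfl).symm
  · constructor
    · intro h a i hi
      cases a <;> rcases i with _ | _ | i <;>
        simp_all [GPiece.Rel, GPiece.IsOut, GPiece.ends, GPiece.out]
    · intro h
      exact ⟨h true 0 rfl, h true 1 rfl⟩

theorem GSlice.rel_iff (s : GSlice) (A B : ℕ → Coef) :
    s.Rel A B ↔ ∀ a i, s.IsOut a i → (if a then B i else A i) = s.out A B a i := by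
  constructor
  · rintro ⟨h1, h2, h3⟩ a i hi
    rcases (s.isOut_iff a i).1 hi with h | ⟨j, rfl, h⟩ | ⟨j, rfl, h⟩
    · rw [s.out_left A B a h]
      cases a <;> simp [h1 i _ h]
    · rw [s.out_piece A B a h, ← (s.piece.rel_iff _ _).1 h2 a j h]
    · rw [s.out_right]
      have := h3 j _ h
      cases a <;> simp_all
  · intro h
    refine ⟨fun i x hx => ?_, ?_, fun j x hx => ?_⟩
    · have := h x i ((s.isOut_iff x i).2 (Or.inl hx))
      rw [s.out_left A B x hx] at this
      cases x <;> simp_all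
    · rw [GPiece.rel_iff]
      intro a j hj
      rw [← s.out_piece A B a hj]
      exact h a _ ((s.isOut_iff a _).2 (Or.inr (Or.inl ⟨j, rfl, hj⟩)))
    · have := h x _ ((s.isOut_iff x _).2 (Or.inr (Or.inr ⟨j, rfl, hx⟩)))
      rw [s.out_right] at this
      cases x <;> simp_all

theorem GPiece.out_congr (p : GPiece) {A B A' B' : ℕ → Coef} {a : Bool} {i : ℕ}
    (h : p.IsOut a i) (hA : ∀ j < (p.ends false).length, A j = A' j)
    (hB : ∀ j < (p.ends true).length, B j = B' j) : p.out A B a i = p.out A' B' a i := by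
  rcases p with x | x | s
  · exact hB _ (by simp [GPiece.ends])
  · exact hA _ (by simp [GPiece.ends])
  · have h0 := hA 0 (by simp [GPiece.ends])
    have h1 := hA 1 (by simp [GPiece.ends])
    cases i <;> simp [GPiece.out, h0, h1]

theorem GSlice.length_ends (s : GSlice) (a : Bool) :
    (s.ends a).length = s.left.length + (s.piece.ends a).length + s.right.length := by
  simp [GSlice.ends]; omega

theorem GSlice.out_congr (s : GSlice) {A B A' B' : ℕ → Coef} {a : Bool} {i : ℕ}
    (h : s.IsOut a i) (hA : ∀ j < (s.ends false).length, A j = A' j)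
    (hB : ∀ j < (s.ends true).length, B j = B' j) : s.out A B a i = s.out A' B' a i := by
  simp only [s.length_ends] at hA hB
  rcases (s.isOut_iff a i).1 h with h' | ⟨j, rfl, h'⟩ | ⟨j, rfl, h'⟩
  · have h1 : i < s.left.length := (List.getElem?_eq_some_iff.1 h').1
    rw [s.out_left _ _ a h', s.out_left _ _ a h', hA i (by omega), hB i (by omega)]
  · rw [s.out_piece _ _ a h', s.out_piece _ _ a h']
    exact s.piece.out_congr h' (fun j hj => hA _ (by omega)) (fun j hj => hB _ (by omega))
  · have h1 : j < s.right.length := (List.getElem?_eq_some_iff.1 h').1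
    rw [s.out_right, s.out_right, hA _ (by omega), hB _ (by omega)]

theorem GSlice.rel_congr (s : GSlice) {A B A' B' : ℕ → Coef} (h : s.Rel A B)
    (hA : ∀ j < (s.ends false).length, A j = A' j)
    (hB : ∀ j < (s.ends true).length, B j = B' j) : s.Rel A' B' := by
  rw [GSlice.rel_iff] at h ⊢
  intro a i hi
  rw [← s.out_congr hi hA hB, ← h a i hi]
  have hl : i < (s.ends a).length := (List.getElem?_eq_some_iff.1 hi).1
  cases a
  · simp [hA i hl]
  · simp [hB i hl]

/-! ### Stacks of slices and their Alexander matrices -/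

/-- A closed weighted diagram: `n` slices `sl 0, …, sl (n - 1)` between horizontal lines
`lev 0, …, lev n`. -/
structure Stack where
  n : ℕ
  lev : ℕ → List Bool
  sl : ℕ → GSlice
  lev_zero : lev 0 = []
  lev_last : lev n = []
  src : ∀ k < n, (sl k).ends false = lev k
  tgt : ∀ k < n, (sl k).ends true = lev (k + 1)

namespace Stack

variable (S : Stack)

/-- The points in which the horizontal lines meet the diagram. -/
abbrev Pt : Type := (k : Fin (S.n + 1)) × Fin (S.lev k).length

theorem ends_eq {k : ℕ} (hk : k < S.n) (a : Bool) : (S.sl k).ends a = S.lev (k + a.toNat) := by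
  cases a
  · exact S.src k hk
  · exact S.tgt k hk

/-- The number of the slice which the link leaves in a point. -/
def owner (k i : ℕ) : ℕ := if (S.lev k)[i]? = some true then k - 1 else k

/-- The defect of the relation at a point. -/
noncomputable def op (Y : ℕ → ℕ → Coef) (k i : ℕ) : Coef :=
  if (S.lev k)[i]? = some true then Y k i - (S.sl (k - 1)).out (Y (k - 1)) (Y k) true i
  else Y k i - (S.sl k).out (Y k) (Y (k + 1)) false i

/-- An upward point is left by the slice below it, a downward point by the slice above it. The lines
`0` and `n` are empty, so this slice always exists and the subtraction in `owner` is never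
truncated. -/
theorem owner_spec (P : S.Pt) : ∃ k < S.n, ∃ a : Bool, P.1.val = k + a.toNat ∧
    (S.sl k).IsOut a P.2 ∧ S.owner P.1 P.2 = k ∧
    ∀ Y, S.op Y P.1 P.2 = Y P.1 P.2 - (S.sl k).out (Y k) (Y (k + 1)) a P.2 := by
  obtain ⟨⟨k, hk⟩, ⟨i, hi⟩⟩ := P
  simp only at hi
  rcases hd : (S.lev k)[i]'hi with _ | _
  · have hd' : (S.lev k)[i]? = some false := by rw [List.getElem?_eq_getElem hi, hd]
    have hk' : k ≠ S.n := by
      rintro rfl; rw [S.lev_last] at hi; exact absurd hi (by simp)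
    refine ⟨k, by omega, false, rfl, ?_, by simp [owner, hd'], fun Y => by simp [op, hd']⟩
    rw [GSlice.IsOut, S.src k (by omega), hd']
  · have hd' : (S.lev k)[i]? = some true := by rw [List.getElem?_eq_getElem hi, hd]
    rcases k with _ | k
    · rw [S.lev_zero] at hi; exact absurd hi (by simp)
    · refine ⟨k, by omega, true, rfl, ?_, by simp [owner, hd'], fun Y => by simp [op, hd']⟩
      rw [GSlice.IsOut, S.tgt k (by omega), hd']

/-- The point at an end point at which the link leaves a slice. -/
theorem exists_pt {k : ℕ} (hk : k < S.n) {a : Bool} {i : ℕ} (h : (S.sl k).IsOut a i) :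
    ∃ P : S.Pt, P.1.val = k + a.toNat ∧ P.2.val = i ∧ S.owner P.1 P.2 = k ∧
    ∀ Y, S.op Y P.1 P.2 = Y P.1 P.2 - (S.sl k).out (Y k) (Y (k + 1)) a P.2 := by
  rw [GSlice.IsOut, S.ends_eq hk] at h
  have hi := (List.getElem?_eq_some_iff.1 h).1
  have ha : a.toNat ≤ 1 := by cases a <;> simp
  refine ⟨⟨⟨k + a.toNat, by omega⟩, ⟨i, hi⟩⟩, rfl, rfl, ?_, ?_⟩
  · cases a <;> simp_all [owner]
  · intro Y
    cases a <;> simp_all [op]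

/-- Labels of the points, as a function of the height and of the position. -/
noncomputable def ext (y : S.Pt → Coef) (k i : ℕ) : Coef :=
  if h : k < S.n + 1 then if h' : i < (S.lev k).length then y ⟨⟨k, h⟩, ⟨i, h'⟩⟩ else 0 else 0

theorem ext_pt (y : S.Pt → Coef) (P : S.Pt) : S.ext y P.1 P.2 = y P := by
  have h : P.1.val < S.n + 1 := P.1.2
  simp [ext, h]

/-- The restriction of labels to the points of a diagram. -/
def restr (Y : ℕ → ℕ → Coef) (P : S.Pt) : Coef := Y P.1 P.2

theorem ext_restr (Y : ℕ → ℕ → Coef) {k i : ℕ} (hk : k ≤ S.n) (hi : i < (S.lev k).length) :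
    S.ext (S.restr Y) k i = Y k i := by
  simp [ext, restr, hi, Nat.lt_succ_of_le hk]

theorem op_congr {Y Y' : ℕ → ℕ → Coef}
    (h : ∀ k ≤ S.n, ∀ i < (S.lev k).length, Y k i = Y' k i) (P : S.Pt) :
    S.op Y P.1 P.2 = S.op Y' P.1 P.2 := by
  obtain ⟨k, hk, a, h1, h2, -, h3⟩ := S.owner_spec P
  rw [h3, h3, h P.1 (by omega) P.2 P.2.2]
  congr 1
  refine (S.sl k).out_congr h2 ?_ ?_
  · rw [S.src k hk]; exact h k (by omega)
  · rw [S.tgt k hk]; exact h (k + 1) (by omega)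

/-- The Alexander matrix as a linear map. -/
noncomputable def opLin : (S.Pt → Coef) →ₗ[Coef] (S.Pt → Coef) where
  toFun y := fun P => S.op (S.ext y) P.1 P.2
  map_add' y z := by
    funext P
    obtain ⟨k, hk, a, h1, h2, -, h3⟩ := S.owner_spec P
    have he : S.ext (y + z) = S.ext y + S.ext z := by
      funext k i; simp only [ext, Pi.add_apply]; split_ifs <;> simp
    rw [Pi.add_apply, h3, h3, h3, he]
    simp only [Pi.add_apply, GSlice.out_add]
    ring
  map_smul' c y := by
    funext P
    obtain ⟨k, hk, a, h1, h2, -, h3⟩ := S.owner_spec P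
    have he : S.ext (c • y) = c • S.ext y := by
      funext k i; simp only [ext, Pi.smul_apply]; split_ifs <;> simp
    rw [RingHom.id_apply, Pi.smul_apply, h3, h3, he]
    simp only [Pi.smul_apply, GSlice.out_smul, smul_eq_mul]
    ring

/-- The Alexander matrix of a weighted diagram. -/
noncomputable def mat : Matrix S.Pt S.Pt Coef := LinearMap.toMatrix' S.opLin

theorem mat_mulVec (y : S.Pt → Coef) (P : S.Pt) :
    (S.mat.mulVec y) P = S.op (S.ext y) P.1 P.2 := by
  rw [mat, LinearMap.toMatrix'_mulVec]; rfl

theorem mat_mulVec_restr (Y : ℕ → ℕ → Coef) (P : S.Pt) :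
    (S.mat.mulVec (S.restr Y)) P = S.op Y P.1 P.2 := by
  rw [mat_mulVec]
  exact S.op_congr (fun k hk i hi => S.ext_restr Y hk hi) P

theorem mat_apply (P Q : S.Pt) :
    S.mat P Q = S.op (S.ext (Pi.single Q 1)) P.1 P.2 := by
  rw [← mat_mulVec, Matrix.mulVec_single_one]; rfl

theorem pt_ext {P Q : S.Pt} (h1 : P.1.val = Q.1.val) (h2 : P.2.val = Q.2.val) : P = Q := by
  obtain ⟨⟨k, hk⟩, ⟨i, hi⟩⟩ := P
  obtain ⟨⟨l, hl⟩, ⟨j, hj⟩⟩ := Q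
  simp only at h1 h2
  subst h1 h2
  rfl

theorem ext_single (Q : S.Pt) (k i : ℕ) :
    S.ext (Pi.single Q 1) k i = if k = Q.1.val ∧ i = Q.2.val then 1 else 0 := by
  by_cases h : k = Q.1.val ∧ i = Q.2.val
  · obtain ⟨rfl, rfl⟩ := h
    simp [ext_pt]
  · rw [if_neg h, ext]
    split_ifs with h1 h2
    · rw [Pi.single_eq_of_ne]
      rintro rfl
      exact h ⟨rfl, rfl⟩
    · rfl
    · rfl

end Stack

/-! ### Elimination of the slices of a part of a diagram -/

/-- A numbering of the end points of a piece which increases along the dependencies of its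
relations. -/
def GPiece.Ord : GPiece → (ℕ → ℕ) → (ℕ → ℕ) → Prop
  | .cup true, _, B => B 1 < B 0
  | .cup false, _, B => B 0 < B 1
  | .cap true, A, _ => A 0 < A 1
  | .cap false, A, _ => A 1 < A 0
  | .vert s, A, B => (s * hp (-2) ≠ 1 → A 0 < B 0) ∧ (s ≠ 0 → A 1 < B 0) ∧
      (s ≠ 0 → A 0 < B 1) ∧ (s ≠ 1 → A 1 < B 1)

/-- A numbering of the end points of a slice which increases along the dependencies of its
relations. -/
def GSlice.Ord (s : GSlice) : (ℕ → ℕ) → (ℕ → ℕ) → Prop :=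
  s.Cond (fun x a b => if x then a < b else b < a) GPiece.Ord

theorem GPiece.out_eq_zero (p : GPiece) {O O' : ℕ → ℕ} (hO : p.Ord O O') {a : Bool} {i : ℕ}
    (h : p.IsOut a i) {A B : ℕ → Coef} (hA : ∀ j, O j < (if a then O' i else O i) → A j = 0)
    (hB : ∀ j, O' j < (if a then O' i else O i) → B j = 0) : p.out A B a i = 0 := by
  rcases p with x | x | s
  · cases x <;> cases a <;> rcases i with _ | _ | i <;>
      simp_all [GPiece.Ord, GPiece.IsOut, GPiece.ends, GPiece.out]
  · cases x <;> cases a <;> rcases i with _ | _ | i <;>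
      simp_all [GPiece.Ord, GPiece.IsOut, GPiece.ends, GPiece.out]
  · obtain ⟨h1, h2, h3, h4⟩ := hO
    have key : ∀ (c : Coef) (j : ℕ), (c ≠ 0 → O j < (if a then O' i else O i)) → c * A j = 0 := by
      intro c j hc
      by_cases h0 : c = 0
      · rw [h0, zero_mul]
      · rw [hA j (hc h0), mul_zero]
    cases a
    · rcases i with _ | _ | i <;> simp_all [GPiece.IsOut, GPiece.ends]
    · rcases i with _ | _ | i
      · simp only [GPiece.out]
        rw [key, key, add_zero]
        · intro h; exact h2 (fun h0 => h (by rw [h0, zero_mul]))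
        · intro h; exact h1 (fun h0 => h (by rw [h0, sub_self]))
      · simp only [GPiece.out]
        rw [key, key, add_zero]
        · intro h; exact h4 (fun h0 => h (by rw [h0, sub_self]))
        · intro h; exact h3 h
      · simp [GPiece.IsOut, GPiece.ends] at h

theorem GSlice.out_eq_zero (s : GSlice) {O O' : ℕ → ℕ} (hO : s.Ord O O') {a : Bool} {i : ℕ}
    (h : s.IsOut a i) {A B : ℕ → Coef} (hA : ∀ j, O j < (if a then O' i else O i) → A j = 0)
    (hB : ∀ j, O' j < (if a then O' i else O i) → B j = 0) : s.out A B a i = 0 := by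
  obtain ⟨h1, h2, h3⟩ := hO
  rcases (s.isOut_iff a i).1 h with h' | ⟨j, rfl, h'⟩ | ⟨j, rfl, h'⟩
  · rw [s.out_left _ _ a h']
    have := h1 i _ h'
    cases a
    · exact hB _ (by simpa using this)
    · exact hA _ (by simpa using this)
  · rw [s.out_piece _ _ a h']
    exact s.piece.out_eq_zero h2 h' (fun j => hA _) (fun j => hB _)
  · rw [s.out_right]
    have := h3 j _ h'
    cases a
    · exact hB _ (by simpa using this)
    · exact hA _ (by simpa using this)

namespace Stack

variable (S S' : Stack)

/-- The point belongs to the relations of the slices `h, …, h + m - 1`. -/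
def Inside (h m : ℕ) (P : S.Pt) : Prop := h ≤ S.owner P.1 P.2 ∧ S.owner P.1 P.2 < h + m

instance (h m : ℕ) : DecidablePred (S.Inside h m) :=
  fun _ => inferInstanceAs (Decidable (_ ∧ _))

/-- In the rows of the eliminated points all off-diagonal entries sit at strictly smaller numbers,
so the block is unitriangular. The row replaced for the cofactor lies outside the block. -/
theorem det_inside (h m : ℕ) (Z : ℕ → ℕ → ℕ)
    (hZ : ∀ k, h ≤ k → k < h + m → (S.sl k).Ord (Z k) (Z (k + 1))) (P₀ : S.Pt)
    (v : S.Pt → Coef) (hP₀ : ¬ S.Inside h m P₀) :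
    ((S.mat.updateRow P₀ v).toSquareBlockProp fun P => ¬ ¬ S.Inside h m P).det = 1 := by
  have key : ∀ P Q : S.Pt, S.Inside h m P → Z P.1 P.2 ≤ Z Q.1 Q.2 →
      S.mat P Q = (Pi.single Q 1 : S.Pt → Coef) P := by
    intro P Q hP hPQ
    obtain ⟨k, hk, a, h1, h2, h3, h4⟩ := S.owner_spec P
    rw [Inside, h3] at hP
    rw [S.mat_apply, h4, S.ext_pt, GSlice.out_eq_zero _ (hZ k hP.1 hP.2) h2, sub_zero]
    · intro j hj
      rw [S.ext_single, if_neg]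
      rintro ⟨rfl, rfl⟩
      cases a <;> simp_all <;> omega
    · intro j hj
      rw [S.ext_single, if_neg]
      rintro ⟨hq, rfl⟩
      rw [hq] at hj
      cases a <;> simp_all <;> omega
  have hne : ∀ P : {P // ¬ ¬ S.Inside h m P}, P.1 ≠ P₀ := by
    rintro ⟨P, hP⟩ rfl
    exact hP hP₀
  refine det_eq_one_of_order _ (fun P => Z P.1.1 P.1.2) ?_ ?_
  · intro P
    rw [Matrix.toSquareBlockProp_def]
    simp only [Matrix.of_apply]
    rw [Matrix.updateRow_ne (hne P), key _ _ (not_not.1 P.2) le_rfl, Pi.single_eq_same]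
  · intro P Q hPQ hZPQ
    rw [Matrix.toSquareBlockProp_def]
    simp only [Matrix.of_apply]
    rw [Matrix.updateRow_ne (hne P), key _ _ (not_not.1 P.2) hZPQ, Pi.single_eq_of_ne]
    exact fun h => hPQ (Subtype.ext h)

variable {S S'}

/-- Two diagrams agree outside the slices `h, …, h + m - 1` of the first one and the slices
`h, …, h + m' - 1` of the second one. -/
structure Agree (S S' : Stack) (h m m' : ℕ) : Prop where
  le : h + m ≤ S.n
  n_eq : S.n + m' = S'.n + m
  low_lev : ∀ k ≤ h, S.lev k = S'.lev k
  low_sl : ∀ k < h, S.sl k = S'.sl k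
  high_lev : ∀ i, h + m + i ≤ S.n → S.lev (h + m + i) = S'.lev (h + m' + i)
  high_sl : ∀ i, h + m + i < S.n → S.sl (h + m + i) = S'.sl (h + m' + i)

namespace Agree

variable {h m m' : ℕ}

theorem symm (A : Agree S S' h m m') : Agree S' S h m' m where
  le := by have := A.le; have := A.n_eq; omega
  n_eq := A.n_eq.symm
  low_lev k hk := (A.low_lev k hk).symm
  low_sl k hk := (A.low_sl k hk).symm
  high_lev i hi := (A.high_lev i (by have := A.n_eq; omega)).symm
  high_sl i hi := (A.high_sl i (by have := A.n_eq; omega)).symm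

/-- The two points correspond to each other. -/
def Corr (S S' : Stack) (h m m' : ℕ) (P : S.Pt) (P' : S'.Pt) : Prop :=
  P.2.val = P'.2.val ∧ S.lev P.1 = S'.lev P'.1 ∧
    ((S.owner P.1 P.2 < h ∧ S'.owner P'.1 P'.2 = S.owner P.1 P.2 ∧ P.1.val = P'.1.val) ∨
      (h + m ≤ S.owner P.1 P.2 ∧ S'.owner P'.1 P'.2 + m = S.owner P.1 P.2 + m' ∧
        P'.1.val + m = P.1.val + m'))

/-- Points are matched through the slices that own them and not through heights alone: on a boundary
line a point is kept or eliminated according to its direction. -/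
theorem exists_corr (A : Agree S S' h m m') (P : S.Pt) (hP : ¬ S.Inside h m P) :
    ∃ P' : S'.Pt, ¬ S'.Inside h m' P' ∧ Corr S S' h m m' P P' := by
  obtain ⟨k, hk, a, h1, h2, h3, -⟩ := S.owner_spec P
  have hn := A.n_eq
  rw [Inside, h3] at hP
  by_cases hlow : k < h
  · rw [GSlice.IsOut, A.low_sl k hlow] at h2
    obtain ⟨P', h1', h2', h3', -⟩ := S'.exists_pt (k := k) (by have := A.le; omega) h2
    have hl : S.lev P.1 = S'.lev P'.1 := by
      rw [h1, h1', A.low_lev]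
      cases a <;> simp <;> omega
    exact ⟨P', by rw [Inside, h3']; omega, h2'.symm, hl, Or.inl (by omega)⟩
  · obtain ⟨i, rfl⟩ : ∃ i, k = h + m + i := ⟨k - (h + m), by omega⟩
    rw [GSlice.IsOut, A.high_sl i hk] at h2
    obtain ⟨P', h1', h2', h3', -⟩ := S'.exists_pt (k := h + m' + i) (by omega) h2
    have hl : S.lev P.1 = S'.lev P'.1 := by
      rw [h1, h1', add_assoc, add_assoc (h + m'), A.high_lev]
      cases a <;> simp <;> omega
    exact ⟨P', by rw [Inside, h3']; omega, h2'.symm, hl, Or.inr (by omega)⟩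

theorem Corr.symm {P : S.Pt} {P' : S'.Pt} (hc : Corr S S' h m m' P P') :
    Corr S' S h m' m P' P := by
  obtain ⟨h1, h2, h3⟩ := hc
  exact ⟨h1.symm, h2.symm, by omega⟩

theorem Corr.unique {P : S.Pt} {P' Q' : S'.Pt} (h1 : Corr S S' h m m' P P')
    (h2 : Corr S S' h m m' P Q') : P' = Q' := by
  obtain ⟨a1, a2, a3⟩ := h1
  obtain ⟨b1, b2, b3⟩ := h2
  exact pt_ext _ (by omega) (by omega)

/-- The point corresponding to a point that is not eliminated. -/
noncomputable def map (A : Agree S S' h m m') (P : {P : S.Pt // ¬ S.Inside h m P}) :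
    {P : S'.Pt // ¬ S'.Inside h m' P} :=
  ⟨(A.exists_corr P.1 P.2).choose, (A.exists_corr P.1 P.2).choose_spec.1⟩

theorem map_corr (A : Agree S S' h m m') (P : {P : S.Pt // ¬ S.Inside h m P}) :
    Corr S S' h m m' P.1 (A.map P).1 := (A.exists_corr P.1 P.2).choose_spec.2

/-- The bijection between the points that are not eliminated. -/
noncomputable def equiv (A : Agree S S' h m m') :
    {P : S.Pt // ¬ S.Inside h m P} ≃ {P : S'.Pt // ¬ S'.Inside h m' P} where
  toFun := A.map
  invFun := A.symm.map
  left_inv P := Subtype.ext ((A.symm.map_corr _).unique (A.map_corr P).symm)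
  right_inv P := Subtype.ext ((A.map_corr _).unique (A.symm.map_corr P).symm)

theorem equiv_corr (A : Agree S S' h m m') (P : {P : S.Pt // ¬ S.Inside h m P}) :
    Corr S S' h m m' P.1 (A.equiv P).1 := A.map_corr P

/-- If the relations of the differing parts have the same consequences for the labels of their
boundaries, then the two diagrams have the same first minors. -/
theorem adjugate_eq (A : Agree S S' h m m') (O O' : ℕ → ℕ → ℕ)
    (hO : ∀ k, h ≤ k → k < h + m → (S.sl k).Ord (O k) (O (k + 1)))
    (hO' : ∀ k, h ≤ k → k < h + m' → (S'.sl k).Ord (O' k) (O' (k + 1)))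
    (hrel : ∀ Y : ℕ → ℕ → Coef, (∀ i < m, (S.sl (h + i)).Rel (Y i) (Y (i + 1))) →
      ∃ Y' : ℕ → ℕ → Coef, (∀ i < m', (S'.sl (h + i)).Rel (Y' i) (Y' (i + 1))) ∧
        (∀ i < (S.lev h).length, Y' 0 i = Y 0 i) ∧
        ∀ i < (S.lev (h + m)).length, Y' m' i = Y m i)
    {P : S.Pt} {P' : S'.Pt} (hP : ¬ S.Inside h m P) (hc : Corr S S' h m m' P P') :
    S.mat.adjugate P P = S'.mat.adjugate P' P' := by
  have hPP : (A.equiv ⟨P, hP⟩).1 = P' := (A.equiv_corr _).unique hc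
  have hP' : ¬ S'.Inside h m' P' := by rw [← hPP]; exact (A.equiv _).2
  have hn := A.n_eq
  have hle := A.le
  rw [Matrix.adjugate_apply, Matrix.adjugate_apply]
  refine det_eq_of_extend _ _ (fun Q => ¬ S.Inside h m Q) (fun Q => ¬ S'.Inside h m' Q) A.equiv
    (S.det_inside h m O hO P _ hP) (S'.det_inside h m' O' hO' P' _ hP') ?_
  intro y hy
  have hupd : ∀ (S : Stack) (P Q : S.Pt) (y : S.Pt → Coef),
      ((S.mat.updateRow P (Pi.single P 1)).mulVec y) Q =
        if Q = P then y P else S.op (S.ext y) Q.1 Q.2 := by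
    intro S P Q y
    split_ifs with hQ
    · subst hQ; simp [Matrix.mulVec]
    · rw [← S.mat_mulVec]; simp [Matrix.mulVec, Matrix.updateRow_ne hQ]
  set Y := S.ext y with hY
  have hrelY : ∀ i < m, (S.sl (h + i)).Rel (Y (h + i)) (Y (h + (i + 1))) := by
    intro i hi
    rw [GSlice.rel_iff]
    intro a j hj
    obtain ⟨Q, h1, h2, h3, h4⟩ := S.exists_pt (k := h + i) (by omega) hj
    have hQ : S.Inside h m Q := by rw [Inside, h3]; omega
    have h5 := hy Q (not_not.2 hQ)
    rw [hupd, if_neg (by rintro rfl; exact hP hQ), h4, sub_eq_zero, h2] at h5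
    refine Eq.trans ?_ h5
    rw [h1]
    cases a <;> rfl
  obtain ⟨Z, hZ, hZ0, hZm⟩ := hrel (fun i => Y (h + i)) hrelY
  -- The old labels below, the labels `Z` on the new part including both its boundary lines, and the
  -- shifted old labels above. On the boundary lines `Z` agrees with the old labels.
  set Y' : ℕ → ℕ → Coef := fun k =>
    if k < h then Y k else if k ≤ h + m' then Z (k - h) else Y (k + m - m') with hY'
  have hYlow : ∀ k ≤ h, ∀ i < (S.lev k).length, Y' k i = Y k i := by
    intro k hk i hi
    by_cases hk' : k < h
    · simp [hY', hk']
    · obtain rfl : k = h := by omega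
      simp only [hY', lt_irrefl, if_false, if_pos (Nat.le_add_right k m'), Nat.sub_self]
      exact hZ0 i hi
  have hYmid : ∀ i ≤ m', Y' (h + i) = Z i := by
    intro i hi
    simp only [hY']
    rw [if_neg (by omega), if_pos (by omega), Nat.add_sub_cancel_left]
  have hYhigh : ∀ j, h + m + j ≤ S.n → ∀ i < (S.lev (h + m + j)).length,
      Y' (h + m' + j) i = Y (h + m + j) i := by
    intro j hj i hi
    rcases j with _ | j
    · rw [add_zero, hYmid m' le_rfl]
      exact hZm i hi
    · simp only [hY']
      rw [if_neg (by omega), if_neg (by omega)]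
      congr 1
      omega
  refine ⟨S'.restr Y', ?_, ?_⟩
  · intro Q hQ
    rw [not_not] at hQ
    rw [hupd, if_neg (by rintro rfl; exact hP' hQ), ← S'.mat_mulVec, S'.mat_mulVec_restr]
    obtain ⟨k, hk, a, h1, h2, h3, h4⟩ := S'.owner_spec Q
    rw [Inside, h3] at hQ
    obtain ⟨i, rfl⟩ : ∃ i, k = h + i := ⟨k - h, by omega⟩
    rw [h4, sub_eq_zero, hYmid i (by omega), add_assoc, hYmid (i + 1) (by omega),
      ← (GSlice.rel_iff _ _ _).1 (hZ i (by omega)) a Q.2 h2]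
    refine (congrArg (fun k => Y' k Q.2.val) h1).trans ?_
    cases a
    · simp [hYmid i (by omega)]
    · simp [add_assoc, hYmid (i + 1) (by omega)]
  · rintro ⟨Q, hQ⟩
    have hcQ := A.equiv_corr ⟨Q, hQ⟩
    set Q' := (A.equiv ⟨Q, hQ⟩).1 with hQ'
    obtain ⟨c1, c2, c3⟩ := hcQ
    simp only at c1 c2 c3
    have hval : S'.restr Y' Q' = y Q := by
      rw [restr, ← c1, ← S.ext_pt y Q, ← hY]
      rcases c3 with ⟨o1, o2, o3⟩ | ⟨o1, o2, o3⟩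
      · rw [← o3]
        refine hYlow _ ?_ _ Q.2.2
        obtain ⟨k, hk, a, h1, h2, h3, h4⟩ := S.owner_spec Q
        have := a.toNat_le
        omega
      · obtain ⟨k, hk, a, h1, h2, h3, h4⟩ := S.owner_spec Q
        obtain ⟨j, hj⟩ : ∃ j, Q.1.val = h + m + j := ⟨Q.1.val - (h + m), by omega⟩
        have hj' : Q'.1.val = h + m' + j := by omega
        have hb : Q.2.val < (S.lev (h + m + j)).length :=
          lt_of_lt_of_eq Q.2.2 (congrArg (fun k => (S.lev k).length) hj)
        exact (congrArg (fun k => Y' k Q.2.val) hj').trans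
          ((hYhigh j (by omega) _ hb).trans (congrArg (fun k => Y k Q.2.val) hj).symm)
    refine ⟨hval, ?_⟩
    rw [hupd, hupd]
    have hiff : Q' = P' ↔ Q = P := by
      rw [← hPP, hQ']
      constructor
      · intro h; exact congrArg Subtype.val (A.equiv.injective (Subtype.ext h))
      · rintro rfl; rfl
    by_cases hQP : Q = P
    · rw [if_pos hQP, if_pos (hiff.2 hQP), ← hQP, ← hiff.2 hQP, hval]
    · rw [if_neg hQP, if_neg (fun h => hQP (hiff.1 h)), ← S'.mat_mulVec, S'.mat_mulVec_restr]
      obtain ⟨k, hk, a, h1, h2, h3, h4⟩ := S.owner_spec Q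
      obtain ⟨k', hk', a', h1', h2', h3', h4'⟩ := S'.owner_spec Q'
      -- Corresponding points have the same position on equal lines, hence the same direction, and
      -- they leave their slices on the same side.
      have haa : a = a' := by
        rw [GSlice.IsOut, S.ends_eq hk, ← h1] at h2
        rw [GSlice.IsOut, S'.ends_eq hk', ← h1', ← c1, ← c2] at h2'
        exact Option.some.inj (h2.symm.trans h2')
      rw [h4, h4']
      have hv : Y' Q'.1 Q'.2 = Y Q.1 Q.2 := by
        rw [hY, S.ext_pt, ← hval]; rfl
      rw [hv, ← haa, ← c1]
      congr 1
      rw [h3, h3'] at c3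
      rcases c3 with ⟨o1, o2, o3⟩ | ⟨o1, o2, o3⟩
      · obtain rfl : k' = k := o2
        rw [← A.low_sl k' o1]
        refine (S.sl k').out_congr h2 ?_ ?_
        · rw [S.src _ hk]; exact hYlow k' (by omega)
        · rw [S.tgt _ hk]; exact hYlow (k' + 1) (by omega)
      · obtain ⟨j, rfl⟩ : ∃ j, k = h + m + j := ⟨k - (h + m), by omega⟩
        obtain rfl : k' = h + m' + j := by omega
        rw [← A.high_sl j hk]
        refine (S.sl _).out_congr h2 ?_ ?_
        · rw [S.src _ hk]; exact hYhigh j (by omega)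
        · rw [S.tgt _ hk]; exact hYhigh (j + 1) (by omega)

end Agree

end Stack

/-! ### The relations between the rows and between the columns -/

/-- The exponent of the region to the left of a strand, with respect to the direction of the
strand. -/
def regionExp : List Bool → ℕ → ℤ
  | [], _ => 0
  | x :: _, 0 => if x then 0 else 2
  | x :: a, i + 1 => (if x then -2 else 2) + regionExp a i

/-- The weighted flux of labels through a horizontal line. -/
noncomputable def flux : List Bool → (ℕ → Coef) → Coef
  | [], _ => 0
  | x :: a, A => (if x then A 0 else -(hp 2 * A 0)) +
      hp (if x then -2 else 2) * flux a (fun i => A (i + 1))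

/-- The exponent of the rightmost region of a horizontal line. -/
def lastExp : List Bool → ℤ
  | [] => 0
  | x :: a => (if x then -2 else 2) + lastExp a

theorem flux_eq_sum (a : List Bool) (A : ℕ → Coef) :
    flux a A = ∑ i ∈ Finset.range a.length,
      (if a[i]? = some true then 1 else -1) * (hp (regionExp a i) * A i) := by
  induction a generalizing A with
  | nil => rfl
  | cons x a ih =>
    rw [flux, ih, Finset.mul_sum, List.length_cons, Finset.sum_range_succ', add_comm]
    refine congrArg₂ (· + ·) ?_ ?_
    · refine Finset.sum_congr rfl fun i _ => ?_
      simp only [List.getElem?_cons_succ, regionExp, hp_add]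
      ring
    · cases x
      · simp [regionExp]
        ring
      · simp [regionExp, hp_zero]

theorem flux_congr {a : List Bool} {A B : ℕ → Coef} (h : ∀ i < a.length, A i = B i) :
    flux a A = flux a B := by
  rw [flux_eq_sum, flux_eq_sum]
  exact Finset.sum_congr rfl fun i hi => by rw [h i (Finset.mem_range.1 hi)]

theorem flux_sub (a : List Bool) (A B : ℕ → Coef) :
    flux a (fun i => A i - B i) = flux a A - flux a B := by
  rw [flux_eq_sum, flux_eq_sum, flux_eq_sum, ← Finset.sum_sub_distrib]
  exact Finset.sum_congr rfl fun i _ => by ring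

theorem flux_append (l r : List Bool) (A : ℕ → Coef) :
    flux (l ++ r) A = flux l A + hp (lastExp l) * flux r (fun i => A (l.length + i)) := by
  induction l generalizing A with
  | nil => simp [flux, lastExp, hp_zero]
  | cons x l ih =>
    simp only [List.cons_append, flux, ih, lastExp, hp_add, List.length_cons]
    have : (fun i => A (l.length + i + 1)) = fun i => A (l.length + 1 + i) := by
      funext i; congr 1; omega
    rw [this]
    ring

theorem lastExp_append (l r : List Bool) : lastExp (l ++ r) = lastExp l + lastExp r := by
  induction l with
  | nil => simp [lastExp]
  | cons x l ih => simp [lastExp, ih, add_assoc]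

/-- For a vertical piece the flux is `A 0 + T⁻¹ A 1`. It is conserved for every weight, since the
row `(1, T⁻¹)` annihilates the column `(-T⁻¹, 1)` of the rank one term. -/
theorem GPiece.flux_eq (p : GPiece) {A B : ℕ → Coef} (h : p.Rel A B) :
    flux (p.ends false) A = flux (p.ends true) B := by
  rcases p with x | x | s
  · have h' : B 0 = B 1 := h
    cases x <;> simp [GPiece.ends, flux, h']
    linear_combination B 1 * hp_two_mul
  · have h' : A 0 = A 1 := h
    cases x <;> simp [GPiece.ends, flux, h']
    linear_combination -A 1 * hp_two_mul
  · obtain ⟨h0, h1⟩ := h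
    simp only [GPiece.ends, flux, h0, h1, if_true]
    ring

theorem GSlice.flux_eq (s : GSlice) {A B : ℕ → Coef} (h : s.Rel A B) :
    flux (s.ends false) A = flux (s.ends true) B := by
  obtain ⟨h1, h2, h3⟩ := h
  have hl : lastExp (s.piece.ends false) = lastExp (s.piece.ends true) := by
    rcases s.piece with x | x | s
    · cases x <;> rfl
    · cases x <;> rfl
    · rfl
  simp only [GSlice.ends, flux_append, lastExp_append, hl, List.length_append,
    s.piece.flux_eq h2]
  rw [flux_congr fun i hi => h1 i _ (List.getElem?_eq_getElem hi)]
  rw [flux_congr fun i hi => h3 i _ (List.getElem?_eq_getElem hi)]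

/-- Prescribed values depend only on entering ends; in `Stack.flux_op` the leaving labels can
therefore be corrected without disturbing the equations. -/
theorem GPiece.out_congr_ins (p : GPiece) {A B A' B' : ℕ → Coef} {a : Bool} {i : ℕ}
    (h : p.IsOut a i) (hA : ∀ j, (p.ends false)[j]? = some true → A j = A' j)
    (hB : ∀ j, (p.ends true)[j]? = some false → B j = B' j) :
    p.out A B a i = p.out A' B' a i := by
  rcases p with x | x | s
  · cases x <;> cases a <;> rcases i with _ | _ | i <;>
      simp_all [GPiece.IsOut, GPiece.ends, GPiece.out]
  · cases x <;> cases a <;> rcases i with _ | _ | i <;>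
      simp_all [GPiece.IsOut, GPiece.ends, GPiece.out]
  · have h0 := hA 0 rfl
    have h1 := hA 1 rfl
    cases i <;> simp [GPiece.out, h0, h1]

theorem GSlice.out_congr_ins (s : GSlice) {A B A' B' : ℕ → Coef} {a : Bool} {i : ℕ}
    (h : s.IsOut a i) (hA : ∀ j, (s.ends false)[j]? = some true → A j = A' j)
    (hB : ∀ j, (s.ends true)[j]? = some false → B j = B' j) :
    s.out A B a i = s.out A' B' a i := by
  rcases (s.isOut_iff a i).1 h with h' | ⟨j, rfl, h'⟩ | ⟨j, rfl, h'⟩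
  · rw [s.out_left _ _ a h', s.out_left _ _ a h']
    cases a
    · exact hB i (getElem?_append_three.2 (Or.inl h'))
    · exact hA i (getElem?_append_three.2 (Or.inl h'))
  · rw [s.out_piece _ _ a h', s.out_piece _ _ a h']
    exact s.piece.out_congr_ins h'
      (fun j hj => hA _ (getElem?_append_three.2 (Or.inr (Or.inl ⟨j, rfl, hj⟩))))
      (fun j hj => hB _ (getElem?_append_three.2 (Or.inr (Or.inl ⟨j, rfl, hj⟩))))
  · rw [s.out_right, s.out_right]
    cases a
    · exact hB _ (getElem?_append_three.2 (Or.inr (Or.inr ⟨j, rfl, h'⟩)))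
    · exact hA _ (getElem?_append_three.2 (Or.inr (Or.inr ⟨j, rfl, h'⟩)))

theorem GSlice.rel_one (s : GSlice) : s.Rel (fun _ => 1) (fun _ => 1) := by
  refine ⟨fun _ _ _ => rfl, ?_, fun _ _ _ => rfl⟩
  rcases s.piece with x | x | s
  · rfl
  · rfl
  · constructor <;> ring

namespace Stack

variable (S : Stack)

theorem mat_mulVec_one : S.mat.mulVec 1 = 0 := by
  funext P
  have h1 : (1 : S.Pt → Coef) = S.restr (fun _ _ => 1) := rfl
  rw [h1, S.mat_mulVec_restr]
  obtain ⟨k, hk, a, h1, h2, -, h3⟩ := S.owner_spec P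
  rw [h3, Pi.zero_apply, sub_eq_zero, ← (GSlice.rel_iff _ _ _).1 (S.sl k).rel_one a P.2 h2, ite_self]

/-- The row weights of the Alexander matrix. -/
noncomputable def weight (P : S.Pt) : Coef := hp (regionExp (S.lev P.1) P.2)

/-- Subtracting its defect from each leaving label of the slice makes all relations of the slice
hold, and then the flux is conserved. -/
theorem flux_op (Y : ℕ → ℕ → Coef) {k : ℕ} (hk : k < S.n) :
    flux (S.lev (k + 1)) (fun i => if (S.lev (k + 1))[i]? = some true then S.op Y (k + 1) i else 0)
      - flux (S.lev k) (fun i => if (S.lev k)[i]? = some true then 0 else S.op Y k i) =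
    flux (S.lev (k + 1)) (Y (k + 1)) - flux (S.lev k) (Y k) := by
  have hrel : (S.sl k).Rel
      (fun i => Y k i - if (S.lev k)[i]? = some true then 0 else S.op Y k i)
      (fun i => Y (k + 1) i -
        if (S.lev (k + 1))[i]? = some true then S.op Y (k + 1) i else 0) := by
    rw [GSlice.rel_iff]
    intro a i hi
    rw [(S.sl k).out_congr_ins (A' := Y k) (B' := Y (k + 1)) hi]
    · rw [GSlice.IsOut, S.ends_eq hk] at hi
      cases a
      · have hi' : (S.lev k)[i]? = some false := hi
        simp [hi', op]
      · have hi' : (S.lev (k + 1))[i]? = some true := hi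
        simp [hi', op]
    · intro j hj
      rw [S.src k hk] at hj
      simp [hj]
    · intro j hj
      rw [S.tgt k hk] at hj
      simp [hj]
  have h := (S.sl k).flux_eq hrel
  rw [S.src k hk, S.tgt k hk, flux_sub, flux_sub] at h
  linear_combination h

/-- The weighted sum of all defects is the flux of the defects at upward points minus that at
downward points, because `flux` counts downward strands negatively. Grouped by slices it telescopes
to the fluxes through the empty lines `0` and `n`. -/
theorem weight_vecMul_mat : Matrix.vecMul S.weight S.mat = 0 := by
  suffices h : ∀ y, dotProduct (Matrix.vecMul S.weight S.mat) y = 0 by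
    funext Q
    have := h (Pi.single Q 1)
    rwa [dotProduct_single_one] at this
  intro y
  rw [← Matrix.dotProduct_mulVec]
  set Y := S.ext y with hY
  have h1 : S.weight ⬝ᵥ (S.mat.mulVec y) = ∑ k : Fin (S.n + 1), (fun k : ℕ =>
      flux (S.lev k) (fun i => if (S.lev k)[i]? = some true then S.op Y k i else 0)
      - flux (S.lev k) (fun i => if (S.lev k)[i]? = some true then 0 else S.op Y k i)) k := by
    rw [dotProduct, Fintype.sum_sigma]
    refine Finset.sum_congr rfl fun k _ => ?_
    simp only
    rw [flux_eq_sum, flux_eq_sum, ← Finset.sum_sub_distrib, ← Fin.sum_univ_eq_sum_range (n :=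
      (S.lev k).length) fun i => (if (S.lev k)[i]? = some true then (1 : Coef) else -1) *
        (hp (regionExp (S.lev k) i) * if (S.lev k)[i]? = some true then S.op Y k i else 0) -
        (if (S.lev k)[i]? = some true then (1 : Coef) else -1) *
        (hp (regionExp (S.lev k) i) * if (S.lev k)[i]? = some true then 0 else S.op Y k i)]
    refine Finset.sum_congr rfl fun i _ => ?_
    rw [S.mat_mulVec, ← hY, weight]
    split_ifs <;> ring
  rw [h1, Fin.sum_univ_eq_sum_range (fun k : ℕ =>
      flux (S.lev k) (fun i => if (S.lev k)[i]? = some true then S.op Y k i else 0)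
      - flux (S.lev k) (fun i => if (S.lev k)[i]? = some true then 0 else S.op Y k i)),
    Finset.sum_sub_distrib, Finset.sum_range_succ', Finset.sum_range_succ]
  have h0 : ∀ A, flux (S.lev 0) A = 0 := by intro A; rw [S.lev_zero]; rfl
  have hn : ∀ A, flux (S.lev S.n) A = 0 := by intro A; rw [S.lev_last]; rfl
  rw [h0, hn, add_zero, add_zero, ← Finset.sum_sub_distrib,
    Finset.sum_congr rfl fun k hk => S.flux_op Y (Finset.mem_range.1 hk),
    Finset.sum_range_sub (fun k => flux (S.lev k) (Y k)), h0, hn, sub_zero]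

/-- The first minors of the Alexander matrix at two points differ by the ratio of the weights. -/
theorem adjugate_mul_weight (P Q : S.Pt) :
    S.mat.adjugate P P * S.weight Q = S.mat.adjugate Q Q * S.weight P :=
  adjugate_diag_mul_eq _ _ (fun _ => hp_ne_zero _) S.mat_mulVec_one S.weight_vecMul_mat P Q

end Stack

namespace Stack

/-! ### The normalised first minor -/

open Classical in
/-- The first minor of the Alexander matrix, divided by the weight of the base point. -/
noncomputable def val (S : Stack) : Coef :=
  if h : Nonempty S.Pt then
    S.mat.adjugate h.some h.some * hp (-regionExp (S.lev h.some.1) h.some.2) else 0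

/-- The minors are proportional to the weights, and the weights are units; hence the arbitrary base
point in `val` can be exchanged for any other. -/
theorem val_eq (S : Stack) (P : S.Pt) :
    S.val = S.mat.adjugate P P * hp (-regionExp (S.lev P.1) P.2) := by
  have h : Nonempty S.Pt := ⟨P⟩
  rw [val, dif_pos h]
  have h1 := S.adjugate_mul_weight h.some P
  have h2 : ∀ Q, S.weight Q * hp (-regionExp (S.lev Q.1) Q.2) = 1 := by
    intro Q
    rw [weight, ← hp_add, add_neg_cancel, hp_zero]
  linear_combination (hp (-regionExp (S.lev h.some.1) h.some.2) *
    hp (-regionExp (S.lev P.1) P.2)) * h1 + S.mat.adjugate P P * hp (-regionExp (S.lev P.1) P.2) *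
    h2 h.some - S.mat.adjugate h.some h.some * hp (-regionExp (S.lev h.some.1) h.some.2) * h2 P

theorem _root_.SingLink.GSlice.out_vert (l r : List Bool) (s : Coef) (A B : ℕ → Coef) (a : Bool) (i : ℕ) :
    (GSlice.mk l (.vert s) r).out A B a i = (GSlice.mk l (.vert 0) r).out A B a i +
      s * ((if i = l.length then -hp (-2) else if i = l.length + 1 then 1 else 0) *
        (A l.length - A (l.length + 1))) := by
  simp only [GSlice.out, GPiece.ends, List.length_cons, List.length_nil]
  by_cases h1 : i < l.length
  · have h2 : i ≠ l.length := by omega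
    have h3 : i ≠ l.length + 1 := by omega
    simp [h1, h2, h3]
  · by_cases h2 : i < l.length + 2
    · obtain rfl | rfl : i = l.length ∨ i = l.length + 1 := by omega
      · simp [GPiece.out]
        ring
      · simp [GPiece.out]
        ring
    · have h3 : i ≠ l.length := by omega
      have h4 : i ≠ l.length + 1 := by omega
      simp [h1, h2, h3, h4]

/-- The diagram with the same horizontal lines and with other slices. -/
abbrev withSl (S : Stack) (sl : ℕ → GSlice) (hs : ∀ k < S.n, (sl k).ends false = S.lev k)
    (ht : ∀ k < S.n, (sl k).ends true = S.lev (k + 1)) : Stack :=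
  ⟨S.n, S.lev, sl, S.lev_zero, S.lev_last, hs, ht⟩

/-- The left factor of the rank one perturbation given by a vertical piece. -/
noncomputable def vertCol (S : Stack) (h n : ℕ) (Q : S.Pt) : Coef :=
  if S.owner Q.1 Q.2 = h then
    -- The signs are opposite to those of `GSlice.out_vert`, because `op` subtracts the prescribed
    -- value.
    if Q.2.val = n then hp (-2) else if Q.2.val = n + 1 then -1 else 0 else 0

theorem op_vert (S : Stack) (sl : ℕ → GSlice) (hs : ∀ k < S.n, (sl k).ends false = S.lev k)
    (ht : ∀ k < S.n, (sl k).ends true = S.lev (k + 1)) (h : ℕ) (hsl : ∀ k ≠ h, sl k = S.sl k)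
    (l r : List Bool) (s : Coef) (e : sl h = ⟨l, .vert s, r⟩) (e₀ : S.sl h = ⟨l, .vert 0, r⟩)
    (Y : ℕ → ℕ → Coef) (Q : S.Pt) :
    (S.withSl sl hs ht).op Y Q.1 Q.2 = S.op Y Q.1 Q.2 +
      s * (S.vertCol h l.length Q * (Y h l.length - Y h (l.length + 1))) := by
  obtain ⟨k, hk1, a, h1, h2, h3, h4⟩ := (S.withSl sl hs ht).owner_spec Q
  obtain ⟨k', hk1', a', h1', h2', h3', h4'⟩ := S.owner_spec Q
  obtain rfl : k' = k := h3'.symm.trans h3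
  obtain rfl : a' = a := by
    have : a'.toNat = a.toNat := by omega
    revert this; cases a <;> cases a' <;> simp
  rw [h4, h4', vertCol, h3']
  by_cases hkh : k' = h
  · rw [if_pos hkh, hkh, show (S.withSl sl hs ht).sl h = _ from e, e₀, GSlice.out_vert l r s]
    split_ifs <;> ring
  · rw [if_neg hkh, show (S.withSl sl hs ht).sl k' = _ from hsl k' hkh]
    ring

/-- The weight enters the matrix through a rank one term. Its column is set to `0` at the base
point, whose row has already been replaced. -/
theorem adjugate_vert (S : Stack) (sl : ℕ → GSlice) (hs : ∀ k < S.n, (sl k).ends false = S.lev k)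
    (ht : ∀ k < S.n, (sl k).ends true = S.lev (k + 1)) (h : ℕ) (hsl : ∀ k ≠ h, sl k = S.sl k)
    (l r : List Bool) (s : Coef) (e : sl h = ⟨l, .vert s, r⟩) (e₀ : S.sl h = ⟨l, .vert 0, r⟩)
    (P : S.Pt) :
    (S.withSl sl hs ht).mat.adjugate P P = (S.mat.updateRow P (Pi.single P 1) + s •
      Matrix.vecMulVec (Function.update (S.vertCol h l.length) P 0) fun Q =>
        S.ext (Pi.single Q 1) h l.length - S.ext (Pi.single Q 1) h (l.length + 1)).det := by
  rw [Matrix.adjugate_apply]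
  refine congrArg Matrix.det (Matrix.ext fun Q R => ?_)
  by_cases hQ : Q = P
  · subst hQ
    simp [Matrix.vecMulVec_apply]
  · rw [Matrix.updateRow_ne hQ, Matrix.add_apply, Matrix.updateRow_ne hQ, Stack.mat_apply,
      S.mat_apply, Matrix.smul_apply, Matrix.vecMulVec_apply, Function.update_of_ne hQ, smul_eq_mul]
    exact S.op_vert sl hs ht h hsl l r s e e₀ _ Q

theorem val_withSl (S : Stack) {h : ℕ} {l r : List Bool} (e₀ : S.sl h = ⟨l, .vert 0, r⟩)
    {s : Coef} (sl : ℕ → GSlice) (hs : ∀ k < S.n, (sl k).ends false = S.lev k)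
    (ht : ∀ k < S.n, (sl k).ends true = S.lev (k + 1)) (hsl : ∀ k ≠ h, sl k = S.sl k)
    (e : sl h = ⟨l, .vert s, r⟩)
    (sl₁ : ℕ → GSlice) (hs₁ : ∀ k < S.n, (sl₁ k).ends false = S.lev k)
    (ht₁ : ∀ k < S.n, (sl₁ k).ends true = S.lev (k + 1)) (hsl₁ : ∀ k ≠ h, sl₁ k = S.sl k)
    (e₁ : sl₁ h = ⟨l, .vert 1, r⟩) :
    (S.withSl sl hs ht).val = S.val + s * ((S.withSl sl₁ hs₁ ht₁).val - S.val) := by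
  by_cases hne : Nonempty S.Pt
  · obtain ⟨P⟩ := hne
    have hv := val_eq (S.withSl sl hs ht) P
    have hv₁ := val_eq (S.withSl sl₁ hs₁ ht₁) P
    rw [S.adjugate_vert sl hs ht h hsl l r s e e₀, det_add_smul_vecMulVec] at hv
    rw [S.adjugate_vert sl₁ hs₁ ht₁ h hsl₁ l r 1 e₁ e₀, one_smul] at hv₁
    rw [hv, hv₁, val_eq S P, Matrix.adjugate_apply]
    ring
  · rw [val, val, val, dif_neg hne, dif_neg hne, dif_neg hne]
    ring

/-- The normalised first minor is an affine function of the weight of each vertical piece. -/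
theorem val_affine (S S₀ S₁ : Stack) (h₀ : S.n = S₀.n) (h₁ : S₁.n = S₀.n)
    (hl₀ : S.lev = S₀.lev) (hl₁ : S₁.lev = S₀.lev) (h : ℕ)
    (hs₀ : ∀ k ≠ h, S.sl k = S₀.sl k) (hs₁ : ∀ k ≠ h, S₁.sl k = S₀.sl k)
    {l r : List Bool} {s : Coef} (e : S.sl h = ⟨l, .vert s, r⟩) (e₀ : S₀.sl h = ⟨l, .vert 0, r⟩)
    (e₁ : S₁.sl h = ⟨l, .vert 1, r⟩) :
    S.val = S₀.val + s * (S₁.val - S₀.val) := by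
  obtain ⟨n, lev, sl, z, z', f, g⟩ := S
  obtain ⟨n₁, lev₁, sl₁, z₁, z₁', f₁, g₁⟩ := S₁
  dsimp only at h₀ h₁ hl₀ hl₁ hs₀ hs₁ e e₁
  subst n n₁ lev lev₁
  exact S₀.val_withSl e₀ sl f g hs₀ e sl₁ f₁ g₁ hs₁ e₁

end Stack

namespace Stack

/-- The first minors vanish if there is a non-constant solution of the relations. -/
theorem val_eq_zero (S : Stack) (Y : ℕ → ℕ → Coef)
    (hY : ∀ k < S.n, (S.sl k).Rel (Y k) (Y (k + 1))) {P Q : S.Pt} (hP : Y P.1 P.2 = 0)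
    (hQ : Y Q.1 Q.2 ≠ 0) : S.val = 0 := by
  rw [S.val_eq P, Matrix.adjugate_apply]
  -- The cofactor matrix has the row `e_P` at the base point; as `Y` vanishes there, `Y` is a
  -- non-zero null vector.
  refine mul_eq_zero_of_left (Matrix.exists_mulVec_eq_zero_iff.1 ⟨S.restr Y, ?_, ?_⟩) _
  · intro h; exact hQ (congrFun h Q)
  · funext R
    by_cases hR : R = P
    · subst hR
      simpa [Matrix.mulVec, restr] using hP
    · have h1 : (S.mat.updateRow P (Pi.single P 1)).mulVec (S.restr Y) R =
          S.mat.mulVec (S.restr Y) R := by simp [Matrix.mulVec, Matrix.updateRow_ne hR]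
      rw [h1, S.mat_mulVec_restr]
      obtain ⟨k, hk, a, h2, h3, -, h4⟩ := S.owner_spec R
      rw [h4, Pi.zero_apply, sub_eq_zero, ← (GSlice.rel_iff _ _ _).1 (hY k hk) a R.2 h3]
      refine (congrArg (fun j => Y j R.2.val) h2).trans ?_
      cases a <;> rfl

end Stack

/-! ### Words of slices -/

/-- The slices fit together and form a diagram from the line `a` to the line `b`. -/
def GFits : List Bool → List GSlice → List Bool → Prop
  | a, [], b => a = b
  | a, s :: w, b => s.ends false = a ∧ GFits (s.ends true) w b

/-- The horizontal lines of a word of slices over the line `a`. -/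
def levFrom : List Bool → List GSlice → ℕ → List Bool
  | a, [], _ => a
  | a, _ :: _, 0 => a
  | _, s :: w, k + 1 => levFrom (s.ends true) w k

theorem levFrom_zero (a : List Bool) (w : List GSlice) : levFrom a w 0 = a := by
  cases w <;> rfl

theorem gfits_append {a c : List Bool} {u v : List GSlice} :
    GFits a (u ++ v) c ↔ ∃ b, GFits a u b ∧ GFits b v c := by
  induction u generalizing a with
  | nil => simp [GFits]
  | cons s u ih => simp [GFits, ih, and_assoc]

theorem GFits.unique {a b b' : List Bool} {w : List GSlice} (h : GFits a w b)
    (h' : GFits a w b') : b = b' := by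
  induction w generalizing a with
  | nil => exact h.symm.trans h'
  | cons s w ih => exact ih h.2 h'.2

theorem levFrom_append_left {a b : List Bool} {u : List GSlice} (v : List GSlice)
    (h : GFits a u b) {k : ℕ} (hk : k ≤ u.length) : levFrom a (u ++ v) k = levFrom a u k := by
  induction u generalizing a k with
  | nil =>
    obtain rfl : k = 0 := by simpa using hk
    rw [levFrom_zero, levFrom_zero]
  | cons s u ih =>
    cases k with
    | zero => rfl
    | succ k => exact ih h.2 (by simpa using hk)

theorem levFrom_append_right {a b : List Bool} {u : List GSlice} (v : List GSlice)
    (h : GFits a u b) (k : ℕ) : levFrom a (u ++ v) (u.length + k) = levFrom b v k := by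
  induction u generalizing a with
  | nil => obtain rfl : a = b := h; simp
  | cons s u ih =>
    rw [List.length_cons, Nat.add_right_comm]
    exact ih h.2

theorem levFrom_length {a b : List Bool} {u : List GSlice} (h : GFits a u b) :
    levFrom a u u.length = b := by
  have := levFrom_append_right [] h 0
  rwa [List.append_nil, levFrom_zero] at this

theorem gfits_src {a b : List Bool} {w : List GSlice} (h : GFits a w b) {k : ℕ}
    (hk : k < w.length) : w[k].ends false = levFrom a w k := by
  induction w generalizing a k with
  | nil => simp at hk
  | cons s w ih =>
    cases k with
    | zero => exact h.1
    | succ k => exact ih h.2 (by simpa using hk)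

theorem gfits_tgt {a b : List Bool} {w : List GSlice} (h : GFits a w b) {k : ℕ}
    (hk : k < w.length) : w[k].ends true = levFrom a w (k + 1) := by
  induction w generalizing a k with
  | nil => simp at hk
  | cons s w ih =>
    cases k with
    | zero => exact (levFrom_zero _ _).symm
    | succ k => exact ih h.2 (by simpa using hk)

/-- A slice without strands, used as a default value. -/
def GSlice.dummy : GSlice := ⟨[], .cup true, []⟩

/-- The closed weighted diagram given by a word. -/
def ofWord (w : List GSlice) (h : GFits [] w []) : Stack where
  n := w.length
  lev := levFrom [] w
  sl k := w.getD k GSlice.dummy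
  lev_zero := levFrom_zero _ _
  lev_last := levFrom_length h
  src k hk := by
    rw [List.getD_eq_getElem _ _ hk]; exact gfits_src h hk
  tgt k hk := by
    rw [List.getD_eq_getElem _ _ hk]; exact gfits_tgt h hk

open Classical in
/-- The normalised first minor of a word. -/
noncomputable def wval (w : List GSlice) : Coef :=
  if h : GFits [] w [] then (ofWord w h).val else 0

theorem wval_eq {w : List GSlice} (h : GFits [] w []) : wval w = (ofWord w h).val := dif_pos h

/-! ### Replacing a part of a diagram without changing the first minor. -/

/-- The labels at the bottom and at the top of a word extend to solutions of all relations. -/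
def Sol : List Bool → List GSlice → (ℕ → Coef) → (ℕ → Coef) → Prop
  | a, [], A, B => ∀ i < a.length, A i = B i
  | _, s :: w, A, B => ∃ C, s.Rel A C ∧ Sol (s.ends true) w C B

theorem sol_of_chain {a b : List Bool} {w : List GSlice} (h : GFits a w b) (Y : ℕ → ℕ → Coef)
    (hY : ∀ i (hi : i < w.length), w[i].Rel (Y i) (Y (i + 1))) : Sol a w (Y 0) (Y w.length) := by
  induction w generalizing a Y with
  | nil => exact fun _ _ => rfl
  | cons s w ih =>
    exact ⟨Y 1, hY 0 (by simp), ih h.2 (fun i => Y (i + 1)) fun i hi => hY (i + 1) (by simpa)⟩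

theorem chain_of_sol {a b : List Bool} {w : List GSlice} (h : GFits a w b) {A B : ℕ → Coef}
    (hs : Sol a w A B) : ∃ Y : ℕ → ℕ → Coef, Y 0 = A ∧ (∀ i < b.length, Y w.length i = B i) ∧
      ∀ i (hi : i < w.length), w[i].Rel (Y i) (Y (i + 1)) := by
  induction w generalizing a A with
  | nil =>
    obtain rfl : a = b := h
    exact ⟨fun _ => A, rfl, hs, fun i hi => absurd hi (by simp)⟩
  | cons s w ih =>
    obtain ⟨C, h1, h2⟩ := hs
    obtain ⟨Y, h3, h4, h5⟩ := ih h.2 h2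
    refine ⟨fun | 0 => A | k + 1 => Y k, rfl, h4, ?_⟩
    rintro (_ | i) hi
    · simpa [h3] using h1
    · exact h5 i (by simpa using hi)

theorem Sol.congr {a b : List Bool} {w : List GSlice} (h : GFits a w b) {A B A' B' : ℕ → Coef}
    (hs : Sol a w A B) (hA : ∀ i < a.length, A i = A' i) (hB : ∀ i < b.length, B i = B' i) :
    Sol a w A' B' := by
  induction w generalizing a A A' with
  | nil =>
    obtain rfl : a = b := h
    exact fun i hi => by rw [← hA i hi, ← hB i hi, hs i hi]
  | cons s w ih =>
    obtain ⟨C, h1, h2⟩ := hs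
    exact ⟨C, s.rel_congr h1 (by rw [h.1]; exact hA) fun _ _ => rfl, ih h.2 h2 fun _ _ => rfl⟩

/-- There is a numbering of the end points which increases along the dependencies. -/
def Acyclic (w : List GSlice) : Prop :=
  ∃ O : ℕ → ℕ → ℕ, ∀ i (hi : i < w.length), w[i].Ord (O i) (O (i + 1))

/-- A local move between weighted diagrams which preserves the normalised first minor. -/
structure Transfer (a b : List Bool) (u v : List GSlice) : Prop where
  fits_left : GFits a u b
  fits_right : GFits a v b
  acyclic_left : Acyclic u
  acyclic_right : Acyclic v
  -- One implication suffices: on both sides acyclicity makes the leaving boundary labels functions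
  -- of the entering ones.
  sol : ∀ A B, Sol a u A B → Sol a v A B
  -- Some strand enters the part, so its boundary contains a point owned by an outer slice; such a
  -- point survives the elimination and can serve as base point.
  enter : true ∈ a ∨ false ∈ b

theorem acyclic_shift {w : List GSlice} (h : Acyclic w) (n : ℕ) :
    ∃ O : ℕ → ℕ → ℕ, ∀ k, n ≤ k → k < n + w.length →
      (w.getD (k - n) GSlice.dummy).Ord (O k) (O (k + 1)) := by
  obtain ⟨O, hO⟩ := h
  refine ⟨fun k => O (k - n), fun k h1 h2 => ?_⟩
  have h3 : k - n < w.length := by omega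
  rw [List.getD_eq_getElem _ _ h3]
  simpa [Nat.sub_add_comm h1] using hO (k - n) h3

theorem getD_append_three (x u y : List GSlice) (k : ℕ) :
    (x ++ u ++ y).getD k GSlice.dummy = if k < x.length then x.getD k GSlice.dummy
      else if k < x.length + u.length then u.getD (k - x.length) GSlice.dummy
      else y.getD (k - (x.length + u.length)) GSlice.dummy := by
  split_ifs with h1 h2
  · rw [List.append_assoc, List.getD_append _ _ _ _ h1]
  · rw [List.getD_append _ _ _ _ (by simpa using h2), List.getD_append_right _ _ _ _ (by omega)]
  · rw [List.getD_append_right _ _ _ _ (by simp; omega), List.length_append]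

/-- The points owned by `u` and by `v` are eliminated through blocks of determinant one, and the
base point is chosen among the remaining points. Corresponding base points have the same weight, so
only the cofactors have to be compared. -/
theorem Transfer.wval_eq {a b : List Bool} {u v : List GSlice} (ht : Transfer a b u v)
    {x y : List GSlice} (hx : GFits [] x a) (hy : GFits b y []) :
    wval (x ++ u ++ y) = wval (x ++ v ++ y) := by
  have hxu : GFits [] (x ++ u) b := gfits_append.2 ⟨a, hx, ht.fits_left⟩
  have hxv : GFits [] (x ++ v) b := gfits_append.2 ⟨a, hx, ht.fits_right⟩
  have hu : GFits [] (x ++ u ++ y) [] := gfits_append.2 ⟨b, hxu, hy⟩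
  have hv : GFits [] (x ++ v ++ y) [] := gfits_append.2 ⟨b, hxv, hy⟩
  rw [SingLink.wval_eq hu, SingLink.wval_eq hv]
  set S := ofWord _ hu with hS
  set S' := ofWord _ hv with hS'
  have hlev : ∀ k, S.lev (x.length + u.length + k) = levFrom b y k := by
    intro k
    have := levFrom_append_right y hxu k
    rwa [List.length_append] at this
  have hlev' : ∀ k, S'.lev (x.length + v.length + k) = levFrom b y k := by
    intro k
    have := levFrom_append_right y hxv k
    rwa [List.length_append] at this
  have hlow : ∀ (u : List GSlice) (b : List Bool), GFits a u b → ∀ k ≤ x.length,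
      levFrom [] (x ++ u ++ y) k = levFrom [] x k := by
    intro u b hu k hk
    rw [List.append_assoc]
    exact levFrom_append_left _ hx hk
  have hlevx : levFrom [] x x.length = a := levFrom_length hx
  have hsl : ∀ k, S.sl k = (x ++ u ++ y).getD k GSlice.dummy := fun _ => rfl
  have hsl' : ∀ k, S'.sl k = (x ++ v ++ y).getD k GSlice.dummy := fun _ => rfl
  have hn : S.n = x.length + u.length + y.length := by simp [hS, ofWord]; omega
  have hn' : S'.n = x.length + v.length + y.length := by simp [hS', ofWord]; omega
  have hA : Stack.Agree S S' x.length u.length v.length :=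
    { le := by omega
      n_eq := by omega
      low_lev := fun k hk =>
        (hlow u b ht.fits_left k hk).trans (hlow v b ht.fits_right k hk).symm
      low_sl := fun k hk => by
        rw [hsl, hsl', getD_append_three, getD_append_three, if_pos hk, if_pos hk]
      high_lev := fun i _ => by rw [hlev, hlev']
      high_sl := fun i _ => by
        rw [hsl, hsl', getD_append_three, getD_append_three, if_neg (by omega), if_neg (by omega),
          if_neg (by omega), if_neg (by omega)]
        congr 1
        omega }
  have hmid : ∀ i < u.length, S.sl (x.length + i) = u.getD i GSlice.dummy := by
    intro i hi
    rw [hsl, getD_append_three, if_neg (by omega), if_pos (by omega), Nat.add_sub_cancel_left]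
  have hmid' : ∀ i < v.length, S'.sl (x.length + i) = v.getD i GSlice.dummy := by
    intro i hi
    rw [hsl', getD_append_three, if_neg (by omega), if_pos (by omega), Nat.add_sub_cancel_left]
  have hla : S.lev x.length = a := (hlow u b ht.fits_left _ le_rfl).trans hlevx
  have hlb : S.lev (x.length + u.length) = b := by
    have := hlev 0; rwa [add_zero, levFrom_zero] at this
  obtain ⟨P, hP⟩ : ∃ P : S.Pt, ¬ S.Inside x.length u.length P := by
    rcases ht.enter with h | h
    · obtain ⟨i, hi, hi'⟩ := List.mem_iff_getElem.1 h
      have hi2 : (S.lev x.length)[i]? = some true := by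
        rw [hla, List.getElem?_eq_getElem hi, hi']
      have hx0 : x.length ≠ 0 := by
        intro h0
        rw [h0, S.lev_zero] at hi2
        simp at hi2
      refine ⟨⟨⟨x.length, by omega⟩, ⟨i, by rwa [hla]⟩⟩, ?_⟩
      simp only [Stack.Inside, Stack.owner, hi2, if_true]
      omega
    · obtain ⟨i, hi, hi'⟩ := List.mem_iff_getElem.1 h
      have hi2 : (S.lev (x.length + u.length))[i]? = some false := by
        rw [hlb, List.getElem?_eq_getElem hi, hi']
      refine ⟨⟨⟨x.length + u.length, by omega⟩, ⟨i, by rwa [hlb]⟩⟩, ?_⟩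
      simp [Stack.Inside, Stack.owner, hi2]
  obtain ⟨P', -, hc⟩ := hA.exists_corr P hP
  obtain ⟨O, hO⟩ := acyclic_shift ht.acyclic_left x.length
  obtain ⟨O', hO'⟩ := acyclic_shift ht.acyclic_right x.length
  rw [S.val_eq P, S'.val_eq P']
  have hr : regionExp (S.lev P.1) P.2 = regionExp (S'.lev P'.1) P'.2 :=
    congrArg₂ regionExp hc.2.1 hc.1
  rw [hr]
  congr 1
  refine hA.adjugate_eq O O' ?_ ?_ ?_ hP hc
  · intro k h1 h2
    have := hmid (k - x.length) (by omega)
    rw [Nat.add_sub_cancel' h1] at this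
    rw [this]
    exact hO k h1 h2
  · intro k h1 h2
    have := hmid' (k - x.length) (by omega)
    rw [Nat.add_sub_cancel' h1] at this
    rw [this]
    exact hO' k h1 h2
  · intro Y hY
    have h1 := sol_of_chain ht.fits_left Y fun i hi => by
      have := hY i hi
      rwa [hmid i hi, List.getD_eq_getElem _ _ hi] at this
    obtain ⟨Y', h2, h3, h4⟩ := chain_of_sol ht.fits_right (ht.sol _ _ h1)
    refine ⟨Y', ?_, fun i _ => by rw [h2], fun i hi => h3 i (by rwa [hlb] at hi)⟩
    intro i hi
    rw [hmid' i hi, List.getD_eq_getElem _ _ hi]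
    exact h4 i hi

/-! ### Widening -/

/-- Add vertical strands on both sides of a slice. -/
def GSlice.widen (l r : List Bool) (s : GSlice) : GSlice := ⟨l ++ s.left, s.piece, s.right ++ r⟩

theorem GSlice.ends_widen (l r : List Bool) (s : GSlice) (a : Bool) :
    (s.widen l r).ends a = l ++ s.ends a ++ r := by
  simp [GSlice.ends, GSlice.widen]

theorem GFits.widen {a b : List Bool} {w : List GSlice} (h : GFits a w b) (l r : List Bool) :
    GFits (l ++ a ++ r) (w.map (GSlice.widen l r)) (l ++ b ++ r) := by
  induction w generalizing a with
  | nil => obtain rfl : a = b := h; rfl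
  | cons s w ih =>
    refine ⟨by rw [GSlice.ends_widen, h.1], ?_⟩
    rw [GSlice.ends_widen]
    exact ih h.2

theorem getElem?_append_two {ρ : Type*} {l r : List ρ} {i : ℕ} {x : ρ} :
    (l ++ r)[i]? = some x ↔ l[i]? = some x ∨ ∃ j, i = l.length + j ∧ r[j]? = some x := by
  have := getElem?_append_three (l := l) (m := r) (r := []) (i := i) (x := x)
  simpa using this

theorem GSlice.cond_widen {ρ : Type*} {thr : Bool → ρ → ρ → Prop}
    {pc : GPiece → (ℕ → ρ) → (ℕ → ρ) → Prop} {l r : List Bool} {s : GSlice} {A B : ℕ → ρ} :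
    (s.widen l r).Cond thr pc A B ↔ (∀ i x, l[i]? = some x → thr x (A i) (B i)) ∧
      s.Cond thr pc (fun j => A (l.length + j)) (fun j => B (l.length + j)) ∧
      ∀ i x, r[i]? = some x → thr x (A (l.length + (s.ends false).length + i))
        (B (l.length + (s.ends true).length + i)) := by
  simp only [GSlice.Cond, GSlice.widen, getElem?_append_two, List.length_append, s.length_ends]
  constructor
  · rintro ⟨h1, h2, h3⟩
    refine ⟨fun i x h => h1 i x (Or.inl h), ⟨fun i x h => h1 _ x (Or.inr ⟨i, rfl, h⟩), ?_,
      fun i x h => ?_⟩, fun i x h => ?_⟩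
    · simpa only [add_assoc] using h2
    · simpa only [add_assoc] using h3 i x (Or.inl h)
    · simpa only [add_assoc] using h3 _ x (Or.inr ⟨i, rfl, h⟩)
  · rintro ⟨h1, ⟨h2, h3, h4⟩, h5⟩
    refine ⟨?_, by simpa only [add_assoc] using h3, ?_⟩
    · rintro i x (h | ⟨j, rfl, h⟩)
      · exact h1 i x h
      · exact h2 j x h
    · rintro i x (h | ⟨j, rfl, h⟩)
      · simpa only [add_assoc] using h4 i x h
      · simpa only [add_assoc] using h5 j x h

/-- Juxtaposition of labels. -/
def glue {ρ : Type*} (n m : ℕ) (L M R : ℕ → ρ) (i : ℕ) : ρ :=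
  if i < n then L i else if i < n + m then M (i - n) else R (i - (n + m))

theorem glue_left {ρ : Type*} {n m : ℕ} {L M R : ℕ → ρ} {i : ℕ} (h : i < n) :
    glue n m L M R i = L i := if_pos h

theorem glue_mid {ρ : Type*} {n m : ℕ} {L M R : ℕ → ρ} {i : ℕ} (h : i < m) :
    glue n m L M R (n + i) = M i := by
  rw [glue, if_neg (by omega), if_pos (by omega), Nat.add_sub_cancel_left]

theorem glue_right {ρ : Type*} {n m : ℕ} {L M R : ℕ → ρ} (i : ℕ) :
    glue n m L M R (n + m + i) = R i := by
  rw [glue, if_neg (by omega), if_neg (by omega), Nat.add_sub_cancel_left]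

theorem sol_widen {a b : List Bool} {w : List GSlice} (h : GFits a w b) (l r : List Bool)
    (A B : ℕ → Coef) : Sol (l ++ a ++ r) (w.map (GSlice.widen l r)) A B ↔
      (∀ i < l.length, A i = B i) ∧
      Sol a w (fun j => A (l.length + j)) (fun j => B (l.length + j)) ∧
      ∀ i < r.length, A (l.length + a.length + i) = B (l.length + b.length + i) := by
  have hget : ∀ (l : List Bool) (p : ℕ → Prop),
      (∀ i x, l[i]? = some x → p i) ↔ ∀ i < l.length, p i := fun l p =>
    ⟨fun h i hi => h i _ (List.getElem?_eq_getElem hi),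
      fun h i x hx => h i (List.getElem?_eq_some_iff.1 hx).1⟩
  induction w generalizing a A with
  | nil =>
    obtain rfl : a = b := h
    simp only [List.map_nil, Sol, List.length_append]
    constructor
    · intro h
      exact ⟨fun i hi => h i (by omega), fun i hi => h _ (by omega), fun i hi => h _ (by omega)⟩
    · rintro ⟨h1, h2, h3⟩ i hi
      by_cases hl : i < l.length
      · exact h1 i hl
      · by_cases hm : i < l.length + a.length
        · have := h2 (i - l.length) (by omega)
          rwa [Nat.add_sub_cancel' (by omega)] at this
        · have := h3 (i - (l.length + a.length)) (by omega)
          rwa [Nat.add_sub_cancel' (by omega)] at this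
  | cons s w ih =>
    simp only [List.map_cons, Sol, GSlice.ends_widen, ih h.2, GSlice.Rel, GSlice.cond_widen,
      hget l, hget r]
    constructor
    · rintro ⟨C, ⟨h1, h2, h3⟩, h4, h5, h6⟩
      refine ⟨fun i hi => (h1 i hi).trans (h4 i hi), ⟨_, h2, h5⟩, fun i hi => ?_⟩
      rw [← h6 i hi, ← h3 i hi, h.1]
    · rintro ⟨h1, ⟨C, h2, h3⟩, h4⟩
      -- On the intermediate line the added strands keep the labels they have at the bottom.
      refine ⟨glue l.length (s.ends true).length A C
        (fun i => A (l.length + (s.ends false).length + i)), ⟨fun i hi => (glue_left hi).symm, ?_,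
          fun i hi => (glue_right
            (R := fun i => A (l.length + (s.ends false).length + i)) i).symm⟩,
          fun i hi => (glue_left hi).trans (h1 i hi), ?_,
          fun i hi => (glue_right i).trans ?_⟩
      · exact s.rel_congr h2 (fun _ _ => rfl) fun j hj => (glue_mid hj).symm
      · exact h3.congr h.2 (fun j hj => (glue_mid hj).symm) fun _ _ => rfl
      · rw [← h4 i hi, h.1]

theorem GPiece.ord_congr (p : GPiece) {A B A' B' : ℕ → ℕ} (h : p.Ord A B)
    (hA : ∀ j < (p.ends false).length, A j = A' j)
    (hB : ∀ j < (p.ends true).length, B j = B' j) : p.Ord A' B' := by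
  rcases p with x | x | s
  · have h0 := hB 0 (by simp [GPiece.ends])
    have h1 := hB 1 (by simp [GPiece.ends])
    cases x <;> simp_all [GPiece.Ord]
  · have h0 := hA 0 (by simp [GPiece.ends])
    have h1 := hA 1 (by simp [GPiece.ends])
    cases x <;> simp_all [GPiece.Ord]
  · have h0 := hB 0 (by simp [GPiece.ends])
    have h1 := hB 1 (by simp [GPiece.ends])
    have h3 := hA 0 (by simp [GPiece.ends])
    have h4 := hA 1 (by simp [GPiece.ends])
    simp only [GPiece.Ord] at h ⊢
    rwa [← h0, ← h1, ← h3, ← h4]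

theorem GSlice.ord_congr (s : GSlice) {A B A' B' : ℕ → ℕ} (h : s.Ord A B)
    (hA : ∀ j < (s.ends false).length, A j = A' j)
    (hB : ∀ j < (s.ends true).length, B j = B' j) : s.Ord A' B' := by
  simp only [s.length_ends] at hA hB
  obtain ⟨h1, h2, h3⟩ := h
  refine ⟨fun i x hx => ?_, s.piece.ord_congr h2 (fun j hj => hA _ (by omega))
    (fun j hj => hB _ (by omega)), fun i x hx => ?_⟩
  · have hi := (List.getElem?_eq_some_iff.1 hx).1
    rw [← hA i (by omega), ← hB i (by omega)]
    exact h1 i x hx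
  · have hi := (List.getElem?_eq_some_iff.1 hx).1
    rw [← hA _ (by omega), ← hB _ (by omega)]
    exact h3 i x hx

theorem Acyclic.widen {a b : List Bool} {w : List GSlice} (h : GFits a w b) (hw : Acyclic w)
    (l r : List Bool) : Acyclic (w.map (GSlice.widen l r)) := by
  obtain ⟨O, hO⟩ := hw
  -- Added strands are numbered by height if they go up and by depth if they go down. No relation
  -- couples them to the inner part, so the two numberings need not be compared.
  set Z : List Bool → ℕ → ℕ → ℕ := fun l k i =>
    if l[i]? = some true then k else w.length - k with hZ
  have hZthr : ∀ (l : List Bool) (k i : ℕ) (x : Bool), k < w.length → l[i]? = some x →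
      if x then Z l k i < Z l (k + 1) i else Z l (k + 1) i < Z l k i := by
    intro l k i x hk hx
    simp only [hZ, hx]
    cases x
    · simp; omega
    · simp
  refine ⟨fun k => glue l.length (levFrom a w k).length (Z l k) (O k) (Z r k), ?_⟩
  intro k hk
  rw [List.length_map] at hk
  rw [List.getElem_map, GSlice.Ord, GSlice.cond_widen]
  have hs := gfits_src h hk
  have ht := gfits_tgt h hk
  refine ⟨fun i x hx => ?_, ?_, fun i x hx => ?_⟩
  · have hi := (List.getElem?_eq_some_iff.1 hx).1
    beta_reduce
    rw [glue_left hi, glue_left hi]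
    exact hZthr l k i x hk hx
  · refine GSlice.ord_congr _ (hO k hk) (fun j hj => ?_) (fun j hj => ?_)
    · rw [hs] at hj; exact (glue_mid hj).symm
    · rw [ht] at hj; exact (glue_mid hj).symm
  · beta_reduce
    rw [hs, ht, glue_right, glue_right]
    exact hZthr r k i x hk hx

theorem Transfer.widen {a b : List Bool} {u v : List GSlice} (h : Transfer a b u v)
    (l r : List Bool) : Transfer (l ++ a ++ r) (l ++ b ++ r) (u.map (GSlice.widen l r))
      (v.map (GSlice.widen l r)) where
  fits_left := h.fits_left.widen l r
  fits_right := h.fits_right.widen l r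
  acyclic_left := h.acyclic_left.widen h.fits_left l r
  acyclic_right := h.acyclic_right.widen h.fits_right l r
  sol A B hs := by
    rw [sol_widen h.fits_right]
    obtain ⟨h1, h2, h3⟩ := (sol_widen h.fits_left l r A B).1 hs
    exact ⟨h1, h.sol _ _ h2, h3⟩
  enter := by
    rcases h.enter with h | h
    · left; simp [h]
    · right; simp [h]

/-! ### The local moves -/

theorem forall_getElem?_nil {p : ℕ → Bool → Prop} :
    (∀ i x, ([] : List Bool)[i]? = some x → p i x) ↔ True := by simp

theorem forall_getElem?_cons {a : Bool} {l : List Bool} {p : ℕ → Bool → Prop} :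
    (∀ i x, (a :: l)[i]? = some x → p i x) ↔
      p 0 a ∧ ∀ i x, l[i]? = some x → p (i + 1) x := by
  constructor
  · exact fun h => ⟨h 0 a rfl, fun i x hx => h (i + 1) x (by simpa using hx)⟩
  · rintro ⟨h0, h⟩ (_ | i) x hx
    · obtain rfl : a = x := by simpa using hx
      exact h0
    · exact h i x (by simpa using hx)

/-- The numbering increases along the dependencies of all slices. -/
def OrdChain : List GSlice → (ℕ → ℕ → ℕ) → Prop
  | [], _ => True
  | s :: w, O => s.Ord (O 0) (O 1) ∧ OrdChain w (fun k => O (k + 1))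

theorem OrdChain.acyclic {w : List GSlice} {O : ℕ → ℕ → ℕ} (h : OrdChain w O) : Acyclic w := by
  refine ⟨O, ?_⟩
  induction w generalizing O with
  | nil => intro i hi; simp at hi
  | cons s w ih =>
    rintro (_ | i) hi
    · exact h.1
    · exact ih h.2 i (by simpa using hi)

/-- The numbering given by a table. -/
def tableOrd (t : List (List ℕ)) (k i : ℕ) : ℕ := (t.getD k []).getD i 0

theorem acyclic_nil : Acyclic [] := OrdChain.acyclic (O := fun _ _ => 0) trivial

theorem transfer_zig (x : Bool) : Transfer [x] [x]
    [⟨[x], .cup (!x), []⟩, ⟨[], .cap x, [x]⟩] [] where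
  fits_left := by cases x <;> simp [GFits, GSlice.ends, GPiece.ends]
  fits_right := rfl
  acyclic_left := by
    cases x
    -- Each row of a table is a horizontal line, from bottom to top, with its points from left to
    -- right. Here the numbers simply increase along the oriented strand.
    · refine OrdChain.acyclic (O := tableOrd [[4], [3, 2, 1], [0]]) ?_
      simp only [OrdChain, GSlice.Ord, GSlice.Cond, GPiece.Ord, GPiece.ends,
        forall_getElem?_cons, forall_getElem?_nil]
      simp [tableOrd]
    · refine OrdChain.acyclic (O := tableOrd [[0], [1, 2, 3], [4]]) ?_
      simp only [OrdChain, GSlice.Ord, GSlice.Cond, GPiece.Ord, GPiece.ends,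
        forall_getElem?_cons, forall_getElem?_nil]
      simp [tableOrd]
  acyclic_right := acyclic_nil
  sol A B h := by
    simp only [Sol, GSlice.Rel, GSlice.Cond, GPiece.Rel, GPiece.ends, GSlice.ends,
      forall_getElem?_cons, forall_getElem?_nil] at h
    simp at h
    simp [Sol]
    grind
  enter := by cases x <;> simp

theorem transfer_zag (x : Bool) : Transfer [x] [x]
    [⟨[], .cup x, [x]⟩, ⟨[x], .cap (!x), []⟩] [] where
  fits_left := by cases x <;> simp [GFits, GSlice.ends, GPiece.ends]
  fits_right := rfl
  acyclic_left := by
    cases x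
    · refine OrdChain.acyclic (O := tableOrd [[4], [1, 2, 3], [0]]) ?_
      simp only [OrdChain, GSlice.Ord, GSlice.Cond, GPiece.Ord, GPiece.ends,
        forall_getElem?_cons, forall_getElem?_nil]
      simp [tableOrd]
    · refine OrdChain.acyclic (O := tableOrd [[0], [3, 2, 1], [4]]) ?_
      simp only [OrdChain, GSlice.Ord, GSlice.Cond, GPiece.Ord, GPiece.ends,
        forall_getElem?_cons, forall_getElem?_nil]
      simp [tableOrd]
  acyclic_right := acyclic_nil
  sol A B h := by
    simp only [Sol, GSlice.Rel, GSlice.Cond, GPiece.Rel, GPiece.ends, GSlice.ends,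
      forall_getElem?_cons, forall_getElem?_nil] at h
    simp at h
    simp [Sol]
    grind
  enter := by cases x <;> simp

theorem transfer_rotate (s : Coef) : Transfer [false, false] [false, false]
    [⟨[false, false], .cup true, []⟩, ⟨[false, false, true], .cup true, [false]⟩,
      ⟨[false, false], .vert s, [false, false]⟩, ⟨[false], .cap false, [true, false, false]⟩,
      ⟨[], .cap false, [false, false]⟩]
    [⟨[], .cup false, [false, false]⟩, ⟨[false], .cup false, [true, false, false]⟩,
      ⟨[false, false], .vert s, [false, false]⟩, ⟨[false, false, true], .cap true, [false]⟩,
      ⟨[false, false], .cap true, []⟩] where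
  fits_left := by simp [GFits, GSlice.ends, GPiece.ends]
  fits_right := by simp [GFits, GSlice.ends, GPiece.ends]
  acyclic_left := by
    refine OrdChain.acyclic (O := tableOrd [[13, 11], [12, 10, 5, 4], [11, 9, 6, 4, 3, 3],
      [10, 8, 7, 7, 2, 2], [9, 8, 1, 1], [0, 0]]) ?_
    simp only [OrdChain, GSlice.Ord, GSlice.Cond, GPiece.Ord, GPiece.ends,
      forall_getElem?_cons, forall_getElem?_nil]
    simp [tableOrd]
  acyclic_right := by
    refine OrdChain.acyclic (O := tableOrd [[11, 13], [4, 5, 10, 12], [3, 3, 4, 6, 9, 11],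
      [2, 2, 7, 7, 8, 10], [1, 1, 8, 9], [0, 0]]) ?_
    simp only [OrdChain, GSlice.Ord, GSlice.Cond, GPiece.Ord, GPiece.ends,
      forall_getElem?_cons, forall_getElem?_nil]
    simp [tableOrd]
  sol A B h := by
    have h' : A 1 = (1 - s * hp (-2)) * B 1 + s * hp (-2) * B 0 ∧
        A 0 = s * B 1 + (1 - s) * B 0 := by
      simp only [Sol, GSlice.Rel, GSlice.Cond, GPiece.Rel, GPiece.ends, GSlice.ends,
        forall_getElem?_cons, forall_getElem?_nil] at h
      simp at h
      grind
    obtain ⟨h1, h0⟩ := h'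
    -- The labels on the successive lines of the second diagram: the turns carry the entering labels
    -- `B` down to the piece, and the piece returns the labels `A`.
    refine ⟨fun i => [B 0, B 0, A 0, A 1].getD i 0, ?_,
      fun i => [B 0, B 1, B 1, B 0, A 0, A 1].getD i 0, ?_,
      fun i => [B 0, B 1, A 1, A 0, A 0, A 1].getD i 0, ?_,
      fun i => [B 0, B 1, A 1, A 1].getD i 0, ?_, B, ?_, fun _ _ => rfl⟩ <;>
    · simp only [GSlice.Rel, GSlice.Cond, GPiece.Rel, GPiece.ends, forall_getElem?_cons,
        forall_getElem?_nil]
      simp [h0, h1]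
  enter := by simp

/-- The loop of the kink feeds the label `A 1` of the crossing back to itself with coefficient `1 -
s`. At weight `1` this vanishes and the system becomes acyclic. -/
theorem transfer_kinkR : Transfer [true] [true]
    [⟨[true], .cup true, []⟩, ⟨[], .vert 1, [false]⟩, ⟨[true], .cap true, []⟩] [] where
  fits_left := by simp [GFits, GSlice.ends, GPiece.ends]
  fits_right := rfl
  acyclic_left := by
    refine OrdChain.acyclic (O := tableOrd [[0], [1, 5, 4], [6, 2, 3], [7]]) ?_
    simp only [OrdChain, GSlice.Ord, GSlice.Cond, GPiece.Ord, GPiece.ends,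
      forall_getElem?_cons, forall_getElem?_nil]
    simp [tableOrd]
  acyclic_right := acyclic_nil
  sol A B h := by
    simp only [Sol, GSlice.Rel, GSlice.Cond, GPiece.Rel, GPiece.ends, GSlice.ends,
      forall_getElem?_cons, forall_getElem?_nil] at h
    simp at h
    simp [Sol]
    grind
  enter := by simp

/-- Here the feedback coefficient is `1 - s T⁻¹`, so the acyclic case is the weight `T`. -/
theorem transfer_kinkL : Transfer [true] [true]
    [⟨[], .cup false, [true]⟩, ⟨[false], .vert (hp 2), []⟩, ⟨[], .cap false, [true]⟩] [] where
  fits_left := by simp [GFits, GSlice.ends, GPiece.ends]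
  fits_right := rfl
  acyclic_left := by
    refine OrdChain.acyclic (O := tableOrd [[0], [4, 5, 1], [3, 2, 6], [7]]) ?_
    simp only [OrdChain, GSlice.Ord, GSlice.Cond, GPiece.Ord, GPiece.ends,
      forall_getElem?_cons, forall_getElem?_nil]
    simp [tableOrd, hp_two_mul]
  acyclic_right := acyclic_nil
  sol A B h := by
    simp only [Sol, GSlice.Rel, GSlice.Cond, GPiece.Rel, GPiece.ends, GSlice.ends,
      forall_getElem?_cons, forall_getElem?_nil] at h
    simp [hp_two_mul] at h
    simp [Sol]
    grind
  enter := by simp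

/-- The weights of two vertical pieces which cancel. -/
def Inverse (s t : Coef) : Prop := (s = 1 ∧ t = hp 2) ∨ (s = hp 2 ∧ t = 1)

theorem transfer_cancel {s t : Coef} (hst : Inverse s t) : Transfer [true, true] [true, true]
    [⟨[], .vert s, []⟩, ⟨[], .vert t, []⟩] [] where
  fits_left := by simp [GFits, GSlice.ends, GPiece.ends]
  fits_right := rfl
  acyclic_left := by
    refine OrdChain.acyclic (O := fun k _ => k) ?_
    simp [OrdChain, GSlice.Ord, GSlice.Cond, GPiece.Ord]
  acyclic_right := acyclic_nil
  sol A B h := by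
    have hk := hp_two_mul
    rcases hst with ⟨rfl, rfl⟩ | ⟨rfl, rfl⟩
    all_goals
      simp only [Sol, GSlice.Rel, GSlice.Cond, GPiece.Rel, GPiece.ends, GSlice.ends,
        forall_getElem?_nil] at h
      simp [hp_two_mul] at h
      simp [Sol]
      grind
  enter := by simp

theorem transfer_vert_zero : Transfer [true, true] [true, true] [⟨[], .vert 0, []⟩] [] where
  fits_left := by simp [GFits, GSlice.ends, GPiece.ends]
  fits_right := rfl
  acyclic_left := by
    refine OrdChain.acyclic (O := fun k _ => k) ?_
    simp [OrdChain, GSlice.Ord, GSlice.Cond, GPiece.Ord]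
  acyclic_right := acyclic_nil
  sol A B h := by
    simp only [Sol, GSlice.Rel, GSlice.Cond, GPiece.Rel, GPiece.ends, GSlice.ends,
      forall_getElem?_nil] at h
    simp at h
    simp [Sol]
    grind
  enter := by simp

/-- Two vertical pieces act by `1 + s N` and `1 + t N` with the same `N`, and these commute. -/
theorem transfer_flip (s t : Coef) : Transfer [true, true] [true, true]
    [⟨[], .vert s, []⟩, ⟨[], .vert t, []⟩] [⟨[], .vert t, []⟩, ⟨[], .vert s, []⟩] where
  fits_left := by simp [GFits, GSlice.ends, GPiece.ends]
  fits_right := by simp [GFits, GSlice.ends, GPiece.ends]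
  acyclic_left := by
    refine OrdChain.acyclic (O := fun k _ => k) ?_
    simp [OrdChain, GSlice.Ord, GSlice.Cond, GPiece.Ord]
  acyclic_right := by
    refine OrdChain.acyclic (O := fun k _ => k) ?_
    simp [OrdChain, GSlice.Ord, GSlice.Cond, GPiece.Ord]
  sol A B h := by
    obtain ⟨C, ⟨-, ⟨h0, h1⟩, -⟩, D, ⟨-, ⟨h2, h3⟩, -⟩, h4⟩ := h
    simp only [List.length_nil, Nat.zero_add] at h0 h1 h2 h3
    refine ⟨fun i => [(1 - t * hp (-2)) * A 0 + t * hp (-2) * A 1, t * A 0 + (1 - t) * A 1].getD i 0,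
      ?_, D, ?_, h4⟩
    · simp [GSlice.Rel, GSlice.Cond, GPiece.Rel]
    · simp [GSlice.Rel, GSlice.Cond, GPiece.Rel]
      rw [h2, h3, h0, h1]
      constructor <;> ring
  enter := by simp

/-- The weight `t` is arbitrary: `t = s` gives the third Reidemeister move and the indeterminate
gives the slide past a singular point. -/
theorem transfer_slide {s : Coef} (hs : s = 1 ∨ s = hp 2) (t : Coef) :
    Transfer [true, true, true] [true, true, true]
    [⟨[], .vert s, [true]⟩, ⟨[true], .vert s, []⟩, ⟨[], .vert t, [true]⟩]
    [⟨[true], .vert t, []⟩, ⟨[], .vert s, [true]⟩, ⟨[true], .vert s, []⟩] where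
  fits_left := by simp [GFits, GSlice.ends, GPiece.ends]
  fits_right := by simp [GFits, GSlice.ends, GPiece.ends]
  acyclic_left := by
    refine OrdChain.acyclic (O := fun k _ => k) ?_
    simp only [OrdChain, GSlice.Ord, GSlice.Cond, GPiece.Ord, forall_getElem?_cons,
      forall_getElem?_nil]
    simp
  acyclic_right := by
    refine OrdChain.acyclic (O := fun k _ => k) ?_
    simp only [OrdChain, GSlice.Ord, GSlice.Cond, GPiece.Ord, forall_getElem?_cons,
      forall_getElem?_nil]
    simp
  sol A B h := by
    simp only [Sol, GSlice.Rel, GSlice.Cond, GPiece.Rel, GPiece.ends,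
      forall_getElem?_cons, forall_getElem?_nil] at h
    simp at h
    obtain ⟨C, ⟨⟨c0, c1⟩, c2⟩, D, ⟨d0, d1, d2⟩, E, ⟨⟨e0, e1⟩, e2⟩, hB⟩ := h
    refine ⟨fun i => [A 0, (1 - t * hp (-2)) * A 1 + t * hp (-2) * A 2,
      t * A 1 + (1 - t) * A 2].getD i 0, ?_,
      fun i => [E 0, s * A 0 + (1 - s) * ((1 - t * hp (-2)) * A 1 + t * hp (-2) * A 2),
      t * A 1 + (1 - t) * A 2].getD i 0, ?_, E, ?_, hB⟩
    · simp only [GSlice.Rel, GSlice.Cond, GPiece.Rel, GPiece.ends, forall_getElem?_cons,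
        forall_getElem?_nil]
      simp
    all_goals
      rcases hs with rfl | rfl
      all_goals
        simp only [GSlice.Rel, GSlice.Cond, GPiece.Rel, GPiece.ends, forall_getElem?_cons,
          forall_getElem?_nil]
        simp [hp_two_mul] at *
        have hk := hp_two_mul
        grind
  enter := by simp

theorem transfer_cancelRL {s t : Coef} (hst : Inverse s t) :
    Transfer [true, false] [true, false]
    [⟨[], .cup false, [true, false]⟩, ⟨[false], .vert s, [false]⟩, ⟨[false, true], .cap true, []⟩,
      ⟨[false, true], .cup true, []⟩, ⟨[false], .vert t, [false]⟩, ⟨[], .cap false, [true, false]⟩]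
    [] where
  fits_left := by simp [GFits, GSlice.ends, GPiece.ends]
  fits_right := rfl
  acyclic_left := by
    rcases hst with ⟨rfl, rfl⟩ | ⟨rfl, rfl⟩
    -- The two orders of the weights need different tables: weight `1` removes the dependence of `B
    -- 1` on `A 1`, weight `T` that of `B 0` on `A 0`.
    · refine OrdChain.acyclic (O := tableOrd [[0, 14], [9, 10, 1, 13], [8, 11, 11, 12], [7, 12],
        [6, 13, 3, 2], [5, 4, 14, 1], [15, 0]]) ?_
      simp only [OrdChain, GSlice.Ord, GSlice.Cond, GPiece.Ord, GPiece.ends,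
        forall_getElem?_cons, forall_getElem?_nil]
      simp [tableOrd, hp_two_mul]
    · refine OrdChain.acyclic (O := tableOrd [[0, 15], [10, 11, 1, 14], [9, 2, 12, 13], [8, 3],
        [7, 4, 3, 2], [6, 5, 5, 1], [6, 0]]) ?_
      simp only [OrdChain, GSlice.Ord, GSlice.Cond, GPiece.Ord, GPiece.ends,
        forall_getElem?_cons, forall_getElem?_nil]
      simp [tableOrd, hp_two_mul]
  acyclic_right := acyclic_nil
  sol A B h := by
    have hk := hp_two_mul
    rcases hst with ⟨rfl, rfl⟩ | ⟨rfl, rfl⟩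
    all_goals
      simp only [Sol, GSlice.Rel, GSlice.Cond, GPiece.Rel, GPiece.ends, GSlice.ends,
        forall_getElem?_cons, forall_getElem?_nil] at h
      simp [hp_two_mul] at h
      simp [Sol]
      grind
  enter := by simp

theorem transfer_cancelLR {s t : Coef} (hst : Inverse s t) :
    Transfer [false, true] [false, true]
    [⟨[false, true], .cup true, []⟩, ⟨[false], .vert s, [false]⟩, ⟨[], .cap false, [true, false]⟩,
      ⟨[], .cup false, [true, false]⟩, ⟨[false], .vert t, [false]⟩, ⟨[false, true], .cap true, []⟩]
    [] where
  fits_left := by simp [GFits, GSlice.ends, GPiece.ends]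
  fits_right := rfl
  acyclic_left := by
    rcases hst with ⟨rfl, rfl⟩ | ⟨rfl, rfl⟩
    · refine OrdChain.acyclic (O := tableOrd [[15, 0], [14, 1, 11, 10], [13, 12, 2, 9], [3, 8],
        [2, 3, 4, 7], [1, 5, 5, 6], [0, 6]]) ?_
      simp only [OrdChain, GSlice.Ord, GSlice.Cond, GPiece.Ord, GPiece.ends,
        forall_getElem?_cons, forall_getElem?_nil]
      simp [tableOrd, hp_two_mul]
    · refine OrdChain.acyclic (O := tableOrd [[14, 0], [13, 1, 10, 9], [12, 11, 11, 8], [12, 7],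
        [2, 3, 13, 6], [1, 14, 4, 5], [0, 15]]) ?_
      simp only [OrdChain, GSlice.Ord, GSlice.Cond, GPiece.Ord, GPiece.ends,
        forall_getElem?_cons, forall_getElem?_nil]
      simp [tableOrd, hp_two_mul]
  acyclic_right := acyclic_nil
  sol A B h := by
    have hk := hp_two_mul
    rcases hst with ⟨rfl, rfl⟩ | ⟨rfl, rfl⟩
    all_goals
      simp only [Sol, GSlice.Rel, GSlice.Cond, GPiece.Rel, GPiece.ends, GSlice.ends,
        forall_getElem?_cons, forall_getElem?_nil] at h
      simp [hp_two_mul] at h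
      simp [Sol]
      grind
  enter := by simp

/-! ### Exchanging the heights of two pieces -/

theorem GPiece.rel_congr (p : GPiece) {A B A' B' : ℕ → Coef} (h : p.Rel A B)
    (hA : ∀ j < (p.ends false).length, A j = A' j)
    (hB : ∀ j < (p.ends true).length, B j = B' j) : p.Rel A' B' := by
  rw [GPiece.rel_iff] at h ⊢
  intro a i hi
  rw [← p.out_congr hi hA hB, ← h a i hi]
  have hl : i < (p.ends a).length := (List.getElem?_eq_some_iff.1 hi).1
  cases a
  · simp [hA i hl]
  · simp [hB i hl]

/-- A number for a strand of direction `x` which meets the piece, at height `k`. -/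
def GPiece.strandOrd : GPiece → Bool → ℕ → ℕ
  -- At a minimum the link comes in downwards and goes out upwards, so downward numbers must be the
  -- smaller ones; at a maximum it is the other way round. Only heights up to `2` occur, so the
  -- ranges do not meet and no subtraction is truncated.
  | .cup _, x, k => if x then 10 + k else 5 - k
  | _, x, k => if x then k else 20 - k

/-- The numbers of the ends of a piece at height `k`. -/
def GPiece.label (p : GPiece) (a : Bool) (k i : ℕ) : ℕ :=
  p.strandOrd (decide ((p.ends a)[i]? = some true)) k

/-- The numbers of vertical strands at height `k`. -/
def strandLabel (m : List Bool) (k i : ℕ) : ℕ := if m[i]? = some true then k else 20 - k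

theorem strandLabel_mono {m : List Bool} {k i : ℕ} {x : Bool} (hk : k < 2) (h : m[i]? = some x) :
    if x then strandLabel m k i < strandLabel m (k + 1) i
    else strandLabel m (k + 1) i < strandLabel m k i := by
  cases x <;> simp [strandLabel, h]
  omega

theorem GPiece.label_mono {p : GPiece} {a : Bool} {k i : ℕ} {x : Bool} (hk : k < 2)
    (h : (p.ends a)[i]? = some x) :
    if x then p.label a k i < p.label a (k + 1) i else p.label a (k + 1) i < p.label a k i := by
  rcases p with y | y | s <;> cases x <;> simp [label, h, strandOrd] <;> omega

theorem GPiece.ord_label (p : GPiece) {k : ℕ} (hk : k < 2) :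
    p.Ord (p.label false k) (p.label true (k + 1)) := by
  rcases p with x | x | s
  · cases x <;> simp [GPiece.Ord, label, strandOrd, GPiece.ends] <;> omega
  · cases x <;> simp [GPiece.Ord, label, strandOrd, GPiece.ends] <;> omega
  · simp [GPiece.Ord, label, strandOrd, GPiece.ends]

theorem ord_lower (p : GPiece) (m n : List Bool) (N N' : ℕ → ℕ) {k : ℕ} (hk : k < 2)
    (hN : ∀ (i : ℕ) (x : Bool), n[i]? = some x → if x then N i < N' i else N' i < N i) :
    (GSlice.mk [] p (m ++ n)).Ord
      (glue (p.ends false).length m.length (p.label false k) (strandLabel m k) N)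
      (glue (p.ends true).length m.length (p.label true (k + 1)) (strandLabel m (k + 1)) N') := by
  refine ⟨by simp, ?_, ?_⟩
  · refine p.ord_congr (p.ord_label hk) (fun j hj => ?_) (fun j hj => ?_)
    · simp only [List.length_nil, Nat.zero_add]; exact (glue_left hj).symm
    · simp only [List.length_nil, Nat.zero_add]; exact (glue_left hj).symm
  · intro i x hx
    simp only [List.length_nil, Nat.zero_add]
    rcases getElem?_append_two.1 hx with h | ⟨j, rfl, h⟩
    · have hi := (List.getElem?_eq_some_iff.1 h).1
      rw [glue_mid hi, glue_mid hi]
      exact strandLabel_mono hk h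
    · rw [← add_assoc, ← add_assoc, glue_right, glue_right]
      exact hN j x h

theorem ord_upper (q : GPiece) (n m : List Bool) (N N' : ℕ → ℕ) {k : ℕ} (hk : k < 2)
    (hN : ∀ (i : ℕ) (x : Bool), n[i]? = some x → if x then N i < N' i else N' i < N i) :
    (GSlice.mk (n ++ m) q []).Ord
      (glue n.length m.length N (strandLabel m k) (q.label false k))
      (glue n.length m.length N' (strandLabel m (k + 1)) (q.label true (k + 1))) := by
  refine ⟨?_, ?_, by simp⟩
  · intro i x hx
    rcases getElem?_append_two.1 hx with h | ⟨j, rfl, h⟩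
    · have hi := (List.getElem?_eq_some_iff.1 h).1
      rw [glue_left hi, glue_left hi]
      exact hN i x h
    · have hi := (List.getElem?_eq_some_iff.1 h).1
      rw [glue_mid hi, glue_mid hi]
      exact strandLabel_mono hk h
  · simp only [List.length_append, glue_right]
    exact q.ord_label hk

theorem transfer_interchange (p q : GPiece) (m : List Bool) :
    Transfer (p.ends false ++ m ++ q.ends false) (p.ends true ++ m ++ q.ends true)
      [⟨[], p, m ++ q.ends false⟩, ⟨p.ends true ++ m, q, []⟩]
      [⟨p.ends false ++ m, q, []⟩, ⟨[], p, m ++ q.ends true⟩] where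
  fits_left := by simp [GFits, GSlice.ends]
  fits_right := by simp [GFits, GSlice.ends]
  acyclic_left := by
    refine OrdChain.acyclic (O := fun k => glue (p.ends (decide (1 ≤ k))).length m.length
      (p.label (decide (1 ≤ k)) k) (strandLabel m k) (q.label (decide (2 ≤ k)) k)) ⟨?_, ?_, trivial⟩
    · exact ord_lower p m _ _ _ (by omega) fun i x h => GPiece.label_mono (by omega) h
    · exact ord_upper q _ m _ _ (by omega) fun i x h => GPiece.label_mono (by omega) h
  acyclic_right := by
    refine OrdChain.acyclic (O := fun k => glue (p.ends (decide (2 ≤ k))).length m.length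
      (p.label (decide (2 ≤ k)) k) (strandLabel m k) (q.label (decide (1 ≤ k)) k)) ⟨?_, ?_, trivial⟩
    · exact ord_upper q _ m _ _ (by omega) fun i x h => GPiece.label_mono (by omega) h
    · exact ord_lower p m _ _ _ (by omega) fun i x h => GPiece.label_mono (by omega) h
  sol A B h := by
    obtain ⟨C, ⟨-, h1, h2⟩, D, ⟨h3, h4, -⟩, h5⟩ := h
    simp only [List.length_nil, Nat.zero_add, List.length_append] at h1 h2 h3 h4
    replace h5 : ∀ i < (p.ends true).length + m.length + (q.ends true).length, D i = B i :=
      fun i hi => h5 i (by simp [GSlice.ends]; omega)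
    have hC : ∀ i < (p.ends true).length + m.length, C i = B i := by
      intro i hi
      rw [h3 i _ (List.getElem?_eq_getElem (by simpa using hi)), h5 i (by omega)]
    have hA : ∀ i < m.length + (q.ends false).length,
        A ((p.ends false).length + i) = C ((p.ends true).length + i) := by
      intro i hi
      exact h2 i _ (List.getElem?_eq_getElem (by simpa using hi))
    -- On the new middle line `p` has not been passed and `q` has: the labels come from the bottom
    -- over `p` and `m`, and from the top over `q`.
    refine ⟨glue (p.ends false).length m.length A (fun i => A ((p.ends false).length + i))
      (fun i => B ((p.ends true).length + m.length + i)), ⟨?_, ?_, by simp⟩, B, ⟨by simp, ?_, ?_⟩,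
      fun _ _ => rfl⟩
    · intro i x hx
      have hi := (List.getElem?_eq_some_iff.1 hx).1
      rw [List.length_append] at hi
      by_cases hi' : i < (p.ends false).length
      · rw [glue_left hi']
      · obtain ⟨j, rfl⟩ : ∃ j, i = (p.ends false).length + j :=
          ⟨i - (p.ends false).length, by omega⟩
        rw [glue_mid (by omega)]
    · simp only [List.length_append, glue_right]
      refine q.rel_congr h4 (fun j hj => ?_) (fun j hj => ?_)
      · rw [add_assoc, add_assoc, hA _ (by omega)]
      · exact h5 _ (by omega)
    · simp only [List.length_nil, Nat.zero_add]
      refine p.rel_congr h1 (fun j hj => (glue_left hj).symm) (fun j hj => hC j (by omega))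
    · intro i x hx
      simp only [List.length_nil, Nat.zero_add]
      rcases getElem?_append_two.1 hx with h | ⟨j, rfl, h⟩
      · have hi := (List.getElem?_eq_some_iff.1 h).1
        rw [glue_mid hi, hA i (by omega), hC _ (by omega)]
      · rw [← add_assoc, ← add_assoc, glue_right]
  enter := by
    rcases p with x | x | s
    · right; cases x <;> simp [GPiece.ends]
    · left; cases x <;> simp [GPiece.ends]
    · left; simp [GPiece.ends]

/-! ### The weight of a vertical piece -/

theorem levFrom_replace {s s' : GSlice} (h : s.ends = s'.ends) (a : List Bool) (x y : List GSlice) :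
    levFrom a (x ++ s :: y) = levFrom a (x ++ s' :: y) := by
  induction x generalizing a with
  | nil => funext k; cases k <;> simp [levFrom, h]
  | cons t x ih => funext k; cases k <;> simp [levFrom, ih]

theorem getD_replace (s s' : GSlice) (x y : List GSlice) {k : ℕ} (hk : k ≠ x.length) :
    (x ++ s :: y).getD k GSlice.dummy = (x ++ s' :: y).getD k GSlice.dummy := by
  by_cases h : k < x.length
  · rw [List.getD_append _ _ _ _ h, List.getD_append _ _ _ _ h]
  · rw [List.getD_append_right _ _ _ _ (by omega), List.getD_append_right _ _ _ _ (by omega)]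
    obtain ⟨j, hj⟩ : ∃ j, k - x.length = j + 1 := ⟨k - x.length - 1, by omega⟩
    rw [hj]
    rfl

theorem getD_replaced (s : GSlice) (x y : List GSlice) :
    (x ++ s :: y).getD x.length GSlice.dummy = s := by
  rw [List.getD_append_right _ _ _ _ le_rfl, Nat.sub_self]
  rfl

/-- The normalised first minor is an affine function of the weight of a vertical piece. -/
theorem wval_vert {x y : List GSlice} {l r : List Bool} (hx : GFits [] x (l ++ [true, true] ++ r))
    (hy : GFits (l ++ [true, true] ++ r) y []) (s : Coef) :
    wval (x ++ ⟨l, .vert s, r⟩ :: y) =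
      wval (x ++ y) + s * (wval (x ++ ⟨l, .vert 1, r⟩ :: y) - wval (x ++ y)) := by
  have hf : ∀ t, GFits [] (x ++ ⟨l, .vert t, r⟩ :: y) [] := fun t =>
    gfits_append.2 ⟨_, hx, rfl, hy⟩
  have h0 : wval (x ++ ⟨l, .vert 0, r⟩ :: y) = wval (x ++ y) := by
    have := (transfer_vert_zero.widen l r).wval_eq hx hy
    simpa [GSlice.widen] using this
  rw [← h0, wval_eq (hf s), wval_eq (hf 0), wval_eq (hf 1)]
  have he : ∀ t t' : Coef, (GSlice.mk l (.vert t) r).ends = (GSlice.mk l (.vert t') r).ends :=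
    fun _ _ => rfl
  refine Stack.val_affine _ _ _ ?_ ?_ (levFrom_replace (he _ _) _ _ _)
    (levFrom_replace (he _ _) _ _ _) x.length (fun k hk => getD_replace _ _ _ _ hk)
    (fun k hk => getD_replace _ _ _ _ hk) (getD_replaced _ _ _) (getD_replaced _ _ _)
    (getD_replaced _ _ _)
  · simp [ofWord]
  · simp [ofWord]

/-- The first minors vanish if the diagram has a split circle. -/
theorem wval_circle {x y : List GSlice} {l r : List Bool} (c : Bool) (hne : l ++ r ≠ [])
    (hx : GFits [] x (l ++ r)) (hy : GFits (l ++ r) y []) :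
    wval (x ++ ⟨l, .cup c, r⟩ :: ⟨l, .cap c, r⟩ :: y) = 0 := by
  have hf : GFits [] (x ++ ⟨l, .cup c, r⟩ :: ⟨l, .cap c, r⟩ :: y) [] :=
    gfits_append.2 ⟨_, hx, by simp [GSlice.ends, GPiece.ends], by simp [GSlice.ends, GPiece.ends],
      by simpa [GSlice.ends, GPiece.ends] using hy⟩
  rw [wval_eq hf]
  set S := ofWord _ hf with hS
  have hn : S.n = x.length + 2 + y.length := by simp [hS, ofWord]; omega
  have hlev : S.lev x.length = l ++ r := by
    have := levFrom_append_right (⟨l, .cup c, r⟩ :: ⟨l, .cap c, r⟩ :: y) hx 0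
    rwa [levFrom_zero] at this
  have hlev' : S.lev (x.length + 1) = l ++ [c, !c] ++ r := by
    have := levFrom_append_right (⟨l, .cup c, r⟩ :: ⟨l, .cap c, r⟩ :: y) hx 1
    rwa [levFrom, levFrom_zero] at this
  have hsl : S.sl x.length = ⟨l, .cup c, r⟩ := getD_replaced _ _ _
  have hsl' : S.sl (x.length + 1) = ⟨l, .cap c, r⟩ := by
    have h := getD_replaced ⟨l, .cap c, r⟩ (x ++ [⟨l, .cup c, r⟩]) y
    rw [List.length_append, List.append_assoc] at h
    exact h
  have h0 : 0 < (l ++ r).length := List.length_pos_iff.2 hne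
  -- The label is `1` on the two points of the circle and `0` elsewhere. The base point lies on
  -- another strand, which exists by `hne`.
  refine S.val_eq_zero
    (fun k i => if k = x.length + 1 ∧ (i = l.length ∨ i = l.length + 1) then 1 else 0) ?_
    (P := ⟨⟨x.length, by omega⟩, ⟨0, by rwa [hlev]⟩⟩)
    (Q := ⟨⟨x.length + 1, by omega⟩, ⟨l.length, by rw [hlev']; simp⟩⟩) (by simp) (by simp)
  intro k hk
  by_cases h1 : k = x.length
  · subst h1
    rw [hsl]
    refine ⟨fun i d hi => ?_, ?_, fun i d hi => ?_⟩
    · have : i < l.length := (List.getElem?_eq_some_iff.1 hi).1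
      simp; omega
    · simp [GPiece.Rel]
    · simp [GPiece.ends]; omega
  · by_cases h2 : k = x.length + 1
    · subst h2
      rw [hsl']
      refine ⟨fun i d hi => ?_, ?_, fun i d hi => ?_⟩
      · have : i < l.length := (List.getElem?_eq_some_iff.1 hi).1
        simp; omega
      · simp [GPiece.Rel]
      · simp [GPiece.ends]; omega
    · have h3 : k + 1 ≠ x.length + 1 := by omega
      simp only [h2, h3, false_and, if_false]
      refine ⟨fun _ _ _ => rfl, ?_, fun _ _ _ => rfl⟩
      rcases (S.sl k).piece with d | d | t <;> simp [GPiece.Rel]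

/-- Both sides are affine in `s`, so two weights suffice: at `1` the kink can be removed, and at `0`
it splits off a circle, which makes the minor vanish. -/
theorem wval_kinkR {x y : List GSlice} {l r : List Bool} (s : Coef)
    (hx : GFits [] x (l ++ [true] ++ r)) (hy : GFits (l ++ [true] ++ r) y []) :
    wval (x ++ [⟨[true], .cup true, []⟩, ⟨[], .vert s, [false]⟩,
      ⟨[true], .cap true, []⟩].map (GSlice.widen l r) ++ y) = s * wval (x ++ y) := by
  have h1 := (transfer_kinkR.widen l r).wval_eq hx hy
  have h0 := wval_circle (x := x) (y := y) (l := l ++ [true]) (r := r) true (by simp)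
    (by simpa using hx) (by simpa using hy)
  have h := fun s => wval_vert (x := x ++ [⟨l ++ [true], .cup true, r⟩])
    (y := ⟨l ++ [true], .cap true, r⟩ :: y) (l := l) (r := false :: r)
    (gfits_append.2 ⟨_, hx, by simp [GSlice.ends, GPiece.ends, GFits]⟩)
    ⟨by simp [GSlice.ends, GPiece.ends], by simpa [GSlice.ends, GPiece.ends] using hy⟩ s
  simp only [List.append_assoc, List.cons_append, List.nil_append, List.map_cons, List.map_nil,
    GSlice.widen, List.append_nil] at h h0 h1 ⊢
  rw [h, h0, h1]
  ring

/-- The same interpolation, with `T` as the weight at which the kink can be removed. -/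
theorem wval_kinkL {x y : List GSlice} {l r : List Bool} (s : Coef)
    (hx : GFits [] x (l ++ [true] ++ r)) (hy : GFits (l ++ [true] ++ r) y []) :
    wval (x ++ [⟨[], .cup false, [true]⟩, ⟨[false], .vert s, []⟩,
      ⟨[], .cap false, [true]⟩].map (GSlice.widen l r) ++ y) = s * hp (-2) * wval (x ++ y) := by
  have h1 := (transfer_kinkL.widen l r).wval_eq hx hy
  have h0 := wval_circle (x := x) (y := y) (l := l) (r := true :: r) false (by simp)
    (by simpa using hx) (by simpa using hy)
  have h := fun s => wval_vert (x := x ++ [⟨l, .cup false, true :: r⟩])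
    (y := ⟨l, .cap false, true :: r⟩ :: y) (l := l ++ [false]) (r := r)
    (gfits_append.2 ⟨_, hx, by simp [GSlice.ends, GPiece.ends, GFits]⟩)
    ⟨by simp [GSlice.ends, GPiece.ends], by simpa [GSlice.ends, GPiece.ends] using hy⟩ s
  simp only [List.append_assoc, List.cons_append, List.nil_append, List.map_cons, List.map_nil,
    GSlice.widen, List.append_nil] at h h0 h1 ⊢
  have h2 := h (hp 2)
  rw [h1, h0] at h2
  rw [h, h0, h2]
  linear_combination -(s * wval (x ++ ⟨l, .cup false, true :: r⟩ ::
    ⟨l ++ [false], .vert 1, r⟩ :: ⟨l, .cap false, true :: r⟩ :: y)) * hp_two_mul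

/-! ### The polynomial of a diagram -/

/-- The weight of a crossing of the given sign. -/
noncomputable def crossingWeight (e : Bool) : Coef := if e then 1 else hp 2

theorem inverse_crossingWeight (e : Bool) :
    Inverse (crossingWeight e) (crossingWeight (!e)) := by
  cases e <;> simp [Inverse, crossingWeight]

theorem crossingWeight_eq (e : Bool) : crossingWeight e = 1 ∨ crossingWeight e = hp 2 := by
  cases e <;> simp [crossingWeight]

/-- The weighted piece of a piece: the weight of a singular point is the variable. -/
noncomputable def Piece.toG : Piece → GPiece
  | .cup x => .cup x
  | .cap x => .cap x
  | .crossing e => .vert (crossingWeight e)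
  | .sing => .vert Polynomial.X

/-- The weighted slice of a slice. -/
noncomputable def Slice.toG (s : Slice) : GSlice := ⟨s.left, s.piece.toG, s.right⟩

theorem Piece.ends_toG_false (p : Piece) : p.toG.ends false = p.src := by cases p <;> rfl

theorem Piece.ends_toG_true (p : Piece) : p.toG.ends true = p.tgt := by cases p <;> rfl

theorem Slice.ends_toG_false (s : Slice) : s.toG.ends false = s.src := by
  simp [GSlice.ends, Slice.toG, Slice.src, Piece.ends_toG_false]

theorem Slice.ends_toG_true (s : Slice) : s.toG.ends true = s.tgt := by
  simp [GSlice.ends, Slice.toG, Slice.tgt, Piece.ends_toG_true]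

theorem fits_iff {a b : List Bool} {w : List Slice} : Fits a w b ↔ GFits a (w.map Slice.toG) b := by
  induction w generalizing a with
  | nil => rfl
  | cons s w ih =>
    simp only [Fits, List.map_cons, GFits, s.ends_toG_false, s.ends_toG_true, ih]

theorem map_widen_toG (l r : List Bool) (u : List Slice) :
    (u.map (Slice.widen l r)).map Slice.toG = (u.map Slice.toG).map (GSlice.widen l r) := by
  simp only [List.map_map]
  rfl

/-- The number of singular points of a piece. -/
def Piece.sings : Piece → ℕ
  | .sing => 1
  | _ => 0

/-- The number of singular points. -/
def numSing (w : List Slice) : ℕ := (w.map fun s => s.piece.sings).sum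

/-- The exponent of the normalising factor. -/
def framing (w : List Slice) : ℤ := writhe w + rotation w

theorem framing_append (u v : List Slice) : framing (u ++ v) = framing u + framing v := by
  simp [framing, writhe, rotation]; ring

theorem framing_widen (l r : List Bool) (u : List Slice) :
    framing (u.map (Slice.widen l r)) = framing u := by
  simp only [framing, writhe, rotation, List.map_map]
  rfl

theorem framing_cons (s : Slice) (u : List Slice) :
    framing (s :: u) = s.piece.sign + s.piece.turn + framing u := by
  simp [framing, writhe, rotation]; ring

theorem framing_nil : framing [] = 0 := rfl

theorem numSing_append (u v : List Slice) : numSing (u ++ v) = numSing u + numSing v := by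
  simp [numSing]

theorem numSing_widen (l r : List Bool) (u : List Slice) :
    numSing (u.map (Slice.widen l r)) = numSing u := by
  simp only [numSing, List.map_map]
  rfl

theorem numSing_cons (s : Slice) (u : List Slice) :
    numSing (s :: u) = s.piece.sings + numSing u := by
  simp [numSing]

/-- The normalised first minor, as a polynomial in the weight of the singular points. -/
noncomputable def wordPoly (w : List Slice) : Coef := hp (framing w + 1) * wval (w.map Slice.toG)

/-- `Move` does not record the strands at the boundary of the replaced part; a non-empty word
determines them. -/
theorem GFits.source_widen {a a' b b' l r : List Bool} {u : List GSlice} (hu : u ≠ [])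
    (h : GFits a u b) (h' : GFits a' (u.map (GSlice.widen l r)) b') : a' = l ++ a ++ r := by
  cases u with
  | nil => exact absurd rfl hu
  | cons s u => rw [← h'.1, GSlice.ends_widen, h.1]

/-- The effect of a local move. -/
structure LocalInvariance (u v : List Slice) (a b : List Bool) : Prop where
  ne_nil : u ≠ []
  fits : GFits a (u.map Slice.toG) b
  sings : numSing u = numSing v
  wval_eq : ∀ x y l r, GFits [] x (l ++ a ++ r) → GFits (l ++ b ++ r) y [] →
    hp (framing u) * wval (x ++ (u.map Slice.toG).map (GSlice.widen l r) ++ y) =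
      hp (framing v) * wval (x ++ (v.map Slice.toG).map (GSlice.widen l r) ++ y)

theorem Transfer.localInvariance {u v : List Slice} {a b : List Bool}
    (h : Transfer a b (u.map Slice.toG) (v.map Slice.toG)) (hu : u ≠ [])
    (hs : numSing u = numSing v) (hf : framing u = framing v) : LocalInvariance u v a b where
  ne_nil := hu
  fits := h.fits_left
  sings := hs
  wval_eq x y l r hx hy := by rw [hf, (h.widen l r).wval_eq hx hy]

theorem Piece.exists_toG_eq_vert {p : Piece} (h : p.src = [up, up]) (h' : p.tgt = [up, up]) :
    ∃ s, p.toG = .vert s := by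
  cases p with
  | cup x => simp [Piece.src] at h
  | cap x => simp [Piece.tgt] at h'
  | crossing e => exact ⟨_, rfl⟩
  | sing => exact ⟨_, rfl⟩

/-- All moves except the kinks preserve both the minor and the exponent `framing`. A kink multiplies
the minor by `s` or `s T⁻¹`, and for `s = 1` and `s = T` the change of writhe plus rotation number
cancels this factor. -/
theorem LocalMove.localInvariance {u v : List Slice} (h : LocalMove u v) :
    ∃ a b, LocalInvariance u v a b := by
  induction h with
  | zig x =>
    refine ⟨_, _, Transfer.localInvariance (transfer_zig x) (by simp) rfl ?_⟩
    cases x <;> simp [framing_cons, framing_nil, Piece.sign, Piece.turn]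
  | zag x =>
    refine ⟨_, _, Transfer.localInvariance (transfer_zag x) (by simp) rfl ?_⟩
    cases x <;> simp [framing_cons, framing_nil, Piece.sign, Piece.turn]
  | interchange p q m =>
    refine ⟨_, _, Transfer.localInvariance (a := p.toG.ends false ++ m ++ q.toG.ends false)
      (b := p.toG.ends true ++ m ++ q.toG.ends true) ?_ (by simp) ?_ ?_⟩
    · have := transfer_interchange p.toG q.toG m
      simp only [Piece.ends_toG_false, Piece.ends_toG_true] at this ⊢
      exact this
    · simp [numSing_cons]; ring
    · simp only [framing_cons]; ring
  | rotate p hp hp' =>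
    obtain ⟨s, hs⟩ := Piece.exists_toG_eq_vert hp hp'
    refine ⟨[false, false], [false, false], Transfer.localInvariance ?_ (by simp) rfl ?_⟩
    · have := transfer_rotate s
      rw [← hs] at this
      exact this
    · simp only [framing_cons, framing_nil, Piece.sign, Piece.turn]; ring
  | kinkR e =>
    refine ⟨[true], [true], by simp, ?_, rfl, fun x y l r hx hy => ?_⟩
    · simp [GFits, GSlice.ends, GPiece.ends, Slice.toG, Piece.toG]
    · have := wval_kinkR (crossingWeight e) hx hy
      refine (congrArg _ this).trans ?_
      cases e
      · have h : framing [⟨[up], .cup up, []⟩, ⟨[], .crossing false, [dn]⟩,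
          ⟨[up], .cap up, []⟩] = -2 := rfl
        rw [h, framing_nil, hp_zero, List.map_nil, List.map_nil, List.append_nil]
        simp only [crossingWeight, Bool.false_eq_true, if_false]
        linear_combination wval (x ++ y) * hp_two_mul
      · have h : framing [⟨[up], .cup up, []⟩, ⟨[], .crossing true, [dn]⟩,
          ⟨[up], .cap up, []⟩] = 0 := rfl
        rw [h, framing_nil, hp_zero, List.map_nil, List.map_nil, List.append_nil]
        simp [crossingWeight]
  | kinkL e =>
    refine ⟨[true], [true], by simp, ?_, rfl, fun x y l r hx hy => ?_⟩
    · simp [GFits, GSlice.ends, GPiece.ends, Slice.toG, Piece.toG]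
    · have := wval_kinkL (crossingWeight e) hx hy
      refine (congrArg _ this).trans ?_
      cases e
      · have h : framing [⟨[], .cup dn, [up]⟩, ⟨[dn], .crossing false, []⟩,
          ⟨[], .cap dn, [up]⟩] = 0 := rfl
        rw [h, framing_nil, hp_zero, List.map_nil, List.map_nil, List.append_nil]
        simp only [crossingWeight, Bool.false_eq_true, if_false]
        linear_combination wval (x ++ y) * hp_two_mul
      · have h : framing [⟨[], .cup dn, [up]⟩, ⟨[dn], .crossing true, []⟩,
          ⟨[], .cap dn, [up]⟩] = 2 := rfl
        rw [h, framing_nil, hp_zero, List.map_nil, List.map_nil, List.append_nil]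
        simp only [crossingWeight, if_true]
        linear_combination wval (x ++ y) * hp_two_mul
  | cancel e =>
    refine ⟨_, _, Transfer.localInvariance (transfer_cancel (inverse_crossingWeight e))
      (by simp) rfl ?_⟩
    cases e <;> rfl
  | cancelRL e =>
    refine ⟨_, _, Transfer.localInvariance (transfer_cancelRL (inverse_crossingWeight e))
      (by simp [sideR]) rfl ?_⟩
    cases e <;> rfl
  | cancelLR e =>
    refine ⟨_, _, Transfer.localInvariance (transfer_cancelLR (inverse_crossingWeight e))
      (by simp [sideL]) rfl ?_⟩
    cases e <;> rfl
  | braid e =>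
    exact ⟨_, _, Transfer.localInvariance (transfer_slide (crossingWeight_eq e) _)
      (by simp) rfl rfl⟩
  | slide e =>
    exact ⟨_, _, Transfer.localInvariance (transfer_slide (crossingWeight_eq e) _)
      (by simp) rfl (by cases e <;> rfl)⟩
  | flip e =>
    exact ⟨_, _, Transfer.localInvariance (transfer_flip (crossingWeight e) _)
      (by simp) rfl (by cases e <;> rfl)⟩

theorem Move.invariance {D D' : Diagram} (h : Move D D') :
    numSing D.slices = numSing D'.slices ∧ wordPoly D.slices = wordPoly D'.slices := by
  obtain ⟨x, y, l, r, u, v, hm, h1, h2⟩ := h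
  obtain ⟨a, b, hi⟩ := hm.localInvariance
  have hc := fits_iff.1 D.closed
  rw [h1, List.map_append, List.map_append, map_widen_toG] at hc
  obtain ⟨b', hc', hy⟩ := gfits_append.1 hc
  obtain ⟨a', hx, hu⟩ := gfits_append.1 hc'
  obtain rfl := hi.fits.source_widen (by simpa using hi.ne_nil) hu
  obtain rfl := (hi.fits.widen l r).unique hu
  have hw := hi.wval_eq _ _ l r hx hy
  constructor
  · simp only [h1, h2, numSing_append, numSing_widen, hi.sings]
  · simp only [wordPoly, h1, h2, framing_append, framing_widen, List.map_append, map_widen_toG,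
      hp_add]
    linear_combination hp (framing x) * hp (framing y) * hp 1 * hw

/-! ### Comparison with the Alexander matrix -/

theorem Piece.length_ends_toG (p : Piece) (a : Bool) : (p.toG.ends a).length = p.width a := by
  cases a
  · rw [p.ends_toG_false]; rfl
  · rw [p.ends_toG_true]; rfl

theorem Piece.coeff_eq_zero {p : Piece} {a : Bool} {i : ℕ} (h : ¬ p.toG.IsOut a i) (b : Bool)
    (j : ℕ) : p.coeff a i b j = 0 := by
  contrapose! h
  revert h
  unfold Piece.coeff
  split <;> simp [GPiece.IsOut, Piece.toG, GPiece.ends]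

/-- Because of this, only the owning slice of a point contributes to the sum in `relCoeff`. -/
theorem Slice.coeff_eq_zero {s : Slice} {a : Bool} {i : ℕ} (h : ¬ s.toG.IsOut a i) (b : Bool)
    (j : ℕ) : s.coeff a i b j = 0 := by
  rw [GSlice.isOut_iff] at h
  push Not at h
  obtain ⟨h1, h2, h3⟩ := h
  unfold Slice.coeff
  dsimp only
  split_ifs with c1 c2 c3 c4 c5
  · exact absurd c2.2.1 h1
  · rfl
  · exact Piece.coeff_eq_zero (h2 (i - s.left.length)
      (show i = s.left.length + _ by omega)) _ _
  · rfl
  · refine absurd c5.2.1 (h3 _ ?_)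
    rw [show s.toG.piece = s.piece.toG from rfl, Piece.length_ends_toG,
      show s.toG.left = s.left from rfl]
    omega
  · rfl

theorem hp_eq_C (n : ℤ) : hp n = Polynomial.C (halfPow n) := rfl

/-- The label which is `1` at the position `j` and `0` otherwise. -/
noncomputable def mark (t : Prop) [Decidable t] (j i : ℕ) : Coef := if t ∧ i = j then 1 else 0

/-- Evaluating `out` on the indicator of one position extracts a column of coefficients. Singular
pieces are excluded because `Piece.coeff` vanishes on them. -/
theorem Piece.out_toG {p : Piece} (hp : p ≠ .sing) (t : Bool → Prop) [DecidablePred t] (j : ℕ)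
    {a : Bool} {i : ℕ} (h : p.toG.IsOut a i) :
    p.toG.out (mark (t false) j) (mark (t true) j) a i =
      ∑ b, if t b then Polynomial.C (if j < p.width b then p.coeff a i b j else 0) else 0 := by
  rw [Fintype.sum_bool]
  rcases p with x | x | e | _
  · rcases i with _ | _ | i <;> cases x <;> cases a <;>
      simp [GPiece.IsOut, Piece.toG, GPiece.ends] at h <;> rcases j with _ | _ | j <;>
      simp [mark, Piece.coeff, GPiece.out, Piece.toG, Piece.width, Piece.src, Piece.tgt]
  · rcases i with _ | _ | i <;> cases x <;> cases a <;>
      simp [GPiece.IsOut, Piece.toG, GPiece.ends] at h <;> rcases j with _ | _ | j <;>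
      simp [mark, Piece.coeff, GPiece.out, Piece.toG, Piece.width, Piece.src, Piece.tgt]
  · rcases i with _ | _ | i <;> cases e <;> cases a <;>
      simp [GPiece.IsOut, Piece.toG, GPiece.ends] at h <;> rcases j with _ | _ | j <;>
      simp [mark, Piece.coeff, GPiece.out, Piece.toG, Piece.width, Piece.src, Piece.tgt,
        crossingWeight, hp_two_mul, ← hp_eq_C]
  · exact absurd rfl hp

theorem GPiece.out_zero (p : GPiece) (a : Bool) (i : ℕ) :
    p.out (fun _ => 0) (fun _ => 0) a i = 0 := by
  rcases p with x | x | s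
  · rfl
  · rfl
  · cases i <;> simp [GPiece.out]

theorem Slice.out_toG {s : Slice} (hs : s.piece ≠ .sing) (t : Bool → Prop) [DecidablePred t]
    (j : ℕ) {a : Bool} {i : ℕ} (h : s.toG.IsOut a i) :
    s.toG.out (mark (t false) j) (mark (t true) j) a i =
      ∑ b, if t b then Polynomial.C (s.coeff a i b j) else 0 := by
  replace h := (s.toG.isOut_iff a i).1 h
  rcases h with h | ⟨i, rfl, h⟩ | ⟨i, rfl, h⟩
  · rw [s.toG.out_left _ _ _ h, Fintype.sum_bool]
    replace h : s.left[i]? = some a := h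
    have hi : i < s.left.length := (List.getElem?_eq_some_iff.1 h).1
    by_cases hj : i = j
    · subst hj
      have hl : s.left[i] = a := (List.getElem?_eq_some_iff.1 h).2
      cases a <;> simp [Slice.coeff, hi, hl, mark]
    · cases a <;> simp [Slice.coeff, hi, mark, hj, Ne.symm hj]
  · rw [s.toG.out_piece _ _ _ h]
    have hi : i < s.piece.width a := by
      rw [← Piece.length_ends_toG]; exact (List.getElem?_eq_some_iff.1 h).1
    simp only [show s.toG.left = s.left from rfl, show s.toG.piece = s.piece.toG from rfl] at h ⊢
    simp only [Slice.coeff, show ¬ (s.left.length + i < s.left.length) by omega, if_false,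
      show s.left.length + i < s.left.length + s.piece.width a by omega, if_true,
      Nat.add_sub_cancel_left]
    by_cases hj : j < s.left.length
    · have h0 : ∀ t : Prop, ∀ _ : Decidable t,
          (fun j' => mark t j (s.left.length + j')) = fun _ => 0 := by
        intro t _; funext j'; simp only [mark]; rw [if_neg]; omega
      rw [h0, h0, GPiece.out_zero]
      simp [show ¬ s.left.length ≤ j by omega]
    · obtain ⟨j, rfl⟩ : ∃ j', j = s.left.length + j' := ⟨j - s.left.length, by omega⟩
      have h0 : ∀ t : Prop, ∀ _ : Decidable t,
          (fun j' => mark t (s.left.length + j) (s.left.length + j')) = mark t j := by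
        intro t _; funext j'; simp only [mark, Nat.add_left_cancel_iff]
      rw [h0, h0, Piece.out_toG hs t j h]
      simp
  · rw [s.toG.out_right, Fintype.sum_bool]
    replace h : s.right[i]? = some a := h
    simp only [show s.toG.left = s.left from rfl, show s.toG.piece = s.piece.toG from rfl,
      Piece.length_ends_toG]
    have h1 : ¬ (s.left.length + s.piece.width a + i < s.left.length) := by omega
    have h2 : ¬ (s.left.length + s.piece.width a + i < s.left.length + s.piece.width a) := by omega
    have hc : ∀ b, s.coeff a (s.left.length + s.piece.width a + i) b j =
        if j = s.left.length + s.piece.width b + i ∧ b = !a then 1 else 0 := by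
      intro b
      simp only [Slice.coeff, if_neg h1, if_neg h2, Nat.add_sub_cancel_left, h, true_and]
    rw [hc, hc]
    by_cases hj : s.left.length + s.piece.width (!a) + i = j
    · subst hj
      cases a <;> simp [mark]
    · have hj' := Ne.symm hj
      cases a <;> simp only [Bool.not_false, Bool.not_true] at hj hj' <;> simp [mark, hj, hj']

theorem level_eq {w : List Slice} (hw : Fits [] w []) {k : ℕ} (hk : k ≤ w.length) :
    level w k = levFrom [] (w.map Slice.toG) k := by
  cases k with
  | zero => rw [levFrom_zero]; rfl
  | succ k =>
    have := gfits_tgt (fits_iff.1 hw) (k := k) (by simpa using hk)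
    rw [← this, List.getElem_map, Slice.ends_toG_true, level,
      List.getElem?_eq_getElem (by omega)]
    rfl

/-- The points of a word, as points of the weighted diagram. -/
noncomputable def ptEquiv {w : List Slice} (hw : Fits [] w []) :
    Pt w ≃ (ofWord (w.map Slice.toG) (fits_iff.1 hw)).Pt where
  toFun P := ⟨⟨P.1, P.1.2.trans_eq (by simp [ofWord])⟩, ⟨P.2, by
    exact lt_of_lt_of_eq P.2.2 (congrArg _ (level_eq hw (Nat.lt_succ_iff.1 P.1.2)))⟩⟩
  invFun P := ⟨⟨P.1, by have := P.1.2; simp only [ofWord, List.length_map] at this; exact this⟩,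
    ⟨P.2, by
      have h := P.1.2
      simp only [ofWord, List.length_map] at h
      exact lt_of_lt_of_eq P.2.2 (congrArg _ (level_eq hw (Nat.lt_succ_iff.1 h)).symm)⟩⟩
  left_inv P := rfl
  right_inv P := rfl

theorem mat_toG {w : List Slice} (hw : Fits [] w []) (hn : ∀ s ∈ w, s.piece ≠ Piece.sing)
    (P Q : Pt w) :
    (ofWord (w.map Slice.toG) (fits_iff.1 hw)).mat (ptEquiv hw P) (ptEquiv hw Q) =
      Polynomial.C (alexanderMatrix w P Q) := by
  rw [Stack.mat_apply]
  obtain ⟨k, hk, a, h1, h2, -, h3⟩ :=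
    (ofWord (w.map Slice.toG) (fits_iff.1 hw)).owner_spec (ptEquiv hw P)
  rw [h3, alexanderMatrix, Matrix.sub_apply, map_sub]
  set S := ofWord (w.map Slice.toG) (fits_iff.1 hw) with hS
  have hSn : S.n = w.length := by simp [hS, ofWord]
  have hsl : ∀ k (hk : k < w.length), S.sl k = (w[k]).toG := by
    intro k hk
    simp [hS, ofWord, hk]
  have hkw : k < w.length := hSn ▸ hk
  have hY : ∀ k, S.ext (Pi.single (ptEquiv hw Q) 1) k =
      mark (Q.1.val = k) Q.2.val := by
    intro k; funext i; rw [S.ext_single, mark]; simp only [eq_comm]; rfl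
  rw [S.ext_pt]
  congr 1
  · simp [Pi.single_apply, Matrix.one_apply]
  · rw [hY, hY, hsl k hkw]
    rw [hsl k hkw] at h2
    -- The predicate records whether the column point `Q` lies on the bottom or on the top line of
    -- the owning slice.
    have h4 := Slice.out_toG (hn _ (List.getElem_mem hkw)) (fun b => Q.1.val = k + b.toNat)
      Q.2.val h2
    have h5 : relCoeff w P Q = ∑ b : Bool,
        if Q.1.val = k + b.toNat then (w[k]).coeff a P.2 b Q.2 else 0 := by
      rw [relCoeff, Finset.sum_eq_single (⟨k, hkw⟩ : Fin w.length), Finset.sum_eq_single (a : Bool)]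
      · refine Finset.sum_congr rfl fun b _ => ?_
        have h1' : P.1.val = k + a.toNat := h1
        simp only [h1', true_and]
        rfl
      · intro a' _ ha'
        have h1' : P.1.val = k + a.toNat := h1
        refine Finset.sum_eq_zero fun b _ => if_neg fun h => ?_
        have : a.toNat = a'.toNat := by have := h.1; simp only at this; omega
        revert this ha'; cases a <;> cases a' <;> simp
      · simp
      · intro k' _ hk'
        refine Finset.sum_eq_zero fun a' _ => Finset.sum_eq_zero fun b _ => ?_
        split_ifs with h
        · refine Slice.coeff_eq_zero (fun h5 => hk' ?_) _ _
          have h1' : P.1.val = k + a.toNat := h1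
          have h6 := S.ends_eq (k'.2.trans_eq hSn.symm) a'
          rw [hsl _ k'.2] at h6
          have h7 := S.ends_eq hk a
          rw [hsl _ hkw] at h7
          rw [GSlice.IsOut] at h2 h5
          rw [h7, ← h1'] at h2
          have h5' : (S.lev (k'.val + a'.toNat))[P.2.val]? = some a' := h6 ▸ h5
          rw [← h.1] at h5'
          have h8 : a' = a := by
            have := h5'.symm.trans h2
            simpa using this
          subst h8
          apply Fin.ext
          have := h.1
          simp only
          omega
        · rfl
      · simp
    refine h4.trans ?_
    rw [h5, map_sum]
    refine Finset.sum_congr rfl fun b _ => ?_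
    rw [apply_ite Polynomial.C, map_zero]
    rfl

theorem wordPoly_eq_alexander {D : Diagram} (hD : D.IsNonsingular) :
    wordPoly D.slices = Polynomial.C D.alexander := by
  obtain ⟨w, hne, hw⟩ := D
  simp only [wordPoly, Diagram.alexander]
  simp only [Diagram.IsNonsingular] at hD
  obtain ⟨x, w', hwdef⟩ : ∃ x w', w = ⟨[], .cup x, []⟩ :: w' := by
    rcases w with _ | ⟨⟨l, p, r⟩, w'⟩
    · exact absurd rfl hne
    · have := hw.1
      rcases p with x | x | e | _ <;> simp [Slice.src, Piece.src] at this
      obtain ⟨rfl, rfl⟩ := this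
      exact ⟨x, w', rfl⟩
  have hlev : level w 1 = [x, !x] := by simp [hwdef, level, Slice.tgt, Piece.tgt]
  let B : Pt w := ⟨⟨1, by simp [hwdef]⟩, ⟨0, by simp [hlev]⟩⟩
  have hB : ∀ P : Pt w, IsBase P ↔ P = B := by
    intro P
    constructor
    · rintro ⟨h1, h2⟩
      obtain ⟨⟨k, hk⟩, ⟨i, hi⟩⟩ := P
      simp only at h1 h2
      subst h1 h2
      rfl
    · rintro rfl; exact ⟨rfl, rfl⟩
  rw [wval_eq (fits_iff.1 hw)]
  set S := ofWord (w.map Slice.toG) (fits_iff.1 hw) with hS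
  rw [S.val_eq (ptEquiv hw B)]
  have h1 : S.mat.submatrix (ptEquiv hw) (ptEquiv hw) =
      (Polynomial.C : ℤ[T;T⁻¹] →+* Coef).mapMatrix (alexanderMatrix w) := by
    ext1 P Q
    exact mat_toG hw hD P Q
  have h2 : S.mat.adjugate (ptEquiv hw B) (ptEquiv hw B) =
      (S.mat.submatrix (ptEquiv hw) (ptEquiv hw)).adjugate B B := by
    rw [Matrix.adjugate_submatrix_equiv_self]
    rfl
  rw [h2, h1, ← RingHom.map_adjugate, RingHom.mapMatrix_apply, Matrix.map_apply,
    adjugate_diag_eq_det_minor _ IsBase B hB, map_mul, ← hp_eq_C]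
  -- The weight of the base point has exponent `0` or `2`. Together with the summand `1` in
  -- `wordPoly` this leaves `1` or `-1`, which is `baseSign`.
  have h3 : regionExp (S.lev (ptEquiv hw B).1) (ptEquiv hw B).2 = if x then 0 else 2 := by
    have : S.lev 1 = [x, !x] := by
      rw [← hlev, level_eq hw (by simp [hwdef])]; rfl
    exact (congrArg (fun l => regionExp l 0) this).trans rfl
  have h4 : baseSign w = if x then 1 else -1 := by
    simp only [hwdef, baseSign, List.head?_cons]
    cases x <;> rfl
  rw [h3, h4, show writhe w + rotation w + (if x then 1 else -1 : ℤ) =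
    framing w + 1 + -(if x then 0 else 2) by cases x <;> simp [framing]; ring,
    hp_add (framing w + 1)]
  ring

/-! ### The invariant of singular links -/

theorem GFits.split_vert {x y : List GSlice} {l r : List Bool} {s : Coef}
    (h : GFits [] (x ++ ⟨l, .vert s, r⟩ :: y) []) :
    GFits [] x (l ++ [true, true] ++ r) ∧ GFits (l ++ [true, true] ++ r) y [] := by
  obtain ⟨b, hx, h1, hy⟩ := gfits_append.1 h
  obtain rfl : l ++ [true, true] ++ r = b := h1
  exact ⟨hx, hy⟩

theorem Fits.split_vertical {x y : List Slice} {l r : List Bool} {p : Piece}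
    (hp : p.src = [up, up]) (hp' : p.tgt = [up, up]) (h : Fits [] (x ++ ⟨l, p, r⟩ :: y) []) :
    GFits [] (x.map Slice.toG) (l ++ [true, true] ++ r) ∧
      GFits (l ++ [true, true] ++ r) (y.map Slice.toG) [] := by
  rw [fits_iff, List.map_append, List.map_cons] at h
  obtain ⟨s, hs⟩ := Piece.exists_toG_eq_vert hp hp'
  rw [Slice.toG, hs] at h
  exact h.split_vert

/-- The polynomial of a word in which a singular point is replaced. -/
theorem wordPoly_vertical {x y : List Slice} {l r : List Bool} {p : Piece} {s : Coef}
    (hs : p.toG = .vert s) :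
    wordPoly (x ++ ⟨l, p, r⟩ :: y) = hp (framing (x ++ y) + 1) * hp (p.sign + p.turn) *
      wval (x.map Slice.toG ++ ⟨l, .vert s, r⟩ :: y.map Slice.toG) := by
  simp only [wordPoly, framing_append, framing_cons, List.map_append, List.map_cons, Slice.toG, hs]
  rw [← hp_add]
  congr 2
  ring

/-- The polynomials of the four diagrams of a resolution. -/
theorem wordPoly_resolution {x y : List Slice} {l r : List Bool}
    (h : Fits [] (x ++ ⟨l, .sing, r⟩ :: y) []) : ∃ f₀ f : Coef,
    wordPoly (x ++ y) = f₀ ∧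
    wordPoly (x ++ ⟨l, .sing, r⟩ :: y) = f₀ + Polynomial.X * f ∧
    wordPoly (x ++ ⟨l, .crossing true, r⟩ :: y) = hp 1 * (f₀ + f) ∧
    wordPoly (x ++ ⟨l, .crossing false, r⟩ :: y) = hp (-1) * (f₀ + hp 2 * f) := by
  obtain ⟨hx, hy⟩ := h.split_vertical rfl rfl
  -- Here `f` is the slope of the affine dependence on the weight. The factors `hp 1` and `hp (-1)`
  -- come from the writhe of the inserted crossing, and `hp 2` is the weight of the negative one.
  refine ⟨_, hp (framing (x ++ y) + 1) *
    (wval (x.map Slice.toG ++ ⟨l, .vert 1, r⟩ :: y.map Slice.toG) -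
      wval (x.map Slice.toG ++ y.map Slice.toG)), rfl, ?_, ?_, ?_⟩
  · rw [wordPoly_vertical rfl, wval_vert hx hy, wordPoly, List.map_append]
    simp only [Piece.sign, Piece.turn, add_zero, hp_zero]
    ring
  · rw [wordPoly_vertical rfl, wordPoly, List.map_append]
    simp only [Piece.sign, Piece.turn, add_zero, crossingWeight, if_true]
    ring
  · rw [wordPoly_vertical rfl, wval_vert hx hy, wordPoly, List.map_append]
    simp only [Piece.sign, Piece.turn, add_zero, crossingWeight, Bool.false_eq_true, if_false]
    ring

/-- Every word with a singular point has a factorisation at a singular point. -/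
theorem exists_sing {w : List Slice} (h : ¬ ∀ s ∈ w, s.piece ≠ Piece.sing) :
    ∃ x y l r, w = x ++ ⟨l, .sing, r⟩ :: y := by
  push Not at h
  obtain ⟨⟨l, p, r⟩, h1, rfl⟩ := h
  obtain ⟨x, y, rfl⟩ := List.append_of_mem h1
  exact ⟨x, y, l, r, rfl⟩

theorem numSing_eq_zero {w : List Slice} (h : ∀ s ∈ w, s.piece ≠ Piece.sing) : numSing w = 0 := by
  induction w with
  | nil => rfl
  | cons s w ih =>
    rw [numSing_cons, ih fun t ht => h t (List.mem_cons_of_mem _ ht), add_zero]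
    have := h s List.mem_cons_self
    revert this
    rcases s.piece with x | x | e | _ <;> simp [Piece.sings]

theorem fits_replace {x y : List Slice} {l r : List Bool} {p q : Piece} (h1 : p.src = q.src)
    (h2 : p.tgt = q.tgt) {a b : List Bool} (h : Fits a (x ++ ⟨l, p, r⟩ :: y) b) :
    Fits a (x ++ ⟨l, q, r⟩ :: y) b := by
  induction x generalizing a with
  | nil => simpa [Fits, Slice.src, Slice.tgt, h1, h2] using h
  | cons s x ih => exact ⟨h.1, ih h.2⟩

theorem fits_smooth {x y : List Slice} {l r : List Bool}
    (h : Fits [] (x ++ ⟨l, .sing, r⟩ :: y) []) : Fits [] (x ++ y) [] ∧ x ++ y ≠ [] := by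
  obtain ⟨hx, hy⟩ := h.split_vertical rfl rfl
  refine ⟨?_, ?_⟩
  · rw [fits_iff, List.map_append]
    exact gfits_append.2 ⟨_, hx, hy⟩
  · intro h0
    rw [(List.append_eq_nil_iff.1 h0).1] at hx
    have := congrArg List.length (show [] = l ++ [true, true] ++ r from hx)
    simp at this

/-- Every singular point of a diagram has resolutions. -/
theorem Diagram.exists_resolution {D : Diagram} (hD : ¬ D.IsNonsingular) :
    ∃ Dpos Dneg Dzero : Diagram, IsResolution D Dpos Dneg Dzero ∧
      numSing Dpos.slices + 1 = numSing D.slices ∧ numSing Dzero.slices + 1 = numSing D.slices := by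
  obtain ⟨w, hne, hw⟩ := D
  obtain ⟨x, y, l, r, rfl⟩ := exists_sing hD
  obtain ⟨h0, h1⟩ := fits_smooth hw
  refine ⟨⟨_, by simp, fits_replace (p := .sing) (q := .crossing true) rfl rfl hw⟩,
    ⟨_, by simp, fits_replace (p := .sing) (q := .crossing false) rfl rfl hw⟩, ⟨_, h1, h0⟩,
    ⟨x, y, l, r, rfl, rfl, rfl, rfl⟩, ?_, ?_⟩
  · simp only [numSing_append, numSing_cons, Piece.sings]; omega
  · simp only [numSing_append, numSing_cons, Piece.sings]; omega

/-- By `wordPoly_resolution` the polynomial is `f₀ + X f`, where `f₀` and `f = T^{-1/2} P(K⁺) - f₀`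
come from diagrams with one singular point less. -/
theorem natDegree_wordPoly_le (D : Diagram) :
    (wordPoly D.slices).natDegree ≤ numSing D.slices := by
  induction hn : numSing D.slices generalizing D with
  | zero =>
    have hD : D.IsNonsingular := by
      by_contra h
      obtain ⟨D₁, D₂, D₃, -, h1, -⟩ := D.exists_resolution h
      omega
    rw [wordPoly_eq_alexander hD, Polynomial.natDegree_C]
  | succ n ih =>
    have hD : ¬ D.IsNonsingular := fun h => by
      rw [numSing_eq_zero h] at hn; omega
    obtain ⟨Dp, Dn, Do, ⟨x, y, l, r, e, ep, en, eo⟩, hp', ho⟩ := D.exists_resolution hD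
    have hp1 := ih Dp (by omega)
    have ho1 := ih Do (by omega)
    obtain ⟨f₀, f, h0, h1, h2, -⟩ := wordPoly_resolution (e ▸ D.closed)
    rw [ep, h2] at hp1
    rw [eo, h0] at ho1
    rw [e, h1]
    have hf : f = hp (-1) * (hp 1 * (f₀ + f)) - f₀ := by
      rw [← mul_assoc, ← hp_add]
      simp [hp_zero]
    have hf1 : f.natDegree ≤ n := by
      rw [hf]
      exact (Polynomial.natDegree_sub_le_of_le
        ((Polynomial.natDegree_C_mul_le _ _).trans hp1) ho1).trans (max_self n).le
    refine (Polynomial.natDegree_add_le _ _).trans (max_le (by omega) ?_)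
    refine Polynomial.natDegree_mul_le.trans ?_
    have := Polynomial.natDegree_X_le (R := ℤ[T;T⁻¹])
    omega

/-- The invariant of a word: the leading coefficient of the polynomial. -/
noncomputable def wordInv (w : List Slice) : ℤ[T;T⁻¹] :=
  halfPow (numSing w) * (wordPoly w).coeff (numSing w)

/-- The Alexander polynomial of singular links. -/
noncomputable def Link.alexander : Link → ℤ[T;T⁻¹] :=
  Quot.lift (fun D => wordInv D.slices) fun D D' h => by
    obtain ⟨h1, h2⟩ := h.invariance
    simp only [wordInv, h1, h2]

theorem Link.alexander_of_nonsingular {D : Diagram} (hD : D.IsNonsingular) :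
    Link.alexander D.link = D.alexander := by
  refine (?_ : wordInv D.slices = D.alexander)
  rw [wordInv, numSing_eq_zero hD, wordPoly_eq_alexander hD, Polynomial.coeff_C_zero]
  simp [halfPow_zero]

/-- With `n` singular points left after resolving, compare the coefficient of `X^(n+1)` for `D` with
those of `X^n` for the other three diagrams. -/
theorem Link.alexander_resolution {D Dpos Dneg Dzero : Diagram}
    (h : IsResolution D Dpos Dneg Dzero) :
    Link.alexander Dpos.link = Link.alexander D.link + halfPow 1 * Link.alexander Dzero.link ∧
    Link.alexander Dneg.link =
      Link.alexander D.link + halfPow (-1) * Link.alexander Dzero.link := by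
  obtain ⟨x, y, l, r, e, ep, en, eo⟩ := h
  change wordInv Dpos.slices = wordInv D.slices + halfPow 1 * wordInv Dzero.slices ∧
    wordInv Dneg.slices = wordInv D.slices + halfPow (-1) * wordInv Dzero.slices
  have hdeg := natDegree_wordPoly_le Dzero
  obtain ⟨f₀, f, h0, h1, h2, h3⟩ := wordPoly_resolution (e ▸ D.closed)
  rw [eo, h0] at hdeg
  -- The degree bound for the smoothing ensures that `f₀` does not contribute to the coefficient of
  -- `X^(n+1)`, which is thus that of `X^n` in `f`.
  have hz : f₀.coeff (numSing (x ++ y) + 1) = 0 :=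
    Polynomial.coeff_eq_zero_of_natDegree_lt (by omega)
  have n1 : ∀ e : Bool, numSing (x ++ ⟨l, .crossing e, r⟩ :: y) = numSing (x ++ y) := by
    intro e; simp [numSing_append, numSing_cons, Piece.sings]
  have n2 : numSing (x ++ ⟨l, .sing, r⟩ :: y) = numSing (x ++ y) + 1 := by
    simp only [numSing_append, numSing_cons, Piece.sings]; omega
  rw [e, ep, en, eo]
  simp only [wordInv, n1, n2, h0, h1, h2, h3]
  rw [Polynomial.coeff_add f₀ (Polynomial.X * f), hz, Polynomial.coeff_X_mul]
  simp only [hp_eq_C, Polynomial.coeff_C_mul, Polynomial.coeff_add, Nat.cast_add, Nat.cast_one,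
    halfPow_add, zero_add]
  have h12 : halfPow (-1) * halfPow 2 = halfPow 1 := by rw [← halfPow_add]; norm_num
  constructor
  · ring
  · linear_combination halfPow (numSing (x ++ y)) *
      f.coeff (numSing (x ++ y)) * h12

/-- The values on ordinary links and the relation at singular points determine the invariant. -/
theorem Link.eq_of_resolution {A B : Link → ℤ[T;T⁻¹]}
    (h : ∀ D : Diagram, D.IsNonsingular → A D.link = B D.link)
    (hA : ∀ D Dpos Dneg Dzero : Diagram, IsResolution D Dpos Dneg Dzero →
      A Dpos.link = A D.link + halfPow 1 * A Dzero.link)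
    (hB : ∀ D Dpos Dneg Dzero : Diagram, IsResolution D Dpos Dneg Dzero →
      B Dpos.link = B D.link + halfPow 1 * B Dzero.link) : A = B := by
  have key : ∀ n, ∀ D : Diagram, numSing D.slices = n → A D.link = B D.link := by
    intro n
    induction n with
    | zero =>
      intro D hn
      refine h D ?_
      by_contra h
      obtain ⟨D₁, D₂, D₃, -, h1, -⟩ := D.exists_resolution h
      omega
    | succ n ih =>
      intro D hn
      have hD : ¬ D.IsNonsingular := fun h => by
        rw [numSing_eq_zero h] at hn; omega
      obtain ⟨Dp, Dn, Do, hr, hp', ho⟩ := D.exists_resolution hD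
      -- The value at `D` is the value at `Dp` minus `T^{1/2}` times that at `Do`, and both are
      -- covered by the induction hypothesis.
      have h1 := hA _ _ _ _ hr
      have h2 := hB _ _ _ _ hr
      rw [ih Dp (by omega), ih Do (by omega)] at h1
      exact add_right_cancel (h1.symm.trans h2)
  funext L
  obtain ⟨D, rfl⟩ := Quot.exists_rep L
  exact key _ D rfl

end SingLink

theorem proposition3p1 :
    ∃! A : SingLink.Link → LaurentPolynomial ℤ,
      (∀ D : SingLink.Diagram, D.IsNonsingular → A D.link = D.alexander) ∧
      ∀ D Dpos Dneg Dzero : SingLink.Diagram, SingLink.IsResolution D Dpos Dneg Dzero →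
        A Dpos.link = A D.link + SingLink.halfPow 1 * A Dzero.link ∧
        A Dneg.link = A D.link + SingLink.halfPow (-1) * A Dzero.link := by
  refine ⟨SingLink.Link.alexander, ⟨fun D hD => SingLink.Link.alexander_of_nonsingular hD,
    fun _ _ _ _ h => SingLink.Link.alexander_resolution h⟩, fun A hA => ?_⟩
  exact SingLink.Link.eq_of_resolution
    (fun D hD => (hA.1 D hD).trans (SingLink.Link.alexander_of_nonsingular hD).symm)
    (fun _ _ _ _ h => (hA.2 _ _ _ _ h).1)
    (fun _ _ _ _ h => (SingLink.Link.alexander_resolution h).1)
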